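/- **Setting.** A discrete quantum group $G$ is a multiplier Hopf $*$-algebra $(C_c(G),\Delta)$ whose underlying $*$-algebra is an algebraic direct sum $C_c(G)=\bigoplus_{i\in I}M_{n_i}(\mathbb C)$ of full matrix algebras ($n_i\ge 1$), with comultiplication $\Delta$, counit $\epsilon$ and antipode $S$, extended as usual to the multiplier algebra $\prod_i M_{n_i}(\mathbb C)$. Its completion $C_0(G)$ is the $C^*$-direct sum of the blocks. $G$ is *unimodular* if some faithful positive functional $\varphi$ on $C_c(G)$ is both left and right invariant, that is, $(\mathrm{id}\otimes\varphi)\Delta(f)=\varphi(f)1=(\varphi\otimes\mathrm{id})\Delta(f)$ for all $f\in C_c(G)$. A *unitary antipode* of $G$ is an involutive $*$-antiautomorphism $R$ of $\prod_i M_{n_i}(\mathbb C)$ such that $S(f)=R(FfF^{-1})$ for some family $F=(F_i)_i$ of positive definite matrices. Let $X$ be a set. A *quantum permutation* of $X$ on a Hilbert space $H$ is a family $(u_{xy})_{x,y\in X}$ of projections in $B(H)$ such that every row and every column consists of pairwise orthogonal projections with (strongly convergent) sum $1$. An *$X$-free wreath corepresentation* of $G$ on $H_\pi$ is a pair $\pi=(\pi^G,\pi^X)$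 of a family $\pi^G=(\pi^G_x)_{x\in X}$ of nondegenerate $*$-representations of $C_0(G)$ on $H_\pi$ and a quantum permutation $\pi^X=(\pi^X_{xy})$ of $X$ on $H_\pi$ with $\pi^G_x(f)\pi^X_{xy}=\pi^X_{xy}\pi^G_x(f)$ for all $x,y\in X$, $f\in C_0(G)$. An intertwiner $\pi\to\rho$ is a bounded operator $T:H_\pi\to H_\rho$ with $T\pi^G_x(f)=\rho^G_x(f)T$ and $T\pi^X_{xy}=\rho^X_{xy}T$ for all $x,y\in X$, $f\in C_0(G)$. The finite-dimensional $X$-free wreath corepresentations and their intertwiners form a monoidal category $\mathrm{Corep}(G)\wr_*\mathrm{Sym}^+(X)$: the tensor product lives on $H_\pi\otimes H_\rho$ and is given by $$(\pi\otimes\rho)^G_x(f)=\sum_{y\in X}(\pi^G_x\otimes\rho^G_y)\Delta(f)\,(\pi^X_{xy}\otimes 1),\qquad (\pi\otimes\rho)^X_{xy}=\sum_{z\in X}\pi^X_{xz}\otimes\rho^X_{zy},$$ the tensor unit is $\mathbb C$ with $f\mapsto\epsilon(f)$ for every $x\in X$ and the quantum permutation $(\delta_{xy})$, and the associativity and unit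 isomorphisms are those of Hilbert spaces. Given a unitary antipode $R$, the *contragredient* $\bar\pi$ of $\pi$ is the $X$-free wreath corepresentation on the conjugate Hilbert space $\overline{H_\pi}$ given by $$\bar\pi^G_x(f)\bar\xi=\sum_{y\in X}\overline{\pi^G_y(R(f^*))\,\pi^X_{yx}\,\xi},\qquad \bar\pi^X_{xy}\bar\xi=\overline{\pi^X_{yx}\xi}.$$ **Statement.** Let $G$ be a unimodular discrete quantum group and let $X$ be a set. Then: 1. $G$ has exactly one unitary antipode $R$, so that the contragredient $\bar\pi$ is well defined. 2. Every finite-dimensional $X$-free wreath corepresentation $\pi$ of $G$ is dualisable with dual $\bar\pi$: there are intertwiners $ev_\pi:\bar\pi\otimes\pi\to 1$, $db_\pi:1\to\pi\otimes\bar\pi$ satisfying the zig-zag equations $$(\mathrm{id}_\pi\otimes ev_\pi)(db_\pi\otimes\mathrm{id}_\pi)=\mathrm{id}_\pi,\qquad (ev_\pi\otimes\mathrm{id}_{\bar\pi})(\mathrm{id}_{\bar\pi}\otimes db_\pi)=\mathrm{id}_{\bar\pi},$$ and intertwiners $ev_{\bar\pi}:\pi\otimes\bar\pi\to 1$, $db_{\bar\pi}:1\to\bar\pi\otimes\pi$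 satisfying the same equations with the roles of $\pi$ and $\bar\pi$ exchanged. 3. Consequently the monoidal category $\mathrm{Corep}(G)\wr_*\mathrm{Sym}^+(X)$ is rigid: every object has a left dual and a right dual. -/

import Mathlib

noncomputable section

open scoped TensorProduct ENNReal ComplexOrder

/-! ## Partitions of unity and gluing -/

section Glue

/-- A finite partition of unity in a ring: pairwise orthogonal elements, all but finitely many of
them zero, with sum one. -/
def IsPOU {ι B : Type*} [Ring B] (P : ι → B) : Prop :=
  (∀ i j, i ≠ j → P i * P j = 0) ∧ ∃ s : Finset ι, (∀ i, i ∉ s → P i = 0) ∧ ∑ i ∈ s, P i = 1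

namespace IsPOU

variable {ι B : Type*} [Ring B] {P : ι → B}

theorem idem (h : IsPOU P) (i : ι) : P i * P i = P i := by
  classical
  obtain ⟨h1, s, hs, hsum⟩ := h
  by_cases hi : i ∈ s
  · have : P i * ∑ j ∈ s, P j = P i * P i := by
      rw [Finset.mul_sum]
      exact Finset.sum_eq_single_of_mem i hi (fun j _ hj => h1 i j (Ne.symm hj))
    rw [← this, hsum, mul_one]
  · simp [hs i hi]

theorem ext_right (h : IsPOU P) {a b : B} (hab : ∀ i, a * P i = b * P i) : a = b := by
  obtain ⟨-, s, -, hsum⟩ := h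
  rw [← mul_one a, ← mul_one b, ← hsum, Finset.mul_sum, Finset.mul_sum]
  exact Finset.sum_congr rfl fun i _ => hab i

end IsPOU

variable {ι B : Type*} {R : ι → Type*} [∀ i, Ring (R i)] [∀ i, StarRing (R i)]
  [∀ i, Algebra ℂ (R i)] [Ring B] [StarRing B] [Algebra ℂ B]

/-- The sum of a family of star homomorphisms whose units form a partition of unity. -/
def glueFun (τ : ∀ i, R i →⋆ₙₐ[ℂ] B) (m : ∀ i, R i) : B := ∑ᶠ i, τ i (m i)

variable {τ : ∀ i, R i →⋆ₙₐ[ℂ] B}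

theorem tau_one_mul (i : ι) (a : R i) : τ i 1 * τ i a = τ i a := by
  rw [← map_mul, one_mul]

theorem tau_mul_one (i : ι) (a : R i) : τ i a * τ i 1 = τ i a := by
  rw [← map_mul, mul_one]

theorem tau_mul_ne (h : IsPOU fun i => τ i 1) {i j : ι} (hij : i ≠ j) (a : R i) (b : R j) :
    τ i a * τ j b = 0 := by
  rw [← tau_mul_one i a, ← tau_one_mul j b, mul_assoc, ← mul_assoc (τ i 1), h.1 i j hij]
  simp

theorem glueFun_eq_sum (m : ∀ i, R i) {s : Finset ι} (hs : ∀ i, i ∉ s → τ i 1 = 0) :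
    glueFun τ m = ∑ i ∈ s, τ i (m i) := by
  refine finsum_eq_sum_of_support_subset _ fun i hi => ?_
  by_contra his
  apply hi
  have h0 : τ i (m i) = 0 := by rw [← tau_one_mul, hs i his, zero_mul]
  exact h0

theorem glueFun_mul_tau (h : IsPOU fun i => τ i 1) (m : ∀ i, R i) (i : ι) :
    glueFun τ m * τ i 1 = τ i (m i) := by
  classical
  obtain ⟨s, hs, -⟩ := h.2
  rw [glueFun_eq_sum m (s := insert i s) (fun j hj => hs j fun h' => hj (by simp [h'])),
    Finset.sum_mul, Finset.sum_eq_single_of_mem i (Finset.mem_insert_self _ _)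
      (fun j _ hj => tau_mul_ne h hj _ _), tau_mul_one]

/-- `glueFun` as a unital star homomorphism on the product. -/
def glue (τ : ∀ i, R i →⋆ₙₐ[ℂ] B) (h : IsPOU fun i => τ i 1) : (∀ i, R i) →⋆ₐ[ℂ] B where
  toFun := glueFun τ
  map_one' := by
    obtain ⟨s, hs, hsum⟩ := h.2
    rw [glueFun_eq_sum _ hs]
    simpa using hsum
  map_mul' a b := by
    refine h.ext_right fun i => ?_
    rw [glueFun_mul_tau h, mul_assoc, glueFun_mul_tau h]
    obtain ⟨s, hs, hsum⟩ := h.2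
    rw [← tau_one_mul i (b i), ← mul_assoc, glueFun_mul_tau h, Pi.mul_apply, map_mul]
  map_zero' := by simp [glueFun]
  map_add' a b := by
    refine h.ext_right fun i => ?_
    rw [glueFun_mul_tau h, add_mul, glueFun_mul_tau h, glueFun_mul_tau h, Pi.add_apply, map_add]
  commutes' c := by
    refine h.ext_right fun i => ?_
    rw [glueFun_mul_tau h]
    simp [Algebra.algebraMap_eq_smul_one]
  map_star' a := by
    obtain ⟨s, hs, -⟩ := h.2
    rw [glueFun_eq_sum _ hs, glueFun_eq_sum _ hs]
    simp [map_star]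

theorem glue_apply (h : IsPOU fun i => τ i 1) (m : ∀ i, R i) :
    glue τ h m = ∑ᶠ i, τ i (m i) := rfl

theorem glue_eq_sum (h : IsPOU fun i => τ i 1) (m : ∀ i, R i) {s : Finset ι}
    (hs : ∀ i, i ∉ s → τ i 1 = 0) : glue τ h m = ∑ i ∈ s, τ i (m i) := glueFun_eq_sum m hs

theorem glue_mul_tau (h : IsPOU fun i => τ i 1) (m : ∀ i, R i) (i : ι) :
    glue τ h m * τ i 1 = τ i (m i) := glueFun_mul_tau h m i

theorem tau_mul_glue (h : IsPOU fun i => τ i 1) (m : ∀ i, R i) (i : ι) :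
    τ i 1 * glue τ h m = τ i (m i) := by
  have := congrArg star (glue_mul_tau h (star m) i)
  rw [star_mul, ← map_star, ← map_star, ← map_star] at this
  simpa using this

theorem glue_dependsOn (h : IsPOU fun i => τ i 1) :
    ∃ s : Finset ι, DependsOn (glue τ h) (s : Set ι) := by
  obtain ⟨s, hs, -⟩ := h.2
  refine ⟨s, fun x y hxy => ?_⟩
  rw [glue_eq_sum h x hs, glue_eq_sum h y hs]
  exact Finset.sum_congr rfl fun i hi => by rw [hxy i hi]

end Glue

section FiniteDimensional

/-- In a finite dimensional algebra, only finitely many members of a family of pairwise orthogonal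
idempotents are nonzero. -/
theorem finite_support_of_orthogonal {ι B : Type*} [Ring B] [Algebra ℂ B] [FiniteDimensional ℂ B]
    (P : ι → B) (hP : ∀ i, P i * P i = P i) (hne : ∀ i j, i ≠ j → P i * P j = 0) :
    {i | P i ≠ 0}.Finite := by
  classical
  have hli : LinearIndependent ℂ (fun i : {i | P i ≠ 0} => P i) := by
    rw [linearIndependent_iff']
    intro s g hg i hi
    have h1 : P i * ∑ j ∈ s, g j • P j = g i • P i := by
      rw [Finset.mul_sum, Finset.sum_eq_single_of_mem i hi]
      · rw [mul_smul_comm, hP]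
      · intro j _ hj
        rw [mul_smul_comm, hne _ _ (fun h => hj (Subtype.ext h.symm)), smul_zero]
    rw [hg, mul_zero] at h1
    exact (smul_eq_zero.mp h1.symm).resolve_right i.2
  have : Finite {i | P i ≠ 0} := hli.finite
  exact Set.toFinite _

end FiniteDimensional

section Blocks

open scoped Matrix.Norms.L2Operator

/-- The full matrix block with index `i`, a C*-algebra in the operator norm. -/
abbrev MatBlock {I : Type*} (d : I → ℕ) (i : I) : Type := Matrix (Fin (d i)) (Fin (d i)) ℂ

/-- The full product of the matrix blocks: the multiplier algebra of their algebraic direct sum. -/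
abbrev MatFun {I : Type*} (d : I → ℕ) : Type _ := ∀ i, MatBlock d i

/-- The product of the algebras `M_{d i} ⊗ M_{d j}`: the multiplier algebra of the tensor square of
the algebraic direct sum of the blocks. -/
abbrev MatFun₂ {I : Type*} (d : I → ℕ) : Type _ :=
  ∀ p : I × I, MatBlock d p.1 ⊗[ℂ] MatBlock d p.2

open scoped Classical in
/-- The inclusion of a block in the product of all blocks. -/
def blockIncl {I : Type*} (d : I → ℕ) (i : I) : MatBlock d i →ₗ[ℂ] MatFun d :=
  LinearMap.single ℂ (MatBlock d) i

open scoped Classical in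
/-- The inclusion of a block, as a star homomorphism. -/
def blockHom {I : Type*} (d : I → ℕ) (i : I) : MatBlock d i →⋆ₙₐ[ℂ] MatFun d where
  toFun := blockIncl d i
  map_smul' c a := map_smul _ c a
  map_zero' := map_zero _
  map_add' := map_add _
  map_mul' a b := by
    simp only [blockIncl, LinearMap.coe_single]
    exact Pi.single_mul i a b
  map_star' a := by
    simp only [blockIncl, LinearMap.coe_single]
    exact Pi.single_star i a

theorem blockHom_apply {I : Type*} (d : I → ℕ) (i : I) (a : MatBlock d i) :
    blockHom d i a = blockIncl d i a := rfl

/-- The algebraic direct sum of the blocks, inside their bounded product. -/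
def finSuppBlocks {I : Type*} (d : I → ℕ) : NonUnitalStarSubalgebra ℂ (lp (MatBlock d) ∞) where
  carrier := {f | {i | f i ≠ 0}.Finite}
  add_mem' {f g} hf hg := (hf.union hg).subset fun i hi => by
    by_contra h
    simp only [Set.mem_union, Set.mem_ofPred_eq, not_or, not_not] at h
    exact hi (by simp [h.1, h.2])
  zero_mem' := by simp
  mul_mem' {f g} hf hg := hf.subset fun i hi h => hi (by
    change f i * g i = 0
    rw [h, zero_mul])
  smul_mem' c f hf := hf.subset fun i hi h => hi (by simp [h])
  star_mem' {f} hf := hf.subset fun i hi h => hi (by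
    change star (f i) = 0
    rw [h, star_zero])

/-- The C*-direct sum of the blocks: the norm closure of the algebraic direct sum inside the bounded
product. -/
abbrev c0Blocks {I : Type*} (d : I → ℕ) : NonUnitalStarSubalgebra ℂ (lp (MatBlock d) ∞) :=
  (finSuppBlocks d).topologicalClosure

instance {I : Type*} (d : I → ℕ) : IsClosed (c0Blocks d : Set (lp (MatBlock d) ∞)) :=
  NonUnitalStarSubalgebra.isClosed_topologicalClosure _

instance {I : Type*} (d : I → ℕ) : NonUnitalRing (c0Blocks d) := inferInstance

instance {I : Type*} (d : I → ℕ) : NonUnitalSemiring (c0Blocks d) := inferInstance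

instance {I : Type*} (d : I → ℕ) : NonUnitalNonAssocSemiring (c0Blocks d) := inferInstance

instance {I : Type*} (d : I → ℕ) : AddCommMonoid (c0Blocks d) := inferInstance

instance {I : Type*} (d : I → ℕ) : Mul (c0Blocks d) := inferInstance

/-- An element of the C*-direct sum, as a family of matrices. -/
def c0ToFun {I : Type*} (d : I → ℕ) : c0Blocks d →⋆ₙₐ[ℂ] MatFun d where
  toFun f := fun i => (f : lp (MatBlock d) ∞) i
  map_smul' _ _ := rfl
  map_zero' := rfl
  map_add' _ _ := rfl
  map_mul' _ _ := rfl
  map_star' _ := rfl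

open scoped Classical in
/-- The inclusion of a block in the C*-direct sum. -/
def blockC0 {I : Type*} (d : I → ℕ) (i : I) : MatBlock d i →⋆ₙₐ[ℂ] c0Blocks d where
  toFun a := ⟨lp.single ∞ i a, NonUnitalStarSubalgebra.le_topologicalClosure _ (by
    refine (Set.finite_singleton i).subset fun j hj => ?_
    by_contra h
    exact hj (lp.single_apply_ne ∞ i a h))⟩
  map_smul' c a := by
    ext1; exact lp.single_smul ∞ i c a
  map_zero' := by
    ext1; exact map_zero (lp.singleAddMonoidHom ∞ i)
  map_add' a b := by
    ext1; exact lp.single_add ∞ i a b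
  map_mul' a b := by
    ext1; ext1
    exact Pi.single_mul i a b
  map_star' a := by
    ext1; ext1
    exact Pi.single_star i a

theorem c0ToFun_blockC0 {I : Type*} (d : I → ℕ) (i : I) (a : MatBlock d i) :
    c0ToFun d (blockC0 d i a) = blockIncl d i a := rfl

end Blocks

section QuantumGroup

universe u v

/-- A discrete quantum group, as a multiplier Hopf *-algebra `(A, Δ)` whose underlying *-algebra
`A = ⨁ i, M_{dim i}(ℂ)` is an algebraic direct sum of full matrix algebras.

All structure maps are given by their unital extensions to the multiplier algebras
`M(A) = ∏ i, M_{dim i}(ℂ)` and `M(A ⊗ A) = ∏ (i, j), M_{dim i}(ℂ) ⊗ M_{dim j}(ℂ)`. The extension of a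
nondegenerate map on `A` is characterised by the fact that each matrix block of its value depends on
finitely many blocks of the argument only; this is the content of the `_dependsOn` fields. For the
same reason all sums over blocks below are finite. -/
structure DiscreteQuantumGroup where
  /-- The set of matrix blocks, i.e. of classes of irreducible corepresentations. -/
  Irr : Type u
  /-- The sizes of the blocks. -/
  dim : Irr → ℕ
  dim_pos : ∀ i, 0 < dim i
  /-- The comultiplication `M(A) → M(A ⊗ A)`. -/
  comul : MatFun dim →⋆ₐ[ℂ] MatFun₂ dim
  comul_dependsOn : ∀ p, ∃ s : Finset Irr, DependsOn (fun f => comul f p) (s : Set Irr)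
  /-- `Δ(A)(1 ⊗ A)` is contained in `A ⊗ A`. -/
  comul_finite_left : ∀ l j, {i | comul (blockIncl dim l 1) (i, j) ≠ 0}.Finite
  /-- `(A ⊗ 1)Δ(A)` is contained in `A ⊗ A`. -/
  comul_finite_right : ∀ l i, {j | comul (blockIncl dim l 1) (i, j) ≠ 0}.Finite
  /-- `(Δ ⊗ id)Δ = (id ⊗ Δ)Δ`. -/
  coassoc : ∀ f i j k,
    TensorProduct.assoc ℂ (MatBlock dim i) (MatBlock dim j) (MatBlock dim k)
      (∑ᶠ l, ((LinearMap.proj (i, j) ∘ₗ comul.toAlgHom.toLinearMap ∘ₗ blockIncl dim l).rTensor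
        (MatBlock dim k)) (comul f (l, k))) =
    ∑ᶠ l, ((LinearMap.proj (j, k) ∘ₗ comul.toAlgHom.toLinearMap ∘ₗ blockIncl dim l).lTensor
        (MatBlock dim i)) (comul f (i, l))
  /-- The counit. -/
  counit : MatFun dim →⋆ₐ[ℂ] ℂ
  counit_dependsOn : ∃ s : Finset Irr, DependsOn counit (s : Set Irr)
  /-- `(ε ⊗ id)Δ = id`. -/
  counit_left : ∀ f j,
    ∑ᶠ i, TensorProduct.lid ℂ (MatBlock dim j)
      (((counit.toAlgHom.toLinearMap ∘ₗ blockIncl dim i).rTensor (MatBlock dim j))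
        (comul f (i, j))) = f j
  /-- `(id ⊗ ε)Δ = id`. -/
  counit_right : ∀ f i,
    ∑ᶠ j, TensorProduct.rid ℂ (MatBlock dim i)
      (((counit.toAlgHom.toLinearMap ∘ₗ blockIncl dim j).lTensor (MatBlock dim i))
        (comul f (i, j))) = f i
  /-- The antipode. -/
  antipode : MatFun dim →ₗ[ℂ] MatFun dim
  antipode_dependsOn : ∀ k, ∃ s : Finset Irr, DependsOn (fun f => antipode f k) (s : Set Irr)
  antipode_mul : ∀ f g, antipode (f * g) = antipode g * antipode f
  /-- `m(S ⊗ id)Δ(f) = ε(f)1`. -/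
  antipode_left : ∀ f k,
    ∑ᶠ i, LinearMap.mul' ℂ (MatBlock dim k)
      (((LinearMap.proj k ∘ₗ antipode ∘ₗ blockIncl dim i).rTensor (MatBlock dim k))
        (comul f (i, k))) = counit f • 1
  /-- `m(id ⊗ S)Δ(f) = ε(f)1`. -/
  antipode_right : ∀ f k,
    ∑ᶠ j, LinearMap.mul' ℂ (MatBlock dim k)
      (((LinearMap.proj k ∘ₗ antipode ∘ₗ blockIncl dim j).lTensor (MatBlock dim k))
        (comul f (k, j))) = counit f • 1

namespace DiscreteQuantumGroup

variable (G : DiscreteQuantumGroup.{u})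

/-- The matrix block of `G` with index `i`. -/
abbrev Block (i : G.Irr) : Type := MatBlock G.dim i

/-- The algebra of all (not necessarily bounded) functions on `G`. -/
abbrev Fun : Type u := MatFun G.dim

/-- The C*-algebra `C_0(G)` of functions on `G` vanishing at infinity. -/
abbrev C0 : Type u := c0Blocks G.dim

/-- A left Haar weight on `G`, given by its restrictions `φ i` to the matrix blocks: a faithful
positive functional `φ` on the algebra of finitely supported functions such that
`(id ⊗ φ)Δ(a) = φ(a)1` for all finitely supported `a`. -/
structure IsLeftHaar (φ : ∀ i, G.Block i →ₗ[ℂ] ℂ) : Prop where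
  nonneg : ∀ i (a : G.Block i), 0 ≤ φ i (star a * a)
  faithful : ∀ i (a : G.Block i), φ i (star a * a) = 0 → a = 0
  left_invariant : ∀ l (a : G.Block l) i,
    ∑ᶠ j, TensorProduct.rid ℂ (G.Block i)
      ((φ j).lTensor (G.Block i) (G.comul (blockIncl G.dim l a) (i, j))) = φ l a • 1

/-- A right Haar weight on `G`: a faithful positive functional `φ` on the algebra of finitely
supported functions such that `(φ ⊗ id)Δ(a) = φ(a)1` for all finitely supported `a`. -/
structure IsRightHaar (φ : ∀ i, G.Block i →ₗ[ℂ] ℂ) : Prop where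
  nonneg : ∀ i (a : G.Block i), 0 ≤ φ i (star a * a)
  faithful : ∀ i (a : G.Block i), φ i (star a * a) = 0 → a = 0
  right_invariant : ∀ l (a : G.Block l) j,
    ∑ᶠ i, TensorProduct.lid ℂ (G.Block j)
      ((φ i).rTensor (G.Block j) (G.comul (blockIncl G.dim l a) (i, j))) = φ l a • 1

/-- `G` is unimodular if its left and right Haar weights agree. -/
def IsUnimodular : Prop :=
  ∃ φ : ∀ i, G.Block i →ₗ[ℂ] ℂ, G.IsLeftHaar φ ∧ G.IsRightHaar φ

/-- The unitary antipode `R` is the involutive *-antiautomorphism in the polar decomposition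
`S = R τ` of the antipode, where `τ = τ_{-i/2}` is the analytic generator of the scaling group.
On a discrete quantum group, `τ` is conjugation by a positive invertible element of each block. -/
structure IsUnitaryAntipode (R : G.Fun →ₗ[ℂ] G.Fun) : Prop where
  map_mul : ∀ f g, R (f * g) = R g * R f
  map_star : ∀ f, R (star f) = star (R f)
  involutive : ∀ f, R (R f) = f
  polar : ∃ F : G.Fun, (∀ i, (F i).PosDef) ∧ ∀ f, G.antipode f = R (F * f * F⁻¹)

variable {G}

theorem IsUnitaryAntipode.map_one {R : G.Fun →ₗ[ℂ] G.Fun} (hR : G.IsUnitaryAntipode R) :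
    R 1 = 1 := by
  have h := hR.map_mul (R 1) 1
  rwa [mul_one, hR.involutive, mul_one, eq_comm] at h

end DiscreteQuantumGroup

end QuantumGroup

section Operators

open TensorProduct

variable {H H' H'' K K' K'' L M : Type*}
  [NormedAddCommGroup H] [InnerProductSpace ℂ H] [NormedAddCommGroup H'] [InnerProductSpace ℂ H']
  [NormedAddCommGroup H''] [InnerProductSpace ℂ H'']
  [NormedAddCommGroup K] [InnerProductSpace ℂ K] [NormedAddCommGroup K'] [InnerProductSpace ℂ K']
  [NormedAddCommGroup K''] [InnerProductSpace ℂ K'']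
  [NormedAddCommGroup L] [InnerProductSpace ℂ L] [NormedAddCommGroup M] [InnerProductSpace ℂ M]

/-- The tensor product of (finite dimensional) Hilbert spaces: Mathlib's tensor product with its
inner product. -/
def HTensor (H K : Type*) [NormedAddCommGroup H] [InnerProductSpace ℂ H]
    [NormedAddCommGroup K] [InnerProductSpace ℂ K] : Type _ := H ⊗[ℂ] K

namespace HTensor

instance : NormedAddCommGroup (HTensor H K) := inferInstanceAs (NormedAddCommGroup (H ⊗[ℂ] K))

instance : InnerProductSpace ℂ (HTensor H K) := inferInstanceAs (InnerProductSpace ℂ (H ⊗[ℂ] K))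

instance [FiniteDimensional ℂ H] [FiniteDimensional ℂ K] : FiniteDimensional ℂ (HTensor H K) :=
  inferInstanceAs (Module.Finite ℂ (H ⊗[ℂ] K))

instance [FiniteDimensional ℂ H] [FiniteDimensional ℂ K] : CompleteSpace (HTensor H K) :=
  FiniteDimensional.complete ℂ _

/-- The elementary tensor `a ⊗ b`. -/
def tmul (a : H) (b : K) : HTensor H K := a ⊗ₜ[ℂ] b

/-- The operator `S ⊗ T`. -/
def map (S : H →L[ℂ] H') (T : K →L[ℂ] K') : HTensor H K →L[ℂ] HTensor H' K' :=
  TensorProduct.mapL S T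

@[simp]
theorem map_tmul (S : H →L[ℂ] H') (T : K →L[ℂ] K') (a : H) (b : K) :
    map S T (tmul a b) = tmul (S a) (T b) := rfl

theorem ext {S T : HTensor H K →L[ℂ] M} (h : ∀ a b, S (tmul a b) = T (tmul a b)) : S = T := by
  ext x
  change H ⊗[ℂ] K at x
  induction x using TensorProduct.induction_on with
  | zero => exact (map_zero S).trans (map_zero T).symm
  | tmul a b => exact h a b
  | add x y hx hy => exact (map_add S x y).trans ((congrArg₂ _ hx hy).trans (map_add T x y).symm)

theorem map_comp (S' : H' →L[ℂ] H'') (T' : K' →L[ℂ] K'') (S : H →L[ℂ] H') (T : K →L[ℂ] K') :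
    map (S' ∘L S) (T' ∘L T) = map S' T' ∘L map S T := ext fun _ _ => rfl

theorem map_mul (S' S : H →L[ℂ] H) (T' T : K →L[ℂ] K) :
    map (S' * S) (T' * T) = map S' T' * map S T := ext fun _ _ => rfl

theorem map_one : map (1 : H →L[ℂ] H) (1 : K →L[ℂ] K) = 1 := ext fun _ _ => rfl

theorem map_id : map (.id ℂ H) (.id ℂ K) = .id ℂ (HTensor H K) := ext fun _ _ => rfl

theorem map_zero_left (T : K →L[ℂ] K') : map (0 : H →L[ℂ] H') T = 0 :=
  TensorProduct.mapL_zero_left T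

theorem map_zero_right (S : H →L[ℂ] H') : map S (0 : K →L[ℂ] K') = 0 :=
  TensorProduct.mapL_zero_right S

theorem star_map [FiniteDimensional ℂ H] [FiniteDimensional ℂ K] [CompleteSpace H] [CompleteSpace K]
    (S : H →L[ℂ] H) (T : K →L[ℂ] K) : star (map S T) = map (star S) (star T) := by
  have : CompleteSpace (H ⊗[ℂ] K) := FiniteDimensional.complete ℂ _
  exact TensorProduct.adjoint_mapL S T

/-- The bilinear map `(S, T) ↦ S ⊗ T` on operators. -/
def mapBilin (H K : Type*) [NormedAddCommGroup H] [InnerProductSpace ℂ H]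
    [NormedAddCommGroup K] [InnerProductSpace ℂ K] :
    (H →L[ℂ] H) →ₗ[ℂ] (K →L[ℂ] K) →ₗ[ℂ] (HTensor H K →L[ℂ] HTensor H K) :=
  LinearMap.mk₂ ℂ map mapL_add_left mapL_smul_left mapL_add_right mapL_smul_right

theorem mapBilin_apply (S : H →L[ℂ] H) (T : K →L[ℂ] K) : mapBilin H K S T = map S T := rfl

theorem sum_map {ι : Type*} (s : Finset ι) (S : ι → H →L[ℂ] H) (T : K →L[ℂ] K) :
    map (∑ i ∈ s, S i) T = ∑ i ∈ s, map (S i) T :=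
  map_sum ((mapBilin H K).flip T) S s

theorem map_sum' {ι : Type*} (s : Finset ι) (S : H →L[ℂ] H) (T : ι → K →L[ℂ] K) :
    map S (∑ i ∈ s, T i) = ∑ i ∈ s, map S (T i) :=
  map_sum (mapBilin H K S) T s

/-- The associativity isomorphism. -/
def assoc (H K L : Type*) [NormedAddCommGroup H] [InnerProductSpace ℂ H]
    [NormedAddCommGroup K] [InnerProductSpace ℂ K] [NormedAddCommGroup L] [InnerProductSpace ℂ L] :
    HTensor (HTensor H K) L ≃ₗᵢ[ℂ] HTensor H (HTensor K L) :=
  TensorProduct.assocIsometry ℂ H K L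

@[simp]
theorem assoc_tmul (a : H) (b : K) (c : L) :
    assoc H K L (tmul (tmul a b) c) = tmul a (tmul b c) := rfl

@[simp]
theorem assoc_symm_tmul (a : H) (b : K) (c : L) :
    (assoc H K L).symm (tmul a (tmul b c)) = tmul (tmul a b) c := rfl

/-- The left unit isomorphism. -/
def lid (H : Type*) [NormedAddCommGroup H] [InnerProductSpace ℂ H] : HTensor ℂ H ≃ₗᵢ[ℂ] H :=
  TensorProduct.lidIsometry ℂ H

@[simp]
theorem lid_tmul (c : ℂ) (a : H) : lid H (tmul c a) = c • a := rfl

@[simp]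
theorem lid_symm_apply (a : H) : (lid H).symm a = tmul 1 a := rfl

/-- The right unit isomorphism. -/
def rid (H : Type*) [NormedAddCommGroup H] [InnerProductSpace ℂ H] : HTensor H ℂ ≃ₗᵢ[ℂ] H :=
  TensorProduct.ridIsometry ℂ H

@[simp]
theorem rid_tmul (c : ℂ) (a : H) : rid H (tmul a c) = c • a := rfl

@[simp]
theorem rid_symm_apply (a : H) : (rid H).symm a = tmul a 1 := rfl

theorem tmul_smul' (c : ℂ) (a : H) (b : K) : tmul a (c • b) = tmul (c • a) b :=
  (TensorProduct.smul_tmul c a b).symm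

theorem lid_naturality (T : H →L[ℂ] H') : (lid H' : HTensor ℂ H' →L[ℂ] H') ∘L map (.id ℂ ℂ) T =
    T ∘L (lid H : HTensor ℂ H →L[ℂ] H) := ext fun c ξ => (map_smul T c ξ).symm

theorem rid_naturality (T : H →L[ℂ] H') : (rid H' : HTensor H' ℂ →L[ℂ] H') ∘L map T (.id ℂ ℂ) =
    T ∘L (rid H : HTensor H ℂ →L[ℂ] H) := ext fun ξ c => (map_smul T c ξ).symm

theorem ext₃ {S T : HTensor (HTensor H K) L →L[ℂ] M}
    (h : ∀ a b c, S (tmul (tmul a b) c) = T (tmul (tmul a b) c)) : S = T := by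
  refine ext fun x c => ?_
  change H ⊗[ℂ] K at x
  induction x using TensorProduct.induction_on with
  | zero =>
    have h0 : tmul (0 : HTensor H K) c = 0 := TensorProduct.zero_tmul _ c
    exact (congrArg S h0).trans ((map_zero S).trans
      ((map_zero T).symm.trans (congrArg T h0.symm)))
  | tmul a b => exact h a b c
  | add x y hx hy =>
    have h0 : tmul (x + y : HTensor H K) c = tmul x c + tmul y c := TensorProduct.add_tmul x y c
    exact (congrArg S h0).trans ((map_add S _ _).trans ((congrArg₂ _ hx hy).trans
      ((map_add T _ _).symm.trans (congrArg T h0.symm))))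

theorem ext₄ {S T : HTensor (HTensor (HTensor H K) L) H' →L[ℂ] M}
    (h : ∀ a b c d, S (tmul (tmul (tmul a b) c) d) = T (tmul (tmul (tmul a b) c) d)) : S = T := by
  refine ext₃ fun x c d => ?_
  change H ⊗[ℂ] K at x
  induction x using TensorProduct.induction_on with
  | zero =>
    have h0 : tmul (tmul (0 : HTensor H K) c) d = 0 :=
      (congrArg (fun y : HTensor (HTensor H K) L => tmul y d) (TensorProduct.zero_tmul _ c)).trans
        (TensorProduct.zero_tmul _ d)
    exact (congrArg S h0).trans ((map_zero S).trans
      ((map_zero T).symm.trans (congrArg T h0.symm)))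
  | tmul a b => exact h a b c d
  | add x y hx hy =>
    have h0 : tmul (tmul (x + y : HTensor H K) c) d = tmul (tmul x c) d + tmul (tmul y c) d :=
      (congrArg (fun y : HTensor (HTensor H K) L => tmul y d) (TensorProduct.add_tmul x y c)).trans
        (TensorProduct.add_tmul _ _ d)
    exact (congrArg S h0).trans ((map_add S _ _).trans ((congrArg₂ _ hx hy).trans
      ((map_add T _ _).symm.trans (congrArg T h0.symm))))

section Star

variable [FiniteDimensional ℂ H] [FiniteDimensional ℂ K] [CompleteSpace H] [CompleteSpace K]

/-- The star homomorphism `a ⊗ b ↦ α a ⊗ β b`. -/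
def pairHom {R R' : Type*} [Ring R] [StarRing R] [Algebra ℂ R] [StarModule ℂ R]
    [Ring R'] [StarRing R'] [Algebra ℂ R'] [StarModule ℂ R']
    (α : R →⋆ₙₐ[ℂ] (H →L[ℂ] H)) (β : R' →⋆ₙₐ[ℂ] (K →L[ℂ] K)) :
    R ⊗[ℂ] R' →⋆ₙₐ[ℂ] (HTensor H K →L[ℂ] HTensor H K) where
  toFun := TensorProduct.lift ((mapBilin H K).compl₁₂ (α : R →ₗ[ℂ] _) (β : R' →ₗ[ℂ] _))
  map_smul' c m := map_smul _ c m
  map_zero' := map_zero _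
  map_add' := map_add _
  map_mul' m n := by
    induction m using TensorProduct.induction_on with
    | zero => simp
    | add m m' h h' => simp only [add_mul, map_add, h, h']
    | tmul a b =>
      induction n using TensorProduct.induction_on with
      | zero => simp
      | add n n' h h' => simp only [mul_add, map_add, h, h']
      | tmul c d => simp [mapBilin_apply, map_mul]
  map_star' m := by
    induction m using TensorProduct.induction_on with
    | zero => simp
    | add m m' h h' => simp only [star_add, map_add, h, h']
    | tmul a b => simp [mapBilin_apply, star_map, map_star]

@[simp]
theorem pairHom_tmul {R R' : Type*} [Ring R] [StarRing R] [Algebra ℂ R] [StarModule ℂ R]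
    [Ring R'] [StarRing R'] [Algebra ℂ R'] [StarModule ℂ R']
    (α : R →⋆ₙₐ[ℂ] (H →L[ℂ] H)) (β : R' →⋆ₙₐ[ℂ] (K →L[ℂ] K)) (a : R) (b : R') :
    pairHom α β (a ⊗ₜ b) = map (α a) (β b) := rfl

end Star

end HTensor

theorem IsPOU.map_left {ι : Type*} {P : ι → H →L[ℂ] H} (hP : IsPOU P) :
    IsPOU fun i => HTensor.map (P i) (1 : K →L[ℂ] K) := by
  refine ⟨fun i j hij => ?_, ?_⟩
  · rw [← HTensor.map_mul, hP.1 i j hij, HTensor.map_zero_left]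
  · obtain ⟨s, hs, hsum⟩ := hP.2
    refine ⟨s, fun i hi => by simp only [hs i hi, HTensor.map_zero_left], ?_⟩
    rw [← HTensor.map_one, ← hsum, HTensor.sum_map]

theorem IsPOU.map_right {ι : Type*} {P : ι → K →L[ℂ] K} (hP : IsPOU P) :
    IsPOU fun i => HTensor.map (1 : H →L[ℂ] H) (P i) := by
  refine ⟨fun i j hij => ?_, ?_⟩
  · rw [← HTensor.map_mul, hP.1 i j hij, HTensor.map_zero_right]
  · obtain ⟨s, hs, hsum⟩ := hP.2
    refine ⟨s, fun i hi => by simp only [hs i hi, HTensor.map_zero_right], ?_⟩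
    rw [← HTensor.map_one, ← hsum, HTensor.map_sum']

theorem IsPOU.map_prod {ι κ : Type*} {P : ι → H →L[ℂ] H} {Q : κ → K →L[ℂ] K} (hP : IsPOU P)
    (hQ : IsPOU Q) : IsPOU fun p : ι × κ => HTensor.map (P p.1) (Q p.2) := by
  refine ⟨fun p q hpq => ?_, ?_⟩
  · rw [← HTensor.map_mul]
    by_cases h : p.1 = q.1
    · rw [hQ.1 p.2 q.2 (fun h' => hpq (Prod.ext h h')), HTensor.map_zero_right]
    · rw [hP.1 _ _ h, HTensor.map_zero_left]
  · obtain ⟨s, hs, hsum⟩ := hP.2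
    obtain ⟨t, ht, htsum⟩ := hQ.2
    refine ⟨s ×ˢ t, fun p hp => ?_, ?_⟩
    · rw [Finset.mem_product, not_and_or] at hp
      rcases hp with hp | hp
      · simp only [hs _ hp, HTensor.map_zero_left]
      · simp only [ht _ hp, HTensor.map_zero_right]
    · rw [← HTensor.map_one, ← hsum, ← htsum, Finset.sum_product, HTensor.sum_map]
      refine Finset.sum_congr rfl fun i _ => ?_
      rw [HTensor.map_sum']

end Operators

section NormalRep

open TensorProduct

universe u

variable {G : DiscreteQuantumGroup.{u}}
variable {H H' K K' L : Type*}
  [NormedAddCommGroup H] [InnerProductSpace ℂ H] [FiniteDimensional ℂ H] [CompleteSpace H]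
  [NormedAddCommGroup H'] [InnerProductSpace ℂ H'] [FiniteDimensional ℂ H'] [CompleteSpace H']
  [NormedAddCommGroup K] [InnerProductSpace ℂ K] [FiniteDimensional ℂ K] [CompleteSpace K]
  [NormedAddCommGroup K'] [InnerProductSpace ℂ K'] [FiniteDimensional ℂ K'] [CompleteSpace K']
  [NormedAddCommGroup L] [InnerProductSpace ℂ L] [FiniteDimensional ℂ L] [CompleteSpace L]

/-- A *-representation of all functions on `G` on a finite dimensional Hilbert space that depends
on finitely many matrix blocks only. These are the unital extensions of the nondegenerate
*-representations of `C_0(G)`. -/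
structure NormalRep (G : DiscreteQuantumGroup.{u}) (H : Type*) [NormedAddCommGroup H]
    [InnerProductSpace ℂ H] [CompleteSpace H] where
  hom : G.Fun →⋆ₐ[ℂ] (H →L[ℂ] H)
  dep : ∃ s : Finset G.Irr, DependsOn hom (s : Set G.Irr)

namespace NormalRep

/-- The restriction of a representation to a matrix block. -/
def block (φ : NormalRep G H) (i : G.Irr) : G.Block i →⋆ₙₐ[ℂ] (H →L[ℂ] H) :=
  (φ.hom : G.Fun →⋆ₙₐ[ℂ] (H →L[ℂ] H)).comp (blockHom G.dim i)

theorem block_apply (φ : NormalRep G H) (i : G.Irr) (a : G.Block i) :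
    φ.block i a = φ.hom (blockIncl G.dim i a) := rfl

theorem sum_blockIncl (f : G.Fun) (s : Finset G.Irr) (i : G.Irr) (hi : i ∈ s) :
    (∑ j ∈ s, blockIncl G.dim j (f j)) i = f i := by
  classical
  rw [Finset.sum_apply, Finset.sum_eq_single_of_mem i hi]
  · simp [blockIncl]
  · intro j _ hj
    simp [blockIncl, Pi.single_eq_of_ne (Ne.symm hj)]

theorem pou (φ : NormalRep G H) : IsPOU fun i => φ.block i 1 := by
  classical
  refine ⟨fun i j hij => ?_, ?_⟩
  · change φ.hom (blockIncl G.dim i 1) * φ.hom (blockIncl G.dim j 1) = 0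
    rw [← map_mul]
    have : blockIncl G.dim i 1 * blockIncl G.dim j 1 = 0 := by
      ext1 k
      by_cases hk : k = i
      · subst hk; simp [blockIncl, Pi.single_eq_of_ne hij]
      · simp [blockIncl, Pi.single_eq_of_ne hk]
    rw [this, map_zero]
  · obtain ⟨s, hs⟩ := φ.dep
    refine ⟨s, fun i hi => ?_, ?_⟩
    · change φ.hom (blockIncl G.dim i 1) = 0
      rw [← map_zero φ.hom]
      refine hs fun j hj => ?_
      have : j ≠ i := fun h => hi (h ▸ hj)
      simp [blockIncl, Pi.single_eq_of_ne this]
    · simp only [block_apply]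
      rw [← map_sum, ← map_one φ.hom]
      exact hs fun i hi => sum_blockIncl 1 s i hi

theorem hom_mul_block (φ : NormalRep G H) (f : G.Fun) (i : G.Irr) :
    φ.hom f * φ.block i 1 = φ.block i (f i) := by
  classical
  rw [block_apply, block_apply, ← map_mul]
  congr 1
  ext1 k
  by_cases hk : k = i
  · subst hk; simp [blockIncl]
  · simp [blockIncl, Pi.single_eq_of_ne hk]

/-- The homomorphism `a ⊗ b ↦ φ a ⊗ ψ b` on a pair of matrix blocks. -/
def pairBlock (φ : NormalRep G H) (ψ : NormalRep G K) (p : G.Irr × G.Irr) :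
    MatBlock G.dim p.1 ⊗[ℂ] MatBlock G.dim p.2 →⋆ₙₐ[ℂ] (HTensor H K →L[ℂ] HTensor H K) :=
  HTensor.pairHom (φ.block p.1) (ψ.block p.2)

theorem pairBlock_tmul (φ : NormalRep G H) (ψ : NormalRep G K) (p : G.Irr × G.Irr)
    (a : G.Block p.1) (b : G.Block p.2) :
    φ.pairBlock ψ p (a ⊗ₜ b) = HTensor.map (φ.block p.1 a) (ψ.block p.2 b) := rfl

theorem pairBlock_one (φ : NormalRep G H) (ψ : NormalRep G K) (p : G.Irr × G.Irr) :
    φ.pairBlock ψ p 1 = HTensor.map (φ.block p.1 1) (ψ.block p.2 1) := by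
  rw [Algebra.TensorProduct.one_def, pairBlock_tmul]

theorem pairBlock_pou (φ : NormalRep G H) (ψ : NormalRep G K) :
    IsPOU fun p => φ.pairBlock ψ p 1 := by
  have h := IsPOU.map_prod φ.pou ψ.pou
  simpa only [pairBlock_one] using h

/-- The homomorphism `φ ⊗ ψ` on `M(C_c(G) ⊗ C_c(G))`. -/
def box (φ : NormalRep G H) (ψ : NormalRep G K) :
    MatFun₂ G.dim →⋆ₐ[ℂ] (HTensor H K →L[ℂ] HTensor H K) :=
  glue (φ.pairBlock ψ) (φ.pairBlock_pou ψ)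

theorem box_apply (φ : NormalRep G H) (ψ : NormalRep G K) (m : MatFun₂ G.dim) :
    φ.box ψ m = ∑ᶠ p : G.Irr × G.Irr, φ.pairBlock ψ p (m p) := rfl

theorem box_mul (φ : NormalRep G H) (ψ : NormalRep G K) (m : MatFun₂ G.dim) (p : G.Irr × G.Irr) :
    φ.box ψ m * HTensor.map (φ.block p.1 1) (ψ.block p.2 1) = φ.pairBlock ψ p (m p) := by
  rw [← pairBlock_one]
  exact glue_mul_tau (φ.pairBlock_pou ψ) m p

theorem box_eq_sum (φ : NormalRep G H) (ψ : NormalRep G K) (m : MatFun₂ G.dim) {s t : Finset G.Irr}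
    (hs : ∀ i, i ∉ s → φ.block i 1 = 0) (ht : ∀ i, i ∉ t → ψ.block i 1 = 0) :
    φ.box ψ m = ∑ p ∈ s ×ˢ t, φ.pairBlock ψ p (m p) := by
  refine glue_eq_sum (φ.pairBlock_pou ψ) m fun p hp => ?_
  rw [pairBlock_one]
  rw [Finset.mem_product, not_and_or] at hp
  rcases hp with hp | hp
  · rw [hs _ hp, HTensor.map_zero_left]
  · rw [ht _ hp, HTensor.map_zero_right]

theorem box_intertwine {φ : NormalRep G H} {φ' : NormalRep G H'} {ψ : NormalRep G K}
    {ψ' : NormalRep G K'} {T : H →L[ℂ] H'} {S : K →L[ℂ] K'}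
    (hT : ∀ f, T ∘L φ.hom f = φ'.hom f ∘L T) (hS : ∀ f, S ∘L ψ.hom f = ψ'.hom f ∘L S)
    (m : MatFun₂ G.dim) :
    HTensor.map T S ∘L φ.box ψ m = φ'.box ψ' m ∘L HTensor.map T S := by
  classical
  obtain ⟨s, hs, -⟩ := φ.pou.2
  obtain ⟨s', hs', -⟩ := φ'.pou.2
  obtain ⟨t, ht, -⟩ := ψ.pou.2
  obtain ⟨t', ht', -⟩ := ψ'.pou.2
  rw [box_eq_sum φ ψ m (s := s ∪ s') (t := t ∪ t')
      (fun i hi => hs i fun h => hi (Finset.mem_union_left _ h))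
      (fun i hi => ht i fun h => hi (Finset.mem_union_left _ h)),
    box_eq_sum φ' ψ' m (s := s ∪ s') (t := t ∪ t')
      (fun i hi => hs' i fun h => hi (Finset.mem_union_right _ h))
      (fun i hi => ht' i fun h => hi (Finset.mem_union_right _ h)),
    ContinuousLinearMap.comp_finsetSum, ContinuousLinearMap.finsetSum_comp]
  refine Finset.sum_congr rfl fun p _ => ?_
  induction m p using TensorProduct.induction_on with
  | zero => simp
  | add a b ha hb =>
    rw [map_add, map_add, ContinuousLinearMap.comp_add, ContinuousLinearMap.add_comp, ha, hb]
  | tmul a b =>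
    rw [pairBlock_tmul, pairBlock_tmul, ← HTensor.map_comp, ← HTensor.map_comp, block_apply, block_apply,
      block_apply, block_apply, hT, hS]

/-- The tensor product `(φ ⊗ ψ)Δ`. -/
def mul (φ : NormalRep G H) (ψ : NormalRep G K) : NormalRep G (HTensor H K) where
  hom := (φ.box ψ).comp G.comul
  dep := by
    classical
    obtain ⟨s, hs⟩ := glue_dependsOn (φ.pairBlock_pou ψ)
    choose t ht using G.comul_dependsOn
    refine ⟨s.biUnion t, fun f g hfg => hs fun p hp => ht p fun i hi => hfg i ?_⟩
    exact Finset.mem_coe.mpr (Finset.mem_biUnion.mpr ⟨p, hp, hi⟩)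

theorem mul_hom (φ : NormalRep G H) (ψ : NormalRep G K) (f : G.Fun) :
    (φ.mul ψ).hom f = φ.box ψ (G.comul f) := rfl

/-- The homomorphism `f ↦ φ(f) P` for a projection `P` commuting with `φ`. -/
def cut (φ : NormalRep G H) (P : H →L[ℂ] H) (hP : IsStarProjection P)
    (hcomm : ∀ f, φ.hom f * P = P * φ.hom f) : G.Fun →⋆ₙₐ[ℂ] (H →L[ℂ] H) where
  toFun f := φ.hom f * P
  map_smul' c f := by simp
  map_zero' := by simp
  map_add' f g := by rw [map_add, add_mul]
  map_mul' f g := by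
    rw [map_mul, mul_assoc, mul_assoc, ← mul_assoc P, ← hcomm g, mul_assoc,
      hP.isIdempotentElem.eq]
  map_star' f := by
    rw [star_mul, hP.isSelfAdjoint.star_eq, ← map_star, hcomm]

theorem cut_apply (φ : NormalRep G H) (P : H →L[ℂ] H) (hP : IsStarProjection P)
    (hcomm : ∀ f, φ.hom f * P = P * φ.hom f) (f : G.Fun) : φ.cut P hP hcomm f = φ.hom f * P := rfl

/-- The diagonal homomorphism. -/
def diag (A X : Type*) [Ring A] [StarRing A] [Algebra ℂ A] : A →⋆ₐ[ℂ] (X → A) where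
  toFun f _ := f
  map_one' := rfl
  map_mul' _ _ := rfl
  map_zero' := rfl
  map_add' _ _ := rfl
  commutes' _ := rfl
  map_star' _ := rfl

section GlueProj

variable {X : Type*} (φ : X → NormalRep G H) (P : X → H →L[ℂ] H) (hP : IsPOU P)
  (hproj : ∀ y, IsStarProjection (P y)) (hcomm : ∀ y f, (φ y).hom f * P y = P y * (φ y).hom f)

theorem cut_pou (φ : X → NormalRep G H) (P : X → H →L[ℂ] H) (hP : IsPOU P)
    (hproj : ∀ y, IsStarProjection (P y)) (hcomm : ∀ y f, (φ y).hom f * P y = P y * (φ y).hom f) :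
    IsPOU fun y => (φ y).cut (P y) (hproj y) (hcomm y) 1 := by
  simpa [cut_apply] using hP

/-- The representation `f ↦ ∑ y, φ_y(f) P_y` glued from representations `φ_y` along a partition of
unity by projections `P_y` commuting with `φ_y`. -/
def glueProj : NormalRep G H where
  hom := (glue (R := fun _ : X => G.Fun) (fun y => (φ y).cut (P y) (hproj y) (hcomm y))
    (cut_pou φ P hP hproj hcomm)).comp (diag G.Fun X)
  dep := by
    classical
    choose t ht using fun y => (φ y).dep
    obtain ⟨s, hs, -⟩ := (cut_pou φ P hP hproj hcomm).2
    refine ⟨s.biUnion t, fun f g hfg => ?_⟩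
    change glue _ (cut_pou φ P hP hproj hcomm) _ = glue _ (cut_pou φ P hP hproj hcomm) _
    rw [glue_eq_sum _ _ hs, glue_eq_sum _ _ hs]
    refine Finset.sum_congr rfl fun y hy => ?_
    change (φ y).hom f * P y = (φ y).hom g * P y
    rw [ht y fun i hi => hfg i (Finset.mem_coe.mpr (Finset.mem_biUnion.mpr ⟨y, hy, hi⟩))]

theorem glueProj_hom (f : G.Fun) :
    (glueProj φ P hP hproj hcomm).hom f = ∑ᶠ y, (φ y).hom f * P y := rfl

theorem glueProj_mul (f : G.Fun) (y : X) :
    (glueProj φ P hP hproj hcomm).hom f * P y = (φ y).hom f * P y := by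
  have := glue_mul_tau (cut_pou φ P hP hproj hcomm) (fun _ => f) y
  rw [cut_apply, cut_apply, map_one, one_mul] at this
  exact this

theorem mul_glueProj (f : G.Fun) (y : X) :
    P y * (glueProj φ P hP hproj hcomm).hom f = (φ y).hom f * P y := by
  have := tau_mul_glue (cut_pou φ P hP hproj hcomm) (fun _ => f) y
  rw [cut_apply, cut_apply, map_one, one_mul] at this
  exact this

end GlueProj

end NormalRep
end NormalRep

section QuantumPermutation

variable {X : Type*} {H H' K K' : Type*}
  [NormedAddCommGroup H] [InnerProductSpace ℂ H] [CompleteSpace H]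
  [NormedAddCommGroup K] [InnerProductSpace ℂ K] [CompleteSpace K]

/-- A quantum permutation (magic unitary) of the set `X` on the Hilbert space `H`. -/
structure QuantumPermutation (X : Type*) (H : Type*) [NormedAddCommGroup H]
    [InnerProductSpace ℂ H] [CompleteSpace H] where
  u : X → X → H →L[ℂ] H
  isProj : ∀ x y, IsStarProjection (u x y)
  row_orth : ∀ x y z, y ≠ z → u x y * u x z = 0
  col_orth : ∀ y x z, x ≠ z → u x y * u z y = 0
  /-- `∑ z, u x z = 1` in the strong operator topology. -/
  row_sum : ∀ x ξ, HasSum (fun z => u x z ξ) ξ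
  /-- `∑ z, u z y = 1` in the strong operator topology. -/
  col_sum : ∀ y ξ, HasSum (fun z => u z y ξ) ξ

theorem isPOU_of_hasSum [FiniteDimensional ℂ H] {P : X → H →L[ℂ] H}
    (hP : ∀ x, IsStarProjection (P x)) (horth : ∀ x y, x ≠ y → P x * P y = 0)
    (hsum : ∀ ξ, HasSum (fun z => P z ξ) ξ) : IsPOU P := by
  have hfin := finite_support_of_orthogonal P (fun i => (hP i).isIdempotentElem.eq) horth
  have h0 : ∀ i, i ∉ hfin.toFinset → P i = 0 := fun i hi => by
    by_contra h
    exact hi (hfin.mem_toFinset.mpr h)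
  refine ⟨horth, hfin.toFinset, h0, ?_⟩
  ext ξ
  rw [ContinuousLinearMap.sum_apply]
  have h : HasSum (fun z => P z ξ) (∑ z ∈ hfin.toFinset, P z ξ) :=
    hasSum_sum_of_ne_finset_zero fun i hi => by rw [h0 i hi]; rfl
  exact h.unique (hsum ξ)

theorem IsPOU.hasSum {P : X → H →L[ℂ] H} (hP : IsPOU P) (ξ : H) :
    HasSum (fun z => P z ξ) ξ := by
  obtain ⟨s, hs, hsum⟩ := hP.2
  have h : HasSum (fun z => P z ξ) (∑ z ∈ s, P z ξ) :=
    hasSum_sum_of_ne_finset_zero fun i hi => by rw [hs i hi]; rfl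
  have e : ∑ z ∈ s, P z ξ = ξ := by
    rw [← ContinuousLinearMap.sum_apply, hsum]; rfl
  rwa [e] at h

namespace QuantumPermutation

theorem row_pou [FiniteDimensional ℂ H] (q : QuantumPermutation X H) (x : X) : IsPOU (q.u x) :=
  isPOU_of_hasSum (q.isProj x) (fun y z h => q.row_orth x y z h) (q.row_sum x)

theorem col_pou [FiniteDimensional ℂ H] (q : QuantumPermutation X H) (y : X) :
    IsPOU fun x => q.u x y :=
  isPOU_of_hasSum (fun x => q.isProj x y) (fun x z h => q.col_orth y x z h) (q.col_sum y)

/-- A matrix of projections whose rows and columns are finite partitions of unity. -/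
def ofPOU (u : X → X → H →L[ℂ] H) (hu : ∀ x y, IsStarProjection (u x y))
    (hrow : ∀ x, IsPOU (u x)) (hcol : ∀ y, IsPOU fun x => u x y) : QuantumPermutation X H where
  u := u
  isProj := hu
  row_orth x y z h := (hrow x).1 y z h
  col_orth y x z h := (hcol y).1 x z h
  row_sum x ξ := (hrow x).hasSum ξ
  col_sum y ξ := (hcol y).hasSum ξ

open scoped Classical in
/-- The trivial quantum permutation on `ℂ`. -/
def trivial (X : Type*) : QuantumPermutation X ℂ :=
  ofPOU (fun x y => if x = y then 1 else 0)
    (fun x y => by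
      split_ifs
      · exact IsStarProjection.one _
      · exact IsStarProjection.zero _)
    (fun x => ⟨fun y z h => by
        by_cases h1 : x = y
        · have h2 : x ≠ z := fun h2 => h (h1.symm.trans h2)
          simp [h2]
        · simp [h1],
      {x}, fun y hy => by
        rw [Finset.mem_singleton] at hy
        simp [Ne.symm hy], by simp⟩)
    (fun y => ⟨fun x z h => by
        by_cases h1 : x = y
        · have h2 : z ≠ y := fun h2 => h (h1.trans h2.symm)
          simp [h2]
        · simp [h1],
      {y}, fun x hx => by
        rw [Finset.mem_singleton] at hx
        simp [hx], by simp⟩)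

theorem trivial_ne {x y : X} (h : x ≠ y) : (trivial X).u x y = 0 := by
  classical
  change (if x = y then 1 else 0 : ℂ →L[ℂ] ℂ) = 0
  rw [if_neg h]

theorem trivial_self (x : X) : (trivial X).u x x = 1 := by
  classical
  change (if x = x then 1 else 0 : ℂ →L[ℂ] ℂ) = 1
  rw [if_pos rfl]

section Tensor

variable [FiniteDimensional ℂ H] [FiniteDimensional ℂ K]
variable (q : QuantumPermutation X H) (r : QuantumPermutation X K)

/-- The entries `∑ z, q_{xz} ⊗ r_{zy}` of the tensor product. -/
def tensorU (x y : X) : HTensor H K →L[ℂ] HTensor H K :=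
  ∑ᶠ z, HTensor.map (q.u x z) (r.u z y)

theorem tensorU_eq_sum_row (x y : X) {s : Finset X} (hs : ∀ z, z ∉ s → q.u x z = 0) :
    q.tensorU r x y = ∑ z ∈ s, HTensor.map (q.u x z) (r.u z y) := by
  refine finsum_eq_sum_of_support_subset _ fun z hz => ?_
  by_contra hzs
  refine hz ?_
  change HTensor.map (q.u x z) (r.u z y) = 0
  rw [hs z hzs, HTensor.map_zero_left]

theorem tensorU_eq_sum_col (x y : X) {s : Finset X} (hs : ∀ z, z ∉ s → r.u z y = 0) :
    q.tensorU r x y = ∑ z ∈ s, HTensor.map (q.u x z) (r.u z y) := by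
  refine finsum_eq_sum_of_support_subset _ fun z hz => ?_
  by_contra hzs
  refine hz ?_
  change HTensor.map (q.u x z) (r.u z y) = 0
  rw [hs z hzs, HTensor.map_zero_right]

theorem tensorU_mul_row (x y z : X) :
    q.tensorU r x y * HTensor.map (q.u x z) 1 = HTensor.map (q.u x z) (r.u z y) := by
  classical
  obtain ⟨s, hs, -⟩ := (q.row_pou x).2
  rw [tensorU_eq_sum_row q r x y (s := insert z s) (fun j hj => hs j fun h' => hj (by simp [h'])),
    Finset.sum_mul, Finset.sum_eq_single_of_mem z (Finset.mem_insert_self _ _)]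
  · rw [← HTensor.map_mul, (q.isProj x z).isIdempotentElem.eq, mul_one]
  · intro j _ hj
    rw [← HTensor.map_mul, q.row_orth x j z hj, HTensor.map_zero_left]

theorem tensorU_mul_col (x y z : X) :
    q.tensorU r x y * HTensor.map 1 (r.u z y) = HTensor.map (q.u x z) (r.u z y) := by
  classical
  obtain ⟨s, hs, -⟩ := (r.col_pou y).2
  rw [tensorU_eq_sum_col q r x y (s := insert z s) (fun j hj => hs j fun h' => hj (by simp [h'])),
    Finset.sum_mul, Finset.sum_eq_single_of_mem z (Finset.mem_insert_self _ _)]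
  · rw [← HTensor.map_mul, (r.isProj z y).isIdempotentElem.eq, mul_one]
  · intro j _ hj
    rw [← HTensor.map_mul, r.col_orth y j z hj, HTensor.map_zero_right]

theorem star_tensorU (x y : X) : star (q.tensorU r x y) = q.tensorU r x y := by
  obtain ⟨s, hs, -⟩ := (q.row_pou x).2
  rw [tensorU_eq_sum_row q r x y hs, star_sum]
  refine Finset.sum_congr rfl fun z _ => ?_
  rw [HTensor.star_map, (q.isProj x z).isSelfAdjoint.star_eq, (r.isProj z y).isSelfAdjoint.star_eq]

theorem row_mul_tensorU (x y z : X) :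
    HTensor.map (q.u x z) 1 * q.tensorU r x y = HTensor.map (q.u x z) (r.u z y) := by
  have h := congrArg star (tensorU_mul_row q r x y z)
  rwa [star_mul, star_tensorU, HTensor.star_map, HTensor.star_map, star_one,
    (q.isProj x z).isSelfAdjoint.star_eq, (r.isProj z y).isSelfAdjoint.star_eq] at h

theorem tensorU_row_pou (x : X) : IsPOU (q.tensorU r x) := by
  classical
  have horth : ∀ y z, y ≠ z → q.tensorU r x y * q.tensorU r x z = 0 := fun y z hyz => by
    refine (q.row_pou x).map_left.ext_right fun w => ?_
    rw [mul_assoc, tensorU_mul_row, zero_mul]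
    have e : HTensor.map (q.u x w) (r.u w z) =
        HTensor.map (q.u x w) 1 * HTensor.map 1 (r.u w z) := by
      rw [← HTensor.map_mul, one_mul, mul_one]
    rw [e, ← mul_assoc, tensorU_mul_row, ← HTensor.map_mul, r.row_orth w y z hyz,
      HTensor.map_zero_right]
  obtain ⟨s, hs, -⟩ := (q.row_pou x).2
  choose t ht htsum using fun z => (r.row_pou z).2
  refine ⟨horth, s.biUnion t, fun y hy => ?_, ?_⟩
  · rw [tensorU_eq_sum_row q r x y hs]
    refine Finset.sum_eq_zero fun z hz => ?_
    rw [ht z y fun h => hy (Finset.mem_biUnion.mpr ⟨z, hz, h⟩), HTensor.map_zero_right]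
  · refine (q.row_pou x).map_left.ext_right fun w => ?_
    rw [Finset.sum_mul, one_mul]
    simp only [tensorU_mul_row]
    rw [← HTensor.map_sum']
    by_cases hw : w ∈ s
    · rw [← Finset.sum_subset (Finset.subset_biUnion_of_mem t hw) (fun y _ hy => ht w y hy),
        htsum]
    · rw [hs w hw, HTensor.map_zero_left, HTensor.map_zero_left]

theorem tensorU_col_pou (y : X) : IsPOU fun x => q.tensorU r x y := by
  classical
  have horth : ∀ x z, x ≠ z → q.tensorU r x y * q.tensorU r z y = 0 := fun x z hxz => by
    refine (r.col_pou y).map_right.ext_right fun w => ?_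
    rw [mul_assoc, tensorU_mul_col, zero_mul]
    have e : HTensor.map (q.u z w) (r.u w y) =
        HTensor.map 1 (r.u w y) * HTensor.map (q.u z w) 1 := by
      rw [← HTensor.map_mul, one_mul, mul_one]
    rw [e, ← mul_assoc, tensorU_mul_col, ← HTensor.map_mul, q.col_orth w x z hxz,
      HTensor.map_zero_left]
  obtain ⟨s, hs', -⟩ := (r.col_pou y).2
  choose t ht' htsum using fun z => (q.col_pou z).2
  have hs : ∀ w, w ∉ s → r.u w y = 0 := hs'
  have ht : ∀ z i, i ∉ t z → q.u i z = 0 := ht'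
  refine ⟨horth, s.biUnion t, fun x hx => ?_, ?_⟩
  · change q.tensorU r x y = 0
    rw [tensorU_eq_sum_col q r x y hs]
    refine Finset.sum_eq_zero fun z hz => ?_
    rw [ht z x fun h => hx (Finset.mem_biUnion.mpr ⟨z, hz, h⟩), HTensor.map_zero_left]
  · refine (r.col_pou y).map_right.ext_right fun w => ?_
    rw [Finset.sum_mul, one_mul]
    simp only [tensorU_mul_col]
    rw [← HTensor.sum_map]
    by_cases hw : w ∈ s
    · rw [← Finset.sum_subset (Finset.subset_biUnion_of_mem t hw) (fun x _ hx => ht w x hx),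
        htsum]
    · rw [hs w hw, HTensor.map_zero_right, HTensor.map_zero_right]

/-- The tensor product of quantum permutations. -/
def tensor : QuantumPermutation X (HTensor H K) :=
  ofPOU (q.tensorU r) (fun x y => ⟨(q.tensorU_row_pou r x).idem y, star_tensorU q r x y⟩)
    (q.tensorU_row_pou r) (q.tensorU_col_pou r)

end Tensor

end QuantumPermutation

end QuantumPermutation

section C0Rep

open scoped Matrix.Norms.L2Operator
open Topology Filter

variable {I : Type*} {d : I → ℕ} {H : Type*} [NormedAddCommGroup H] [InnerProductSpace ℂ H]
  [CompleteSpace H]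

theorem mul_blockC0_one (f : c0Blocks d) (i : I) :
    f * blockC0 d i 1 = blockC0 d i (c0ToFun d f i) := by
  classical
  ext1; ext1; ext1 j
  change (f : lp (MatBlock d) ∞) j * (Pi.single i 1 : MatFun d) j =
    (Pi.single i ((f : lp (MatBlock d) ∞) i) : MatFun d) j
  by_cases hj : j = i
  · subst hj; simp
  · simp [Pi.single_eq_of_ne hj]

theorem blockC0_mul_ne {i j : I} (hij : i ≠ j) (a : MatBlock d i) (b : MatBlock d j) :
    blockC0 d i a * blockC0 d j b = 0 := by
  classical
  ext1; ext1; ext1 k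
  change (Pi.single i a : MatFun d) k * (Pi.single j b : MatFun d) k = 0
  by_cases hk : k = i
  · subst hk; simp [Pi.single_eq_of_ne hij]
  · simp [Pi.single_eq_of_ne hk]

theorem finSupp_eq_sum (f : c0Blocks d) (s : Finset I)
    (hs : ∀ i, i ∉ s → c0ToFun d f i = 0) : f = ∑ i ∈ s, blockC0 d i (c0ToFun d f i) := by
  classical
  have hinj : Function.Injective (c0ToFun d) := fun f g h => by
    ext1; ext1
    exact h
  apply hinj
  rw [map_sum]
  simp only [c0ToFun_blockC0]
  ext1 i
  rw [Finset.sum_apply]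
  by_cases hi : i ∈ s
  · rw [Finset.sum_eq_single_of_mem i hi]
    · simp [blockIncl]
    · intro j _ hj
      simp [blockIncl, Pi.single_eq_of_ne (Ne.symm hj)]
  · rw [hs i hi, Finset.sum_eq_zero]
    intro j hj
    have : i ≠ j := fun h => hi (h ▸ hj)
    simp [blockIncl, Pi.single_eq_of_ne this]

theorem continuous_c0Rep (τ : c0Blocks d →⋆ₙₐ[ℂ] (H →L[ℂ] H)) : Continuous τ :=
  AddMonoidHomClass.continuous_of_bound τ 1 fun f => by
    rw [one_mul]; exact NonUnitalStarAlgHom.norm_apply_le τ f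

/-- A *-representation of `C_0(G)` is nondegenerate if the span of its range vectors is dense. -/
def IsNondegenerateRep (τ : c0Blocks d →⋆ₙₐ[ℂ] (H →L[ℂ] H)) : Prop :=
  (Submodule.span ℂ {ζ : H | ∃ f ξ, τ f ξ = ζ}).topologicalClosure = ⊤

theorem IsNondegenerateRep.pou [FiniteDimensional ℂ H] {τ : c0Blocks d →⋆ₙₐ[ℂ] (H →L[ℂ] H)}
    (hτ : IsNondegenerateRep τ) : IsPOU fun i => τ.comp (blockC0 d i) 1 := by
  classical
  have horth : ∀ i j, i ≠ j → τ (blockC0 d i 1) * τ (blockC0 d j 1) = 0 := fun i j hij => by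
    rw [← map_mul, blockC0_mul_ne hij, map_zero]
  have hidem : ∀ i, τ (blockC0 d i 1) * τ (blockC0 d i 1) = τ (blockC0 d i 1) := fun i => by
    rw [← map_mul, ← map_mul, one_mul]
  have hfin := finite_support_of_orthogonal (fun i => τ (blockC0 d i 1)) hidem horth
  have h0 : ∀ i, i ∉ hfin.toFinset → τ (blockC0 d i 1) = 0 := fun i hi => by
    by_contra h
    exact hi (hfin.mem_toFinset.mpr h)
  refine ⟨horth, hfin.toFinset, h0, ?_⟩
  change ∑ i ∈ hfin.toFinset, τ (blockC0 d i 1) = 1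
  set e := ∑ i ∈ hfin.toFinset, τ (blockC0 d i 1) with he
  have h1 : ∀ i (a : MatBlock d i), e * τ (blockC0 d i a) = τ (blockC0 d i a) := fun i a => by
    have h2 : τ (blockC0 d i a) = τ (blockC0 d i 1) * τ (blockC0 d i a) := by
      rw [← map_mul, ← map_mul, one_mul]
    by_cases hi : i ∈ hfin.toFinset
    · rw [h2, ← mul_assoc, he, Finset.sum_mul, Finset.sum_eq_single_of_mem i hi, hidem]
      exact fun j _ hj => horth j i hj
    · rw [h2, h0 i hi, zero_mul, mul_zero]
  have h2 : ∀ f : c0Blocks d, e * τ f = τ f := fun f => by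
    obtain ⟨x, hx, hlim⟩ := mem_closure_iff_seq_limit.mp f.2
    let y : ℕ → c0Blocks d := fun n => ⟨x n, subset_closure (hx n)⟩
    have hy : Tendsto y atTop (𝓝 f) := tendsto_subtype_rng.mpr hlim
    have h3 : ∀ n, e * τ (y n) = τ (y n) := fun n => by
      have hf : {i | x n i ≠ 0}.Finite := hx n
      rw [finSupp_eq_sum (y n) hf.toFinset fun i hi => by
        by_contra h
        exact hi (hf.mem_toFinset.mpr h), map_sum, Finset.mul_sum]
      exact Finset.sum_congr rfl fun i _ => h1 i _
    have hτc := ((continuous_c0Rep τ).tendsto f).comp hy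
    refine tendsto_nhds_unique (hτc.const_mul e) ?_
    exact hτc.congr fun n => (h3 n).symm
  ext ζ
  have hle : (Submodule.span ℂ {ζ : H | ∃ f ξ, τ f ξ = ζ}).topologicalClosure ≤
      LinearMap.eqLocus (e : H →ₗ[ℂ] H) LinearMap.id := by
    refine Submodule.topologicalClosure_minimal _ (Submodule.span_le.mpr ?_) ?_
    · rintro _ ⟨f, ξ, rfl⟩
      exact congrArg (fun T : H →L[ℂ] H => T ξ) (h2 f)
    · exact isClosed_eq e.continuous continuous_id
  have hmem : ζ ∈ (Submodule.span ℂ {ζ : H | ∃ f ξ, τ f ξ = ζ}).topologicalClosure := by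
    rw [show (Submodule.span ℂ {ζ : H | ∃ f ξ, τ f ξ = ζ}).topologicalClosure = ⊤ from hτ]
    trivial
  exact hle hmem

end C0Rep

section NormalExtension

open scoped Matrix.Norms.L2Operator

universe u

variable {G : DiscreteQuantumGroup.{u}} {H : Type*} [NormedAddCommGroup H] [InnerProductSpace ℂ H]
  [FiniteDimensional ℂ H] [CompleteSpace H]

namespace NormalRep

/-- The unital extension of a nondegenerate *-representation of `C_0(G)` to all functions. -/
def extend (τ : G.C0 →⋆ₙₐ[ℂ] (H →L[ℂ] H)) (hτ : IsNondegenerateRep τ) : NormalRep G H where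
  hom := glue (fun i => τ.comp (blockC0 G.dim i)) hτ.pou
  dep := glue_dependsOn hτ.pou

theorem extend_hom (τ : G.C0 →⋆ₙₐ[ℂ] (H →L[ℂ] H)) (hτ : IsNondegenerateRep τ) (f : G.C0) :
    (extend τ hτ).hom (c0ToFun G.dim f) = τ f := by
  refine hτ.pou.ext_right fun i => ?_
  refine (glue_mul_tau hτ.pou _ i).trans ?_
  change τ (blockC0 G.dim i (c0ToFun G.dim f i)) = τ f * τ (blockC0 G.dim i 1)
  rw [← mul_blockC0_one, map_mul]

/-- The restriction of a representation of all functions to `C_0(G)`. -/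
def restrict (φ : NormalRep G H) : G.C0 →⋆ₙₐ[ℂ] (H →L[ℂ] H) :=
  (φ.hom : G.Fun →⋆ₙₐ[ℂ] (H →L[ℂ] H)).comp (c0ToFun G.dim)

theorem restrict_apply (φ : NormalRep G H) (f : G.C0) :
    φ.restrict f = φ.hom (c0ToFun G.dim f) := rfl

theorem restrict_nondegenerate (φ : NormalRep G H) : IsNondegenerateRep φ.restrict := by
  obtain ⟨s, -, hsum⟩ := φ.pou.2
  rw [IsNondegenerateRep, eq_top_iff]
  intro ζ _
  refine Submodule.le_topologicalClosure _ (Submodule.subset_span ⟨∑ i ∈ s, blockC0 G.dim i 1, ζ, ?_⟩)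
  rw [map_sum]
  change (∑ i ∈ s, φ.block i 1) ζ = ζ
  rw [hsum]; rfl

theorem ext_block {φ ψ : NormalRep G H} (h : ∀ i a, φ.block i a = ψ.block i a) : φ = ψ := by
  have h' : φ.hom = ψ.hom := by
    ext1 f
    refine φ.pou.ext_right fun i => ?_
    rw [hom_mul_block, h i 1, hom_mul_block, h]
  cases φ; cases ψ; cases h'; rfl

theorem extend_restrict (φ : NormalRep G H) :
    extend φ.restrict φ.restrict_nondegenerate = φ := by
  refine ext_block fun i a => ?_
  rw [block_apply, ← c0ToFun_blockC0, extend_hom, restrict_apply, c0ToFun_blockC0, block_apply]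

end NormalRep

/-- An `X`-free wreath corepresentation of `G` on the Hilbert space `H`. -/
structure WreathCorep (G : DiscreteQuantumGroup.{u}) (X : Type*) (H : Type*) [NormedAddCommGroup H]
    [InnerProductSpace ℂ H] [CompleteSpace H] where
  /-- The *-representations `π^G_x` of `C_0(G)`. -/
  rep : X → G.C0 →⋆ₙₐ[ℂ] (H →L[ℂ] H)
  nondegenerate : ∀ x, IsNondegenerateRep (rep x)
  /-- The quantum permutation `π^X`. -/
  perm : QuantumPermutation X H
  comm : ∀ x y f, rep x f * perm.u x y = perm.u x y * rep x f

namespace WreathCorep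

variable {X : Type*}

/-- The unital extension of `π^G_x` to all functions on `G`. -/
def ext (π : WreathCorep G X H) (x : X) : NormalRep G H :=
  NormalRep.extend (π.rep x) (π.nondegenerate x)

theorem ext_hom (π : WreathCorep G X H) (x : X) (f : G.C0) :
    (π.ext x).hom (c0ToFun G.dim f) = π.rep x f := NormalRep.extend_hom _ _ f

theorem ext_block (π : WreathCorep G X H) (x : X) (i : G.Irr) (a : G.Block i) :
    (π.ext x).block i a = π.rep x (blockC0 G.dim i a) := by
  rw [NormalRep.block_apply, ← c0ToFun_blockC0, ext_hom]

theorem ext_comm (π : WreathCorep G X H) (x y : X) (f : G.Fun) :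
    (π.ext x).hom f * π.perm.u x y = π.perm.u x y * (π.ext x).hom f := by
  obtain ⟨s, hs, -⟩ := (π.nondegenerate x).pou.2
  have h : (π.ext x).hom f = ∑ i ∈ s, π.rep x (blockC0 G.dim i (f i)) :=
    glue_eq_sum (π.nondegenerate x).pou f hs
  rw [h, Finset.sum_mul, Finset.mul_sum]
  exact Finset.sum_congr rfl fun i _ => π.comm x y _

/-- A wreath corepresentation built from representations of all functions. -/
def ofNormal (φ : X → NormalRep G H) (u : QuantumPermutation X H)
    (h : ∀ x y f, (φ x).hom f * u.u x y = u.u x y * (φ x).hom f) : WreathCorep G X H where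
  rep x := (φ x).restrict
  nondegenerate x := (φ x).restrict_nondegenerate
  perm := u
  comm x y f := h x y _

theorem ofNormal_ext (φ : X → NormalRep G H) (u : QuantumPermutation X H)
    (h : ∀ x y f, (φ x).hom f * u.u x y = u.u x y * (φ x).hom f) (x : X) :
    (ofNormal φ u h).ext x = φ x := NormalRep.extend_restrict _

end WreathCorep

end NormalExtension

theorem IsPOU.ext_comp {ι H M : Type*} [NormedAddCommGroup H] [InnerProductSpace ℂ H]
    [NormedAddCommGroup M] [InnerProductSpace ℂ M] {P : ι → H →L[ℂ] H} (hP : IsPOU P)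
    {A B : H →L[ℂ] M} (h : ∀ i, A ∘L P i = B ∘L P i) : A = B := by
  obtain ⟨-, s, -, hsum⟩ := hP
  have e : ∀ C : H →L[ℂ] M, C = ∑ i ∈ s, C ∘L P i := fun C => by
    rw [← ContinuousLinearMap.comp_finsetSum, hsum]; rfl
  rw [e A, e B]
  exact Finset.sum_congr rfl fun i _ => h i

section Intertwines

open TensorProduct

universe u

variable {G : DiscreteQuantumGroup.{u}}
variable {H H' H'' K K' L : Type*}
  [NormedAddCommGroup H] [InnerProductSpace ℂ H] [FiniteDimensional ℂ H] [CompleteSpace H]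
  [NormedAddCommGroup H'] [InnerProductSpace ℂ H'] [FiniteDimensional ℂ H'] [CompleteSpace H']
  [NormedAddCommGroup H''] [InnerProductSpace ℂ H''] [FiniteDimensional ℂ H''] [CompleteSpace H'']
  [NormedAddCommGroup K] [InnerProductSpace ℂ K] [FiniteDimensional ℂ K] [CompleteSpace K]
  [NormedAddCommGroup K'] [InnerProductSpace ℂ K'] [FiniteDimensional ℂ K'] [CompleteSpace K']
  [NormedAddCommGroup L] [InnerProductSpace ℂ L] [FiniteDimensional ℂ L] [CompleteSpace L]

namespace NormalRep

/-- The operator `T` intertwines `φ` and `ψ`. -/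
def Intertwines (φ : NormalRep G H) (ψ : NormalRep G K) (T : H →L[ℂ] K) : Prop :=
  ∀ f, T ∘L φ.hom f = ψ.hom f ∘L T

theorem Intertwines.comp {φ : NormalRep G H} {φ' : NormalRep G H'} {φ'' : NormalRep G H''}
    {S : H' →L[ℂ] H''} {T : H →L[ℂ] H'} (hS : φ'.Intertwines φ'' S) (hT : φ.Intertwines φ' T) :
    φ.Intertwines φ'' (S ∘L T) := fun f => by
  rw [ContinuousLinearMap.comp_assoc, hT, ← ContinuousLinearMap.comp_assoc, hS,
    ContinuousLinearMap.comp_assoc]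

theorem Intertwines.one (φ : NormalRep G H) : φ.Intertwines φ 1 := fun _ => rfl

theorem Intertwines.map {φ : NormalRep G H} {φ' : NormalRep G H'} {ψ : NormalRep G K}
    {ψ' : NormalRep G K'} {T : H →L[ℂ] H'} {S : K →L[ℂ] K'} (hT : φ.Intertwines φ' T)
    (hS : ψ.Intertwines ψ' S) : (φ.mul ψ).Intertwines (φ'.mul ψ') (HTensor.map T S) :=
  fun f => box_intertwine hT hS (G.comul f)

theorem hom_eq_sum (φ : NormalRep G H) (f : G.Fun) {s : Finset G.Irr}
    (hs : ∀ i, i ∉ s → φ.block i 1 = 0) : φ.hom f = ∑ i ∈ s, φ.block i (f i) := by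
  refine φ.pou.ext_right fun j => ?_
  rw [hom_mul_block, Finset.sum_mul]
  by_cases hj : j ∈ s
  · rw [Finset.sum_eq_single_of_mem j hj, tau_mul_one]
    exact fun i _ hij => tau_mul_ne φ.pou hij _ _
  · have h0 : φ.block j 1 = 0 := hs j hj
    rw [← tau_one_mul, h0, zero_mul, Finset.sum_eq_zero]
    exact fun i _ => mul_zero _

theorem intertwines_of_block {φ : NormalRep G H} {ψ : NormalRep G K} {T : H →L[ℂ] K}
    (h : ∀ i a, T ∘L φ.block i a = ψ.block i a ∘L T) : φ.Intertwines ψ T := fun f => by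
  classical
  obtain ⟨s, hs, -⟩ := φ.pou.2
  obtain ⟨t, ht, -⟩ := ψ.pou.2
  rw [hom_eq_sum φ f (s := s ∪ t) (fun i hi => hs i fun h => hi (Finset.mem_union_left _ h)),
    hom_eq_sum ψ f (s := s ∪ t) (fun i hi => ht i fun h => hi (Finset.mem_union_right _ h)),
    ContinuousLinearMap.comp_finsetSum, ContinuousLinearMap.finsetSum_comp]
  exact Finset.sum_congr rfl fun i _ => h i _

/-- The counit, as a representation on `ℂ`. -/
def counit (G : DiscreteQuantumGroup.{u}) : NormalRep G ℂ where
  hom := (StarAlgHom.ofId ℂ (ℂ →L[ℂ] ℂ)).comp G.counit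
  dep := by
    obtain ⟨s, hs⟩ := G.counit_dependsOn
    exact ⟨s, fun f g h => congrArg (StarAlgHom.ofId ℂ (ℂ →L[ℂ] ℂ)) (hs h)⟩

theorem counit_hom_apply (f : G.Fun) (c : ℂ) : (counit G).hom f c = G.counit f * c := rfl

theorem lid_intertwines (φ : NormalRep G H) :
    ((counit G).mul φ).Intertwines φ (HTensor.lid H : HTensor ℂ H →L[ℂ] H) := fun f => by
  obtain ⟨s, hs, -⟩ := (counit G).pou.2
  obtain ⟨t, ht, -⟩ := φ.pou.2
  rw [mul_hom, box_eq_sum (counit G) φ _ hs ht, hom_eq_sum φ f ht, Finset.sum_product_right,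
    ContinuousLinearMap.comp_finsetSum, ContinuousLinearMap.finsetSum_comp]
  refine Finset.sum_congr rfl fun j _ => ?_
  have hz : ∀ i, i ∉ s → G.counit.toAlgHom.toLinearMap ∘ₗ blockIncl G.dim i = 0 := fun i hi => by
    ext1 a
    have h1 : (counit G).block i a 1 = 0 := by
      rw [← tau_one_mul, show (counit G).block i 1 = 0 from hs i hi, zero_mul]; rfl
    rw [block_apply, counit_hom_apply, mul_one] at h1
    exact h1
  rw [← G.counit_left f j, finsum_eq_sum_of_support_subset (s := s) _ (fun i hi => by
    by_contra his
    refine hi ?_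
    dsimp only
    rw [hz i his, LinearMap.rTensor_zero, LinearMap.zero_apply, map_zero]), map_sum,
    ContinuousLinearMap.comp_finsetSum, ContinuousLinearMap.finsetSum_comp]
  refine Finset.sum_congr rfl fun i _ => ?_
  induction G.comul f (i, j) using TensorProduct.induction_on with
  | zero => simp
  | add a b ha hb =>
    rw [map_add, map_add, map_add, map_add, ContinuousLinearMap.comp_add,
      ContinuousLinearMap.add_comp, ha, hb]
  | tmul a b =>
    refine HTensor.ext fun c ξ => ?_
    change (G.counit (blockIncl G.dim i a) * c) • φ.block j b ξ =
      φ.block j (G.counit (blockIncl G.dim i a) • b) (c • ξ)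
    rw [map_smul, map_smul, ContinuousLinearMap.smul_apply, smul_smul, mul_comm]

theorem rid_intertwines (φ : NormalRep G H) :
    (φ.mul (counit G)).Intertwines φ (HTensor.rid H : HTensor H ℂ →L[ℂ] H) := fun f => by
  obtain ⟨s, hs, -⟩ := (counit G).pou.2
  obtain ⟨t, ht, -⟩ := φ.pou.2
  rw [mul_hom, box_eq_sum φ (counit G) _ ht hs, hom_eq_sum φ f ht, Finset.sum_product,
    ContinuousLinearMap.comp_finsetSum, ContinuousLinearMap.finsetSum_comp]
  refine Finset.sum_congr rfl fun j _ => ?_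
  have hz : ∀ i, i ∉ s → G.counit.toAlgHom.toLinearMap ∘ₗ blockIncl G.dim i = 0 := fun i hi => by
    ext1 a
    have h1 : (counit G).block i a 1 = 0 := by
      rw [← tau_one_mul, show (counit G).block i 1 = 0 from hs i hi, zero_mul]; rfl
    rw [block_apply, counit_hom_apply, mul_one] at h1
    exact h1
  rw [← G.counit_right f j, finsum_eq_sum_of_support_subset (s := s) _ (fun i hi => by
    by_contra his
    refine hi ?_
    dsimp only
    rw [hz i his, LinearMap.lTensor_zero, LinearMap.zero_apply, map_zero]), map_sum,
    ContinuousLinearMap.comp_finsetSum, ContinuousLinearMap.finsetSum_comp]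
  refine Finset.sum_congr rfl fun i _ => ?_
  induction G.comul f (j, i) using TensorProduct.induction_on with
  | zero => simp
  | add a b ha hb =>
    rw [map_add, map_add, map_add, map_add, ContinuousLinearMap.comp_add,
      ContinuousLinearMap.add_comp, ha, hb]
  | tmul a b =>
    refine HTensor.ext fun ξ c => ?_
    change (G.counit (blockIncl G.dim i b) * c) • φ.block j a ξ =
      φ.block j (G.counit (blockIncl G.dim i b) • a) (c • ξ)
    rw [map_smul, map_smul, ContinuousLinearMap.smul_apply, smul_smul, mul_comm]

theorem comul_block_eq_zero (p : G.Irr × G.Irr) : ∃ s : Finset G.Irr, ∀ l, l ∉ s →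
    LinearMap.proj p ∘ₗ G.comul.toAlgHom.toLinearMap ∘ₗ blockIncl G.dim l = 0 := by
  classical
  obtain ⟨s, hs⟩ := G.comul_dependsOn p
  refine ⟨s, fun l hl => ?_⟩
  ext1 a
  have h : G.comul (blockIncl G.dim l a) p = G.comul 0 p := hs fun j hj => by
    have : j ≠ l := fun h => hl (h ▸ hj)
    simp [blockIncl, Pi.single_eq_of_ne this]
  rw [map_zero] at h
  exact h

theorem mul_block (φ : NormalRep G H) (ψ : NormalRep G K) {s t : Finset G.Irr}
    (hs : ∀ i, i ∉ s → φ.block i 1 = 0) (ht : ∀ i, i ∉ t → ψ.block i 1 = 0) (l : G.Irr)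
    (a : G.Block l) : (φ.mul ψ).block l a =
      ∑ p ∈ s ×ˢ t, φ.pairBlock ψ p (G.comul (blockIncl G.dim l a) p) := by
  rw [block_apply, mul_hom, box_eq_sum φ ψ _ hs ht]

theorem box_mul_left_eq (φ : NormalRep G H) (ψ : NormalRep G K) (χ : NormalRep G L)
    {s t r : Finset G.Irr} (hs : ∀ i, i ∉ s → φ.block i 1 = 0) (ht : ∀ i, i ∉ t → ψ.block i 1 = 0)
    (hr : ∀ i, i ∉ r → χ.block i 1 = 0) (m : MatFun₂ G.dim) :
    (φ.mul ψ).box χ m = ∑ k ∈ r, ∑ p ∈ s ×ˢ t,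
      HTensor.pairHom (φ.pairBlock ψ p) (χ.block k) (∑ᶠ l,
        ((LinearMap.proj p ∘ₗ G.comul.toAlgHom.toLinearMap ∘ₗ blockIncl G.dim l).rTensor
          (MatBlock G.dim k)) (m (l, k))) := by
  classical
  choose w hw using fun p => comul_block_eq_zero (G := G) p
  obtain ⟨v, hv, -⟩ := (φ.mul ψ).pou.2
  set q := v ∪ (s ×ˢ t).biUnion w with hq
  have hvq : ∀ i, i ∉ q → (φ.mul ψ).block i 1 = 0 :=
    fun i hi => hv i fun h => hi (Finset.mem_union_left _ h)
  rw [box_eq_sum _ χ m hvq hr, Finset.sum_product_right]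
  refine Finset.sum_congr rfl fun k _ => ?_
  have h1 : ∀ p ∈ s ×ˢ t, (∑ᶠ l,
        ((LinearMap.proj p ∘ₗ G.comul.toAlgHom.toLinearMap ∘ₗ blockIncl G.dim l).rTensor
          (MatBlock G.dim k)) (m (l, k))) = ∑ l ∈ q,
        ((LinearMap.proj p ∘ₗ G.comul.toAlgHom.toLinearMap ∘ₗ blockIncl G.dim l).rTensor
          (MatBlock G.dim k)) (m (l, k)) := fun p hp =>
    finsum_eq_sum_of_support_subset _ fun l hl => by
      by_contra h
      refine hl ?_
      dsimp only
      rw [hw p l fun h' => h (Finset.mem_union_right _ (Finset.mem_biUnion.mpr ⟨p, hp, h'⟩)),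
        LinearMap.rTensor_zero, LinearMap.zero_apply]
  refine Eq.symm (Eq.trans (Finset.sum_congr rfl fun p hp =>
    (congrArg _ (h1 p hp)).trans (map_sum _ _ _)) ?_)
  rw [Finset.sum_comm]
  refine Finset.sum_congr rfl fun l _ => Eq.symm ?_
  induction m (l, k) using TensorProduct.induction_on with
  | zero => simp
  | add a b ha hb => simp only [map_add, ha, hb, Finset.sum_add_distrib]
  | tmul a b =>
    rw [pairBlock_tmul, mul_block φ ψ hs ht, HTensor.sum_map]
    rfl

theorem box_mul_right_eq (φ : NormalRep G H) (ψ : NormalRep G K) (χ : NormalRep G L)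
    {s t r : Finset G.Irr} (hs : ∀ i, i ∉ s → φ.block i 1 = 0) (ht : ∀ i, i ∉ t → ψ.block i 1 = 0)
    (hr : ∀ i, i ∉ r → χ.block i 1 = 0) (m : MatFun₂ G.dim) :
    φ.box (ψ.mul χ) m = ∑ i ∈ s, ∑ p ∈ t ×ˢ r,
      HTensor.pairHom (φ.block i) (ψ.pairBlock χ p) (∑ᶠ l,
        ((LinearMap.proj p ∘ₗ G.comul.toAlgHom.toLinearMap ∘ₗ blockIncl G.dim l).lTensor
          (MatBlock G.dim i)) (m (i, l))) := by
  classical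
  choose w hw using fun p => comul_block_eq_zero (G := G) p
  obtain ⟨v, hv, -⟩ := (ψ.mul χ).pou.2
  set q := v ∪ (t ×ˢ r).biUnion w with hq
  have hvq : ∀ i, i ∉ q → (ψ.mul χ).block i 1 = 0 :=
    fun i hi => hv i fun h => hi (Finset.mem_union_left _ h)
  rw [box_eq_sum φ _ m hs hvq, Finset.sum_product]
  refine Finset.sum_congr rfl fun i _ => ?_
  have h1 : ∀ p ∈ t ×ˢ r, (∑ᶠ l,
        ((LinearMap.proj p ∘ₗ G.comul.toAlgHom.toLinearMap ∘ₗ blockIncl G.dim l).lTensor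
          (MatBlock G.dim i)) (m (i, l))) = ∑ l ∈ q,
        ((LinearMap.proj p ∘ₗ G.comul.toAlgHom.toLinearMap ∘ₗ blockIncl G.dim l).lTensor
          (MatBlock G.dim i)) (m (i, l)) := fun p hp =>
    finsum_eq_sum_of_support_subset _ fun l hl => by
      by_contra h
      refine hl ?_
      dsimp only
      rw [hw p l fun h' => h (Finset.mem_union_right _ (Finset.mem_biUnion.mpr ⟨p, hp, h'⟩)),
        LinearMap.lTensor_zero, LinearMap.zero_apply]
  refine Eq.symm (Eq.trans (Finset.sum_congr rfl fun p hp =>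
    (congrArg _ (h1 p hp)).trans (map_sum _ _ _)) ?_)
  rw [Finset.sum_comm]
  refine Finset.sum_congr rfl fun l _ => Eq.symm ?_
  induction m (i, l) using TensorProduct.induction_on with
  | zero => simp
  | add a b ha hb => simp only [map_add, ha, hb, Finset.sum_add_distrib]
  | tmul a b =>
    rw [pairBlock_tmul, mul_block ψ χ ht hr, HTensor.map_sum']
    rfl

theorem assoc_pair (α : NormalRep G H) (β : NormalRep G K) (γ : NormalRep G L) (i j k : G.Irr)
    (m : (G.Block i ⊗[ℂ] G.Block j) ⊗[ℂ] G.Block k) :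
    (HTensor.assoc H K L : _ →L[ℂ] _) ∘L
      HTensor.pairHom (α.pairBlock β (i, j)) (γ.block k) m =
    HTensor.pairHom (α.block i) (β.pairBlock γ (j, k))
      (TensorProduct.assoc ℂ (G.Block i) (G.Block j) (G.Block k) m) ∘L
        (HTensor.assoc H K L : _ →L[ℂ] _) := by
  induction m using TensorProduct.induction_on with
  | zero => simp
  | add a b ha hb =>
    rw [map_add, map_add, map_add, ContinuousLinearMap.comp_add, ContinuousLinearMap.add_comp, ha,
      hb]
  | tmul m c =>
    induction m using TensorProduct.induction_on with
    | zero => simp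
    | add a b ha hb =>
      rw [TensorProduct.add_tmul, map_add, map_add, map_add, ContinuousLinearMap.comp_add,
        ContinuousLinearMap.add_comp, ha, hb]
    | tmul a b => exact HTensor.ext₃ fun ξ η ζ => rfl

theorem assoc_intertwines (φ : NormalRep G H) (ψ : NormalRep G K) (χ : NormalRep G L) :
    ((φ.mul ψ).mul χ).Intertwines (φ.mul (ψ.mul χ))
      (HTensor.assoc H K L : HTensor (HTensor H K) L →L[ℂ] HTensor H (HTensor K L)) := fun f => by
  obtain ⟨s, hs, -⟩ := φ.pou.2
  obtain ⟨t, ht, -⟩ := ψ.pou.2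
  obtain ⟨r, hr, -⟩ := χ.pou.2
  rw [mul_hom, mul_hom, box_mul_left_eq φ ψ χ hs ht hr, box_mul_right_eq φ ψ χ hs ht hr]
  simp only [Finset.sum_product]
  rw [Finset.sum_comm]
  rw [ContinuousLinearMap.comp_finsetSum, ContinuousLinearMap.finsetSum_comp]
  refine Finset.sum_congr rfl fun i _ => ?_
  rw [Finset.sum_comm]
  rw [ContinuousLinearMap.comp_finsetSum, ContinuousLinearMap.finsetSum_comp]
  refine Finset.sum_congr rfl fun j _ => ?_
  rw [ContinuousLinearMap.comp_finsetSum, ContinuousLinearMap.finsetSum_comp]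
  refine Finset.sum_congr rfl fun k _ => ?_
  rw [← G.coassoc f i j k]
  exact assoc_pair φ ψ χ i j k _

theorem glueProj_intertwines {X : Type*} (φ : X → NormalRep G H) (P : X → H →L[ℂ] H) (hP : IsPOU P)
    (hproj : ∀ y, IsStarProjection (P y)) (hcomm : ∀ y f, (φ y).hom f * P y = P y * (φ y).hom f)
    (y : X) : (φ y).Intertwines (glueProj φ P hP hproj hcomm) (P y) := fun f => by
  refine Eq.trans ?_ (glueProj_mul φ P hP hproj hcomm f y).symm
  exact (hcomm y f).symm

/-- Intertwiners out of a representation are detected on the members of a partition of unity. -/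
theorem intertwines_of_pou {ι : Type*} {φ : NormalRep G H} {ψ : NormalRep G K} {T : H →L[ℂ] K} {P : ι → H →L[ℂ] H} (hP : IsPOU P)
    {θ : ι → NormalRep G H} (h1 : ∀ i, (θ i).Intertwines φ (P i))
    (h2 : ∀ i, (θ i).Intertwines ψ (T ∘L P i)) : φ.Intertwines ψ T := fun f => by
  refine hP.ext_comp fun i => ?_
  rw [ContinuousLinearMap.comp_assoc, ← h1 i f, ← ContinuousLinearMap.comp_assoc, h2 i f,
    ContinuousLinearMap.comp_assoc]

end NormalRep

end Intertwines

section WreathTensor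

open scoped Matrix.Norms.L2Operator

universe u v

variable {G : DiscreteQuantumGroup.{u}} {X : Type v}
variable {H H' K K' L : Type*}
  [NormedAddCommGroup H] [InnerProductSpace ℂ H] [FiniteDimensional ℂ H] [CompleteSpace H]
  [NormedAddCommGroup H'] [InnerProductSpace ℂ H'] [FiniteDimensional ℂ H'] [CompleteSpace H']
  [NormedAddCommGroup K] [InnerProductSpace ℂ K] [FiniteDimensional ℂ K] [CompleteSpace K]
  [NormedAddCommGroup K'] [InnerProductSpace ℂ K'] [FiniteDimensional ℂ K'] [CompleteSpace K']
  [NormedAddCommGroup L] [InnerProductSpace ℂ L] [FiniteDimensional ℂ L] [CompleteSpace L]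

theorem HTensor.isStarProjection_map {P : H →L[ℂ] H} {Q : K →L[ℂ] K} (hP : IsStarProjection P)
    (hQ : IsStarProjection Q) : IsStarProjection (HTensor.map P Q) :=
  ⟨by
    change HTensor.map P Q * HTensor.map P Q = HTensor.map P Q
    rw [← HTensor.map_mul, hP.isIdempotentElem.eq, hQ.isIdempotentElem.eq],
    by
    change star (HTensor.map P Q) = HTensor.map P Q
    rw [HTensor.star_map, hP.isSelfAdjoint.star_eq, hQ.isSelfAdjoint.star_eq]⟩

namespace WreathCorep

theorem perm_intertwines (π : WreathCorep G X H) (x y : X) :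
    (π.ext x).Intertwines (π.ext x) (π.perm.u x y) := fun f => (π.ext_comm x y f).symm

/-- The representation `(π ⊗ ρ)^G_x`, given by
`f ↦ ∑ y, (π^G_x ⊗ ρ^G_y)(Δ f) (π^X_{xy} ⊗ 1)`. -/
def tensorRep (π : WreathCorep G X H) (ρ : WreathCorep G X K) (x : X) :
    NormalRep G (HTensor H K) :=
  NormalRep.glueProj (fun y => (π.ext x).mul (ρ.ext y))
    (fun y => HTensor.map (π.perm.u x y) (1 : K →L[ℂ] K)) (π.perm.row_pou x).map_left
    (fun y => HTensor.isStarProjection_map (π.perm.isProj x y) (IsStarProjection.one _))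
    (fun y f => (((π.perm_intertwines x y).map (NormalRep.Intertwines.one (ρ.ext y))) f).symm)

theorem tensorRep_hom (π : WreathCorep G X H) (ρ : WreathCorep G X K) (x : X) (f : G.Fun) :
    (π.tensorRep ρ x).hom f = ∑ᶠ y, (π.ext x).box (ρ.ext y) (G.comul f) *
      HTensor.map (π.perm.u x y) 1 := rfl

/-- The components of the tensor product in terms of its constituents. -/
theorem tensorRep_intertwines (π : WreathCorep G X H) (ρ : WreathCorep G X K) (x y : X)
    {S : K →L[ℂ] K} (hS : (ρ.ext y).Intertwines (ρ.ext y) S) :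
    ((π.ext x).mul (ρ.ext y)).Intertwines (π.tensorRep ρ x) (HTensor.map (π.perm.u x y) S) := by
  have h1 := (NormalRep.glueProj_intertwines (fun y => (π.ext x).mul (ρ.ext y))
    (fun y => HTensor.map (π.perm.u x y) (1 : K →L[ℂ] K)) (π.perm.row_pou x).map_left
    (fun y => HTensor.isStarProjection_map (π.perm.isProj x y) (IsStarProjection.one _))
    (fun y f => (((π.perm_intertwines x y).map (NormalRep.Intertwines.one (ρ.ext y))) f).symm) y)
  have h2 := h1.comp ((NormalRep.Intertwines.one (π.ext x)).map hS)
  rw [← HTensor.map_comp] at h2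
  exact h2

theorem tensor_comm (π : WreathCorep G X H) (ρ : WreathCorep G X K) (x y : X) :
    (π.tensorRep ρ x).Intertwines (π.tensorRep ρ x) (π.perm.tensorU ρ.perm x y) := by
  refine NormalRep.intertwines_of_pou (P := fun z => HTensor.map (π.perm.u x z) (1 : K →L[ℂ] K))
    (π.perm.row_pou x).map_left (θ := fun z => (π.ext x).mul (ρ.ext z)) (fun z => ?_) (fun z => ?_)
  · exact π.tensorRep_intertwines ρ x z (NormalRep.Intertwines.one _)
  · have h := π.perm.tensorU_mul_row ρ.perm x y z
    change π.perm.tensorU ρ.perm x y ∘L HTensor.map (π.perm.u x z) 1 = _ at h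
    rw [h]
    exact π.tensorRep_intertwines ρ x z (ρ.perm_intertwines z y)

/-- The tensor product of finite dimensional `X`-free wreath corepresentations. -/
def tensor (π : WreathCorep G X H) (ρ : WreathCorep G X K) : WreathCorep G X (HTensor H K) :=
  ofNormal (π.tensorRep ρ) (π.perm.tensor ρ.perm) (fun x y f => (π.tensor_comm ρ x y f).symm)

theorem tensor_rep (π : WreathCorep G X H) (ρ : WreathCorep G X K) (x : X) (f : G.C0) :
    (π.tensor ρ).rep x f = ∑ᶠ y, (π.ext x).box (ρ.ext y) (G.comul (c0ToFun G.dim f)) *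
      HTensor.map (π.perm.u x y) 1 := rfl

theorem tensor_perm (π : WreathCorep G X H) (ρ : WreathCorep G X K) (x y : X) :
    (π.tensor ρ).perm.u x y = ∑ᶠ z, HTensor.map (π.perm.u x z) (ρ.perm.u z y) := rfl

theorem tensor_ext (π : WreathCorep G X H) (ρ : WreathCorep G X K) (x : X) :
    (π.tensor ρ).ext x = π.tensorRep ρ x := ofNormal_ext _ _ _ x

/-- The trivial `X`-free wreath corepresentation. -/
def unit (G : DiscreteQuantumGroup.{u}) (X : Type v) : WreathCorep G X ℂ :=
  ofNormal (fun _ => NormalRep.counit G) (QuantumPermutation.trivial X) (fun x y f => by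
    by_cases h : x = y
    · subst h
      rw [QuantumPermutation.trivial_self, one_mul, mul_one]
    · rw [QuantumPermutation.trivial_ne h, zero_mul, mul_zero])

theorem unit_ext (x : X) : (unit G X).ext x = NormalRep.counit G := ofNormal_ext _ _ _ x

/-- `T` intertwines the `X`-free wreath corepresentations `π` and `ρ`. -/
structure Intertwines (π : WreathCorep G X H) (ρ : WreathCorep G X K) (T : H →L[ℂ] K) : Prop where
  rep : ∀ x f, T ∘L π.rep x f = ρ.rep x f ∘L T
  perm : ∀ x y, T ∘L π.perm.u x y = ρ.perm.u x y ∘L T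

theorem intertwines_ext {π : WreathCorep G X H} {ρ : WreathCorep G X K} {T : H →L[ℂ] K}
    (hT : π.Intertwines ρ T) (x : X) : (π.ext x).Intertwines (ρ.ext x) T :=
  NormalRep.intertwines_of_block fun i a => by rw [ext_block, ext_block, hT.rep]

theorem intertwines_of_ext {π : WreathCorep G X H} {ρ : WreathCorep G X K} {T : H →L[ℂ] K}
    (h : ∀ x, (π.ext x).Intertwines (ρ.ext x) T)
    (h' : ∀ x y, T ∘L π.perm.u x y = ρ.perm.u x y ∘L T) : π.Intertwines ρ T :=
  ⟨fun x f => by rw [← ext_hom, ← ext_hom, h], h'⟩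

theorem Intertwines.id (π : WreathCorep G X H) : π.Intertwines π (.id ℂ H) :=
  ⟨fun _ _ => rfl, fun _ _ => rfl⟩

theorem Intertwines.comp {π : WreathCorep G X H} {ρ : WreathCorep G X K} {σ : WreathCorep G X L}
    {S : K →L[ℂ] L} {T : H →L[ℂ] K} (hS : ρ.Intertwines σ S) (hT : π.Intertwines ρ T) :
    π.Intertwines σ (S ∘L T) where
  rep x f := by
    rw [ContinuousLinearMap.comp_assoc, hT.rep, ← ContinuousLinearMap.comp_assoc, hS.rep,
      ContinuousLinearMap.comp_assoc]
  perm x y := by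
    rw [ContinuousLinearMap.comp_assoc, hT.perm, ← ContinuousLinearMap.comp_assoc, hS.perm,
      ContinuousLinearMap.comp_assoc]

theorem Intertwines.symm {π : WreathCorep G X H} {ρ : WreathCorep G X K} {e : H ≃ₗᵢ[ℂ] K}
    (h : π.Intertwines ρ (e : H →L[ℂ] K)) : ρ.Intertwines π (e.symm : K →L[ℂ] H) where
  rep x f := by
    ext ξ
    have := congrArg (fun T : H →L[ℂ] K => e.symm (T (e.symm ξ))) (h.rep x f)
    simpa using this.symm
  perm x y := by
    ext ξ
    have := congrArg (fun T : H →L[ℂ] K => e.symm (T (e.symm ξ))) (h.perm x y)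
    simpa using this.symm

theorem Intertwines.map {π : WreathCorep G X H} {π' : WreathCorep G X H'} {ρ : WreathCorep G X K}
    {ρ' : WreathCorep G X K'} {T : H →L[ℂ] H'} {S : K →L[ℂ] K'} (hT : π.Intertwines π' T)
    (hS : ρ.Intertwines ρ' S) : (π.tensor ρ).Intertwines (π'.tensor ρ') (HTensor.map T S) := by
  refine intertwines_of_ext (fun x => ?_) (fun x y => ?_)
  · rw [tensor_ext, tensor_ext]
    refine NormalRep.intertwines_of_pou (P := fun z => HTensor.map (π.perm.u x z) (1 : K →L[ℂ] K))
      (π.perm.row_pou x).map_left (θ := fun z => (π.ext x).mul (ρ.ext z)) (fun z => ?_)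
      (fun z => ?_)
    · exact π.tensorRep_intertwines ρ x z (NormalRep.Intertwines.one _)
    · have h := (π'.tensorRep_intertwines ρ' x z (NormalRep.Intertwines.one _)).comp
        ((intertwines_ext hT x).map (intertwines_ext hS z))
      rw [← HTensor.map_comp, ← hT.perm] at h
      rw [← HTensor.map_comp]
      exact h
  · refine (π.perm.row_pou x).map_left.ext_comp (M := HTensor H' K') fun z => ?_
    have h1 := π.perm.tensorU_mul_row ρ.perm x y z
    have h2 := π'.perm.tensorU_mul_row ρ'.perm x y z
    change (π.tensor ρ).perm.u x y ∘L HTensor.map (π.perm.u x z) 1 = _ at h1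
    change (π'.tensor ρ').perm.u x y ∘L HTensor.map (π'.perm.u x z) 1 = _ at h2
    have h3 : HTensor.map T S ∘L HTensor.map (π.perm.u x z) (1 : K →L[ℂ] K) =
        HTensor.map (π'.perm.u x z) 1 ∘L HTensor.map T S := by
      rw [← HTensor.map_comp, ← HTensor.map_comp, hT.perm]; rfl
    rw [ContinuousLinearMap.comp_assoc, h1, ContinuousLinearMap.comp_assoc, h3,
      ← ContinuousLinearMap.comp_assoc, h2, ← HTensor.map_comp, ← HTensor.map_comp, hT.perm,
      hS.perm]

theorem trivial_row (x y : X) (h : x ≠ y) : (unit G X).perm.u x y = 0 :=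
  QuantumPermutation.trivial_ne h

theorem trivial_diag (x : X) : (unit G X).perm.u x x = 1 := QuantumPermutation.trivial_self x

theorem lid_intertwines (π : WreathCorep G X H) :
    ((unit G X).tensor π).Intertwines π (HTensor.lid H : HTensor ℂ H →L[ℂ] H) := by
  refine intertwines_of_ext (fun x => ?_) (fun x y => ?_)
  · rw [tensor_ext]
    have h1 := (unit G X).tensorRep_intertwines π x x (NormalRep.Intertwines.one _)
    rw [trivial_diag, HTensor.map_one, unit_ext] at h1
    intro f
    have h2 := h1 f
    have h3 : ((unit G X).tensorRep π x).hom f = ((NormalRep.counit G).mul (π.ext x)).hom f :=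
      h2.symm
    rw [h3]
    exact NormalRep.lid_intertwines (π.ext x) f
  · have h1 := (unit G X).perm.tensorU_mul_row π.perm x y x
    rw [trivial_diag, HTensor.map_one, mul_one] at h1
    change _ ∘L (unit G X).perm.tensorU π.perm x y = _
    rw [h1]
    exact HTensor.ext fun c ξ => (map_smul (π.perm.u x y) c ξ).symm

theorem rid_intertwines (π : WreathCorep G X H) :
    (π.tensor (unit G X)).Intertwines π (HTensor.rid H : HTensor H ℂ →L[ℂ] H) := by
  refine intertwines_of_ext (fun x => ?_) (fun x y => ?_)
  · rw [tensor_ext]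
    refine NormalRep.intertwines_of_pou (P := fun z => HTensor.map (π.perm.u x z) (1 : ℂ →L[ℂ] ℂ))
      (π.perm.row_pou x).map_left (θ := fun z => (π.ext x).mul ((unit G X).ext z)) (fun z => ?_)
      (fun z => ?_)
    · exact π.tensorRep_intertwines (unit G X) x z (NormalRep.Intertwines.one _)
    · rw [unit_ext]
      exact (NormalRep.rid_intertwines (π.ext x)).comp
        ((π.perm_intertwines x z).map (NormalRep.Intertwines.one _))
  · refine (π.perm.row_pou x).map_left.ext_comp (M := H) fun z => ?_
    have h1 := π.perm.tensorU_mul_row (unit G X).perm x y z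
    change (π.tensor (unit G X)).perm.u x y ∘L HTensor.map (π.perm.u x z) 1 = _ at h1
    rw [ContinuousLinearMap.comp_assoc, h1]
    by_cases hzy : z = y
    · subst hzy
      rw [trivial_diag]
      refine HTensor.ext fun ξ c => ?_
      change c • π.perm.u x z ξ = π.perm.u x z (c • π.perm.u x z ξ)
      rw [map_smul]
      congr 1
      exact (congrArg (fun T : H →L[ℂ] H => T ξ) (π.perm.isProj x z).isIdempotentElem.eq).symm
    · rw [trivial_row z y hzy, HTensor.map_zero_right, ContinuousLinearMap.comp_zero]
      refine HTensor.ext fun ξ c => ?_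
      change (0 : H) = π.perm.u x y (c • π.perm.u x z ξ)
      have h0 : π.perm.u x y (π.perm.u x z ξ) = 0 :=
        congrArg (fun T : H →L[ℂ] H => T ξ) (π.perm.row_orth x y z (Ne.symm hzy))
      rw [map_smul, h0, smul_zero]

theorem assoc_pou (π : WreathCorep G X H) (ρ : WreathCorep G X K) (L : Type*)
    [NormedAddCommGroup L] [InnerProductSpace ℂ L] (x : X) {M : Type*} [NormedAddCommGroup M]
    [InnerProductSpace ℂ M] {A B : HTensor (HTensor H K) L →L[ℂ] M}
    (h : ∀ y z, A ∘L HTensor.map (HTensor.map (π.perm.u x y) (ρ.perm.u y z)) (1 : L →L[ℂ] L) =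
      B ∘L HTensor.map (HTensor.map (π.perm.u x y) (ρ.perm.u y z)) (1 : L →L[ℂ] L)) : A = B := by
  have h1 : IsPOU fun y => HTensor.map (HTensor.map (π.perm.u x y) (1 : K →L[ℂ] K))
      (1 : L →L[ℂ] L) := (π.perm.row_pou x).map_left.map_left
  refine h1.ext_comp fun y => ?_
  have h2 : IsPOU fun z => HTensor.map (HTensor.map (1 : H →L[ℂ] H) (ρ.perm.u y z))
      (1 : L →L[ℂ] L) := (ρ.perm.row_pou y).map_right.map_left
  refine h2.ext_comp fun z => ?_
  have h3 : HTensor.map (HTensor.map (π.perm.u x y) (1 : K →L[ℂ] K)) (1 : L →L[ℂ] L) ∘L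
      HTensor.map (HTensor.map (1 : H →L[ℂ] H) (ρ.perm.u y z)) (1 : L →L[ℂ] L) =
      HTensor.map (HTensor.map (π.perm.u x y) (ρ.perm.u y z)) (1 : L →L[ℂ] L) := by
    rw [← HTensor.map_comp, ← HTensor.map_comp]; rfl
  rw [ContinuousLinearMap.comp_assoc, ContinuousLinearMap.comp_assoc, h3, h]

theorem assoc_intertwines (π : WreathCorep G X H) (ρ : WreathCorep G X K) (σ : WreathCorep G X L) :
    ((π.tensor ρ).tensor σ).Intertwines (π.tensor (ρ.tensor σ))
      (HTensor.assoc H K L : HTensor (HTensor H K) L →L[ℂ] HTensor H (HTensor K L)) := by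
  have hα : ∀ (A : H →L[ℂ] H) (B : K →L[ℂ] K) (C : L →L[ℂ] L),
      (HTensor.assoc H K L : HTensor (HTensor H K) L →L[ℂ] HTensor H (HTensor K L)) ∘L
        HTensor.map (HTensor.map A B) C = HTensor.map A (HTensor.map B C) ∘L
        (HTensor.assoc H K L : HTensor (HTensor H K) L →L[ℂ] HTensor H (HTensor K L)) :=
    fun A B C => HTensor.ext₃ fun _ _ _ => rfl
  have hE : ∀ x y z w, ((π.tensor ρ).tensor σ).perm.u x w ∘L
      HTensor.map (HTensor.map (π.perm.u x y) (ρ.perm.u y z)) 1 =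
      HTensor.map (HTensor.map (π.perm.u x y) (ρ.perm.u y z)) (σ.perm.u z w) := by
    intro x y z w
    have h1 : (π.tensor ρ).perm.u x z ∘L HTensor.map (π.perm.u x y) (1 : K →L[ℂ] K) =
      HTensor.map (π.perm.u x y) (ρ.perm.u y z) := π.perm.tensorU_mul_row ρ.perm x z y
    have h2 : ((π.tensor ρ).tensor σ).perm.u x w ∘L
      HTensor.map ((π.tensor ρ).perm.u x z) (1 : L →L[ℂ] L) =
      HTensor.map ((π.tensor ρ).perm.u x z) (σ.perm.u z w) :=
      (π.tensor ρ).perm.tensorU_mul_row σ.perm x w z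
    have h3 : HTensor.map (HTensor.map (π.perm.u x y) (ρ.perm.u y z)) (1 : L →L[ℂ] L) =
        HTensor.map ((π.tensor ρ).perm.u x z) (1 : L →L[ℂ] L) ∘L
          HTensor.map (HTensor.map (π.perm.u x y) (1 : K →L[ℂ] K)) (1 : L →L[ℂ] L) := by
      rw [← HTensor.map_comp, h1]; rfl
    rw [h3, ← ContinuousLinearMap.comp_assoc, h2, ← HTensor.map_comp, h1]; rfl
  have hF : ∀ x y z w, (π.tensor (ρ.tensor σ)).perm.u x w ∘L
      HTensor.map (π.perm.u x y) (HTensor.map (ρ.perm.u y z) 1) =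
      HTensor.map (π.perm.u x y) (HTensor.map (ρ.perm.u y z) (σ.perm.u z w)) := by
    intro x y z w
    have h1 : (ρ.tensor σ).perm.u y w ∘L HTensor.map (ρ.perm.u y z) (1 : L →L[ℂ] L) =
      HTensor.map (ρ.perm.u y z) (σ.perm.u z w) := ρ.perm.tensorU_mul_row σ.perm y w z
    have h2 : (π.tensor (ρ.tensor σ)).perm.u x w ∘L
      HTensor.map (π.perm.u x y) (1 : HTensor K L →L[ℂ] HTensor K L) =
      HTensor.map (π.perm.u x y) ((ρ.tensor σ).perm.u y w) :=
      π.perm.tensorU_mul_row (ρ.tensor σ).perm x w y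
    have h3 : HTensor.map (π.perm.u x y) (HTensor.map (ρ.perm.u y z) (1 : L →L[ℂ] L)) =
        HTensor.map (π.perm.u x y) 1 ∘L
          HTensor.map (1 : H →L[ℂ] H) (HTensor.map (ρ.perm.u y z) (1 : L →L[ℂ] L)) := by
      rw [← HTensor.map_comp]; rfl
    rw [h3, ← ContinuousLinearMap.comp_assoc, h2, ← HTensor.map_comp, h1]; rfl
  refine intertwines_of_ext (fun x => ?_) (fun x w => ?_)
  · rw [tensor_ext, tensor_ext]
    intro f
    refine assoc_pou π ρ L x fun y z => ?_
    have h1 : (((π.ext x).mul (ρ.ext y)).mul (σ.ext z)).Intertwines ((π.tensor ρ).tensorRep σ x)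
        (HTensor.map (HTensor.map (π.perm.u x y) (ρ.perm.u y z)) 1) := by
      have h2 := (π.tensor ρ).tensorRep_intertwines σ x z (NormalRep.Intertwines.one _)
      rw [tensor_ext] at h2
      have h3 := h2.comp ((π.tensorRep_intertwines ρ x y (NormalRep.Intertwines.one _)).map
        (NormalRep.Intertwines.one (σ.ext z)))
      have h4 : (π.tensor ρ).perm.u x z ∘L HTensor.map (π.perm.u x y) (1 : K →L[ℂ] K) =
        HTensor.map (π.perm.u x y) (ρ.perm.u y z) := π.perm.tensorU_mul_row ρ.perm x z y
      rw [← HTensor.map_comp, h4] at h3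
      exact h3
    have h2 : ((π.ext x).mul ((ρ.ext y).mul (σ.ext z))).Intertwines (π.tensorRep (ρ.tensor σ) x)
        (HTensor.map (π.perm.u x y) (HTensor.map (ρ.perm.u y z) 1)) := by
      have h2 := π.tensorRep_intertwines (ρ.tensor σ) x y (NormalRep.Intertwines.one _)
      rw [tensor_ext] at h2
      have h3 := h2.comp ((NormalRep.Intertwines.one (π.ext x)).map
        (ρ.tensorRep_intertwines σ y z (NormalRep.Intertwines.one _)))
      rw [← HTensor.map_comp] at h3
      exact h3
    have h3 := h2.comp (NormalRep.assoc_intertwines (π.ext x) (ρ.ext y) (σ.ext z))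
    rw [ContinuousLinearMap.comp_assoc, ← h1 f, ← ContinuousLinearMap.comp_assoc, hα, h3 f,
      ContinuousLinearMap.comp_assoc, hα]
  · refine assoc_pou π ρ L x fun y z => ?_
    rw [ContinuousLinearMap.comp_assoc, hE, hα, ContinuousLinearMap.comp_assoc, hα,
      ← ContinuousLinearMap.comp_assoc, hF]

end WreathCorep

end WreathTensor

section Conjugate

open scoped ComplexConjugate

/-- The conjugate Hilbert space of `H`: a copy of the additive group `H`, whose elements are written
`toConj ξ`, with `c • toConj ξ = toConj (conj c • ξ)` and `⟪toConj ξ, toConj η⟫ = ⟪η, ξ⟫`. -/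
def ConjSpace (H : Type*) : Type _ := H

variable {H : Type*} [NormedAddCommGroup H] [InnerProductSpace ℂ H]

namespace ConjSpace

instance : NormedAddCommGroup (ConjSpace H) := inferInstanceAs (NormedAddCommGroup H)

instance : Module ℂ (ConjSpace H) := Module.compHom H (starRingEnd ℂ)

/-- The vector `ξ̄` of the conjugate space, additively. -/
def mk : H ≃+ ConjSpace H := AddEquiv.refl H

theorem smul_mk (c : ℂ) (ξ : H) : c • mk ξ = mk (conj c • ξ) := rfl

instance : NormedSpace ℂ (ConjSpace H) where
  norm_smul_le c ξ := by
    change ‖conj c • mk.symm ξ‖ ≤ ‖c‖ * ‖mk.symm ξ‖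
    rw [norm_smul, RCLike.norm_conj]

instance : InnerProductSpace ℂ (ConjSpace H) where
  inner ξ η := inner ℂ (mk.symm η) (mk.symm ξ)
  norm_sq_eq_re_inner ξ := norm_sq_eq_re_inner (𝕜 := ℂ) (E := H) ξ
  conj_inner_symm ξ η := inner_conj_symm (𝕜 := ℂ) (E := H) η ξ
  add_left ξ η ζ := inner_add_right (𝕜 := ℂ) (E := H) ζ ξ η
  smul_left ξ η c := inner_smul_right (𝕜 := ℂ) (E := H) η ξ (conj c)

/-- The antiunitary `ξ ↦ ξ̄` from a Hilbert space to its conjugate. -/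
def toConj (H : Type*) [NormedAddCommGroup H] [InnerProductSpace ℂ H] :
    H ≃ₗᵢ⋆[ℂ] ConjSpace H where
  toFun := mk
  invFun := mk.symm
  map_add' _ _ := rfl
  map_smul' c ξ := by
    change mk (c • ξ) = mk (conj (conj c) • ξ)
    rw [Complex.conj_conj]
  left_inv _ := rfl
  right_inv _ := rfl
  norm_map' _ := rfl

theorem inner_toConj (ξ η : H) : inner ℂ (toConj H ξ) (toConj H η) = inner ℂ η ξ := rfl

theorem smul_toConj (c : ℂ) (ξ : H) : c • toConj H ξ = toConj H (conj c • ξ) := rfl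

instance [FiniteDimensional ℂ H] : FiniteDimensional ℂ (ConjSpace H) :=
  Module.Finite.of_surjective (toConj H).toLinearEquiv.toLinearMap (toConj H).surjective

instance [CompleteSpace H] : CompleteSpace (ConjSpace H) := inferInstanceAs (CompleteSpace H)

/-- The operator `ξ̄ ↦ conj (T ξ)` on the conjugate space. -/
def bar (T : H →L[ℂ] H) : ConjSpace H →L[ℂ] ConjSpace H :=
  ((toConj H).toContinuousLinearEquiv : H →L⋆[ℂ] ConjSpace H) ∘SL T ∘SL
    ((toConj H).symm.toContinuousLinearEquiv : ConjSpace H →L⋆[ℂ] H)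

theorem bar_toConj (T : H →L[ℂ] H) (ξ : H) : bar T (toConj H ξ) = toConj H (T ξ) := rfl

theorem bar_zero : bar (0 : H →L[ℂ] H) = 0 := rfl

theorem bar_one : bar (1 : H →L[ℂ] H) = 1 := rfl

theorem bar_mul (S T : H →L[ℂ] H) : bar (S * T) = bar S * bar T := rfl

theorem bar_add (S T : H →L[ℂ] H) : bar (S + T) = bar S + bar T := rfl

theorem bar_smul (c : ℂ) (T : H →L[ℂ] H) : bar (c • T) = conj c • bar T := by
  ext ξ
  change mk (c • T (mk.symm ξ)) = mk (conj (conj c) • T (mk.symm ξ))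
  rw [Complex.conj_conj]

theorem star_bar [CompleteSpace H] (T : H →L[ℂ] H) : star (bar T) = bar (star T) := by
  refine ((ContinuousLinearMap.eq_adjoint_iff (bar (star T)) (bar T)).mpr fun ξ η => ?_).symm
  change inner ℂ (mk.symm η) ((star T) (mk.symm ξ)) = inner ℂ (T (mk.symm η)) (mk.symm ξ)
  exact ContinuousLinearMap.adjoint_inner_right T _ _

theorem bar_sum {ι : Type*} (s : Finset ι) (T : ι → H →L[ℂ] H) :
    bar (∑ i ∈ s, T i) = ∑ i ∈ s, bar (T i) :=
  map_sum (⟨⟨bar, bar_zero⟩, bar_add⟩ : (H →L[ℂ] H) →+ (ConjSpace H →L[ℂ] ConjSpace H)) T s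

theorem isStarProjection_bar [CompleteSpace H] {P : H →L[ℂ] H} (hP : IsStarProjection P) :
    IsStarProjection (bar P) :=
  ⟨by
    change bar P * bar P = bar P
    rw [← bar_mul, hP.isIdempotentElem.eq],
    by
    change star (bar P) = bar P
    rw [star_bar, hP.isSelfAdjoint.star_eq]⟩

theorem pou_bar {ι : Type*} {P : ι → H →L[ℂ] H} (hP : IsPOU P) : IsPOU fun i => bar (P i) := by
  refine ⟨fun i j hij => ?_, ?_⟩
  · rw [← bar_mul, hP.1 i j hij, bar_zero]
  · obtain ⟨s, hs, hsum⟩ := hP.2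
    refine ⟨s, fun i hi => by simp only [hs i hi, bar_zero], ?_⟩
    rw [← bar_sum, hsum, bar_one]

end ConjSpace

end Conjugate

section Contragredient

open scoped Matrix.Norms.L2Operator

universe u v

variable {G : DiscreteQuantumGroup.{u}} {X : Type v} {H : Type*} [NormedAddCommGroup H]
  [InnerProductSpace ℂ H] [FiniteDimensional ℂ H] [CompleteSpace H]

theorem DiscreteQuantumGroup.IsUnitaryAntipode.dependsOn {R : G.Fun →ₗ[ℂ] G.Fun}
    (hR : G.IsUnitaryAntipode R) (k : G.Irr) :
    ∃ s : Finset G.Irr, DependsOn (fun f => R f k) (s : Set G.Irr) := by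
  obtain ⟨F, hF, hS⟩ := hR.polar
  obtain ⟨s, hs⟩ := G.antipode_dependsOn k
  have hF1 : F * F⁻¹ = 1 := funext fun i =>
    Matrix.mul_nonsing_inv _ ((hF i).det_pos.ne'.isUnit)
  have h : ∀ f, R f = G.antipode (F⁻¹ * f * F) := fun f => by
    rw [hS]
    congr 1
    rw [mul_assoc, mul_assoc, mul_assoc, hF1, mul_one, ← mul_assoc, hF1, one_mul]
  refine ⟨s, fun f g hfg => ?_⟩
  change R f k = R g k
  rw [h, h]
  refine hs fun i hi => ?_
  change F⁻¹ i * f i * F i = F⁻¹ i * g i * F i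
  rw [hfg i hi]

namespace NormalRep

/-- The conjugate representation `f ↦ conj (φ (R (f*)))`. -/
def conj (φ : NormalRep G H) {R : G.Fun →ₗ[ℂ] G.Fun} (hR : G.IsUnitaryAntipode R) :
    NormalRep G (ConjSpace H) where
  hom :=
    { toFun f := ConjSpace.bar (φ.hom (R (star f)))
      map_one' := by rw [star_one, hR.map_one, _root_.map_one, ConjSpace.bar_one]
      map_mul' f g := by rw [star_mul, hR.map_mul, _root_.map_mul, ConjSpace.bar_mul]
      map_zero' := by rw [star_zero, _root_.map_zero, _root_.map_zero, ConjSpace.bar_zero]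
      map_add' f g := by rw [star_add, map_add, map_add, ConjSpace.bar_add]
      commutes' c := by
        rw [Algebra.algebraMap_eq_smul_one, star_smul, star_one, map_smul, hR.map_one, map_smul,
          _root_.map_one, ConjSpace.bar_smul, ConjSpace.bar_one, Algebra.algebraMap_eq_smul_one]
        congr 1
        exact star_star c
      map_star' f := by
        rw [hR.map_star, map_star, ConjSpace.star_bar] }
  dep := by
    classical
    obtain ⟨s, hs⟩ := φ.dep
    choose t ht using hR.dependsOn
    refine ⟨s.biUnion t, fun f g hfg => ?_⟩
    change ConjSpace.bar (φ.hom (R (star f))) = ConjSpace.bar (φ.hom (R (star g)))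
    congr 1
    refine hs fun k hk => ht k fun i hi => ?_
    change star (f i) = star (g i)
    rw [hfg i (Finset.mem_coe.mpr (Finset.mem_biUnion.mpr ⟨k, hk, hi⟩))]

theorem conj_hom (φ : NormalRep G H) {R : G.Fun →ₗ[ℂ] G.Fun} (hR : G.IsUnitaryAntipode R)
    (f : G.Fun) : (φ.conj hR).hom f = ConjSpace.bar (φ.hom (R (star f))) := rfl

end NormalRep

/-- The conjugate `ū_{xy} = conj (u_{yx})` of a quantum permutation. -/
def QuantumPermutation.conj (q : QuantumPermutation X H) : QuantumPermutation X (ConjSpace H) :=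
  ofPOU (fun x y => ConjSpace.bar (q.u y x))
    (fun x y => ConjSpace.isStarProjection_bar (q.isProj y x))
    (fun x => ConjSpace.pou_bar (q.col_pou x)) (fun y => ConjSpace.pou_bar (q.row_pou y))

namespace WreathCorep

theorem conj_comm (π : WreathCorep G X H) {R : G.Fun →ₗ[ℂ] G.Fun} (hR : G.IsUnitaryAntipode R)
    (x y : X) (f : G.Fun) : ((π.ext y).conj hR).hom f * ConjSpace.bar (π.perm.u y x) =
      ConjSpace.bar (π.perm.u y x) * ((π.ext y).conj hR).hom f := by
  rw [NormalRep.conj_hom, ← ConjSpace.bar_mul, π.ext_comm, ConjSpace.bar_mul]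

/-- The representation `f ↦ ∑ y, conj (π^G_y(R(f*)) π^X_{yx})`. -/
def contragredientRep (π : WreathCorep G X H) {R : G.Fun →ₗ[ℂ] G.Fun} (hR : G.IsUnitaryAntipode R)
    (x : X) : NormalRep G (ConjSpace H) :=
  NormalRep.glueProj (fun y => (π.ext y).conj hR) (fun y => ConjSpace.bar (π.perm.u y x))
    (ConjSpace.pou_bar (π.perm.col_pou x))
    (fun y => ConjSpace.isStarProjection_bar (π.perm.isProj y x)) (π.conj_comm hR x)

theorem contragredient_comm (π : WreathCorep G X H) {R : G.Fun →ₗ[ℂ] G.Fun}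
    (hR : G.IsUnitaryAntipode R) (x y : X) (f : G.Fun) :
    (π.contragredientRep hR x).hom f * ConjSpace.bar (π.perm.u y x) =
      ConjSpace.bar (π.perm.u y x) * (π.contragredientRep hR x).hom f := by
  have h1 := NormalRep.glueProj_mul (fun y => (π.ext y).conj hR)
    (fun y => ConjSpace.bar (π.perm.u y x)) (ConjSpace.pou_bar (π.perm.col_pou x))
    (fun y => ConjSpace.isStarProjection_bar (π.perm.isProj y x)) (π.conj_comm hR x) f y
  have h2 := NormalRep.mul_glueProj (fun y => (π.ext y).conj hR)
    (fun y => ConjSpace.bar (π.perm.u y x)) (ConjSpace.pou_bar (π.perm.col_pou x))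
    (fun y => ConjSpace.isStarProjection_bar (π.perm.isProj y x)) (π.conj_comm hR x) f y
  exact h1.trans h2.symm

/-- The contragredient of a finite dimensional `X`-free wreath corepresentation `π` of `G`, with
respect to the unitary antipode `R` of `G`. -/
def contragredient (π : WreathCorep G X H) {R : G.Fun →ₗ[ℂ] G.Fun} (hR : G.IsUnitaryAntipode R) :
    WreathCorep G X (ConjSpace H) :=
  ofNormal (π.contragredientRep hR) π.perm.conj (fun x y f => π.contragredient_comm hR x y f)

/-- `π̄^G_x(f)ξ̄ = ∑ y, conj (π^G_y(R(f*)) π^X_{yx} ξ)`. -/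
theorem contragredient_rep (π : WreathCorep G X H) {R : G.Fun →ₗ[ℂ] G.Fun}
    (hR : G.IsUnitaryAntipode R) (x : X) (f : G.C0) (ξ : H) :
    (π.contragredient hR).rep x f (ConjSpace.toConj H ξ) = ∑ᶠ y, ConjSpace.toConj H
      ((π.ext y).hom (R (star (c0ToFun G.dim f))) (π.perm.u y x ξ)) := by
  obtain ⟨s, hs, -⟩ := (π.perm.col_pou x).2
  have hs' : ∀ y, y ∉ s → π.perm.u y x = 0 := hs
  have h1 : (π.contragredient hR).rep x f = ∑ᶠ y, ConjSpace.bar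
      ((π.ext y).hom (R (star (c0ToFun G.dim f)))) * ConjSpace.bar (π.perm.u y x) := rfl
  rw [h1, finsum_eq_sum_of_support_subset (s := s) _ (fun y hy => by
    by_contra h
    refine hy ?_
    dsimp only
    rw [hs' y h, ConjSpace.bar_zero, mul_zero]), ContinuousLinearMap.sum_apply,
    finsum_eq_sum_of_support_subset (s := s) _ (fun y hy => by
    by_contra h
    refine hy ?_
    dsimp only
    rw [hs' y h, ContinuousLinearMap.zero_apply, map_zero, map_zero])]
  rfl

/-- `π̄^X_{xy}ξ̄ = conj (π^X_{yx} ξ)`. -/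
theorem contragredient_perm (π : WreathCorep G X H) {R : G.Fun →ₗ[ℂ] G.Fun}
    (hR : G.IsUnitaryAntipode R) (x y : X) (ξ : H) :
    (π.contragredient hR).perm.u x y (ConjSpace.toConj H ξ) =
      ConjSpace.toConj H (π.perm.u y x ξ) := rfl

end WreathCorep

end Contragredient

section FreeWreathCategory

open CategoryTheory
open scoped Matrix.Norms.L2Operator

universe u v

/-- A finite dimensional `X`-free wreath corepresentation of `G`: an object of the category
`Corep(G) ≀_* Sym⁺(X)`. -/
structure FreeWreath (G : DiscreteQuantumGroup.{u}) (X : Type v) where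
  space : Type
  [normed : NormedAddCommGroup space]
  [inner : InnerProductSpace ℂ space]
  [finite : FiniteDimensional ℂ space]
  [complete : CompleteSpace space]
  corep : WreathCorep G X space

namespace FreeWreath

attribute [instance] normed inner finite complete

variable {G : DiscreteQuantumGroup.{u}} {X : Type v}

/-- An intertwiner of `X`-free wreath corepresentations. -/
@[ext]
structure Hom (π ρ : FreeWreath G X) where
  op : π.space →L[ℂ] ρ.space
  intertwines : π.corep.Intertwines ρ.corep op

instance : Category (FreeWreath G X) where
  Hom := Hom
  id π := ⟨.id ℂ _, .id _⟩
  comp f g := ⟨g.op ∘L f.op, g.intertwines.comp f.intertwines⟩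

/-- The operator underlying a morphism. -/
def op {π ρ : FreeWreath G X} (f : π ⟶ ρ) : π.space →L[ℂ] ρ.space := Hom.op f

theorem op_intertwines {π ρ : FreeWreath G X} (f : π ⟶ ρ) :
    π.corep.Intertwines ρ.corep (op f) := Hom.intertwines f

theorem hom_ext {π ρ : FreeWreath G X} {f g : π ⟶ ρ} (h : op f = op g) : f = g := Hom.ext h

theorem op_comp {π ρ σ : FreeWreath G X} (f : π ⟶ ρ) (g : ρ ⟶ σ) :
    op (f ≫ g) = op g ∘L op f := rfl

theorem op_id (π : FreeWreath G X) : op (𝟙 π) = .id ℂ π.space := rfl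

/-- The isomorphism given by a unitary intertwiner. -/
def isoOfUnitary {π ρ : FreeWreath G X} (e : π.space ≃ₗᵢ[ℂ] ρ.space)
    (h : π.corep.Intertwines ρ.corep (e : π.space →L[ℂ] ρ.space)) : π ≅ ρ where
  hom := ⟨e, h⟩
  inv := ⟨e.symm, h.symm⟩
  hom_inv_id := hom_ext (by ext ξ; exact e.symm_apply_apply ξ)
  inv_hom_id := hom_ext (by ext ξ; exact e.apply_symm_apply ξ)

instance : MonoidalCategoryStruct (FreeWreath G X) where
  tensorObj π ρ := ⟨HTensor π.space ρ.space, π.corep.tensor ρ.corep⟩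
  tensorHom f g := ⟨HTensor.map (op f) (op g), (op_intertwines f).map (op_intertwines g)⟩
  whiskerLeft π _ _ g := ⟨HTensor.map (.id ℂ π.space) (op g),
    (WreathCorep.Intertwines.id π.corep).map (op_intertwines g)⟩
  whiskerRight f ρ := ⟨HTensor.map (op f) (.id ℂ ρ.space),
    (op_intertwines f).map (WreathCorep.Intertwines.id ρ.corep)⟩
  tensorUnit := ⟨ℂ, WreathCorep.unit G X⟩
  associator π ρ σ := isoOfUnitary (HTensor.assoc π.space ρ.space σ.space)
    (WreathCorep.assoc_intertwines π.corep ρ.corep σ.corep)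
  leftUnitor π := isoOfUnitary (HTensor.lid π.space) (WreathCorep.lid_intertwines π.corep)
  rightUnitor π := isoOfUnitary (HTensor.rid π.space) (WreathCorep.rid_intertwines π.corep)

instance : MonoidalCategory (FreeWreath G X) :=
  MonoidalCategory.ofTensorHom
    (id_tensorHom_id := fun _ _ => hom_ext HTensor.map_id)
    (id_tensorHom := fun _ _ _ _ => rfl)
    (tensorHom_id := fun _ _ => rfl)
    (tensorHom_comp_tensorHom := fun _ _ _ _ => hom_ext (HTensor.map_comp _ _ _ _).symm)
    (associator_naturality := fun _ _ _ => hom_ext (HTensor.ext₃ fun _ _ _ => rfl))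
    (leftUnitor_naturality := fun f => hom_ext (HTensor.lid_naturality (op f)))
    (rightUnitor_naturality := fun f => hom_ext (HTensor.rid_naturality (op f)))
    (pentagon := fun _ _ _ _ => hom_ext (HTensor.ext₄ fun _ _ _ _ => rfl))
    (triangle := fun _ _ => hom_ext (HTensor.ext₃ fun ξ c η => HTensor.tmul_smul' c ξ η))

/-- The contragredient, as an object of the category. -/
def contragredient (π : FreeWreath G X) {R : G.Fun →ₗ[ℂ] G.Fun} (hR : G.IsUnitaryAntipode R) :
    FreeWreath G X :=
  ⟨ConjSpace π.space, π.corep.contragredient hR⟩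

end FreeWreath

end FreeWreathCategory

end

open CategoryTheory

universe u v

/-!
Linear maps on the functions on `G` with values in an algebra are convolved along the
comultiplication, and the antipode `S` is the convolution inverse of the identity. For the unit `p`
of the block carrying the counit this says that `Δ(p)(a ⊗ 1) = Δ(p)(1 ⊗ S a)` and
`(1 ⊗ a)Δ(p) = (S a ⊗ 1)Δ(p)`.

Slicing these identities with an invariant functional `φ` shows that left invariance makes `S²` the
modular automorphism of `φ` and that right invariance makes it the inverse, so that `S⁴ = 1`. Then
`y = S² a - a` satisfies `S² y = -y`, hence `φ(y y*) = -φ(y* y)`, and both sides vanish by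
positivity. Therefore `S² = 1`, and `S` preserves the adjoint. The polar part of a unitary antipode
is then central, which makes `S` the only one.

The conjugation `J` on a finite dimensional corepresentation gives the pairing `J ξ ⊗ η ↦ ⟪ξ, η⟫`.
It is invariant because `(π ∘ S) * π` is the counit, and the coevaluation is the adjoint of the
evaluation for `J⁻¹`.
-/

open scoped TensorProduct ComplexOrder

section BlockSums

variable {I : Type*} {d : I → ℕ}

theorem blockIncl_apply_self (i : I) (a : MatBlock d i) : blockIncl d i a i = a := by
  classical
  exact Pi.single_eq_same i a

theorem blockIncl_apply_ne {i j : I} (h : j ≠ i) (a : MatBlock d i) : blockIncl d i a j = 0 := by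
  classical
  exact Pi.single_eq_of_ne h a

theorem mul_blockIncl (f : MatFun d) (i : I) (a : MatBlock d i) :
    f * blockIncl d i a = blockIncl d i (f i * a) := by
  ext1 k
  by_cases hk : k = i
  · subst hk; simp only [Pi.mul_apply, blockIncl_apply_self]
  · simp only [Pi.mul_apply, blockIncl_apply_ne hk, mul_zero]

theorem blockIncl_mul (f : MatFun d) (i : I) (a : MatBlock d i) :
    blockIncl d i a * f = blockIncl d i (a * f i) := by
  ext1 k
  by_cases hk : k = i
  · subst hk; simp only [Pi.mul_apply, blockIncl_apply_self]
  · simp only [Pi.mul_apply, blockIncl_apply_ne hk, zero_mul]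

variable {V W : Type*} [AddCommGroup V] [Module ℂ V] [AddCommGroup W] [Module ℂ W]

theorem comp_blockIncl_eq_zero {T : MatFun d →ₗ[ℂ] V} {s : Finset I}
    (hs : DependsOn T (s : Set I)) {i : I} (hi : i ∉ s) : T ∘ₗ blockIncl d i = 0 :=
  LinearMap.ext fun a => (hs fun _ hj =>
    blockIncl_apply_ne (ne_of_mem_of_not_mem hj hi) a).trans (map_zero T)

theorem eq_sum_blockIncl {T : MatFun d →ₗ[ℂ] V} {s : Finset I} (hs : DependsOn T (s : Set I))
    (f : MatFun d) : T f = ∑ i ∈ s, T (blockIncl d i (f i)) := by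
  classical
  rw [← map_sum]
  refine hs fun i hi => ?_
  rw [Finset.sum_apply, Finset.sum_eq_single_of_mem i hi, blockIncl_apply_self]
  exact fun j _ hj => blockIncl_apply_ne hj.symm _

/-- A linear map on `∏ i, M_{d i}(ℂ)` is normal if it depends on finitely many blocks only. These
are the canonical extensions of the linear maps on `⨁ i, M_{d i}(ℂ)` that vanish on all but
finitely many blocks. -/
def IsNormal (T : MatFun d →ₗ[ℂ] V) : Prop :=
  ∃ s : Finset I, DependsOn T (s : Set I)

theorem isNormal_proj (i : I) : IsNormal (LinearMap.proj i : MatFun d →ₗ[ℂ] MatBlock d i) :=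
  ⟨{i}, fun _ _ h => h i (by simp)⟩

theorem IsNormal.postcomp {T : MatFun d →ₗ[ℂ] V} (hT : IsNormal T) (g : V →ₗ[ℂ] W) :
    IsNormal (g ∘ₗ T) :=
  let ⟨s, hs⟩ := hT
  ⟨s, fun _ _ h => congrArg g (hs h)⟩

theorem IsNormal.precomp {J : Type*} {e : J → ℕ} {T : MatFun d →ₗ[ℂ] V} (hT : IsNormal T)
    {U : MatFun e →ₗ[ℂ] MatFun d} (hU : ∀ i, IsNormal (LinearMap.proj i ∘ₗ U)) :
    IsNormal (T ∘ₗ U) := by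
  classical
  obtain ⟨s, hs⟩ := hT
  choose t ht using hU
  exact ⟨s.biUnion t, fun f g h => hs fun i hi =>
    ht i fun j hj => h j (Finset.mem_biUnion.mpr ⟨i, hi, hj⟩)⟩

theorem IsNormal.sum {ι : Type*} {s : Finset ι} {T : ι → MatFun d →ₗ[ℂ] V}
    (hT : ∀ i ∈ s, IsNormal (T i)) : IsNormal (∑ i ∈ s, T i) := by
  classical
  choose! t ht using hT
  refine ⟨s.biUnion t, fun f g h => ?_⟩
  simp only [LinearMap.sum_apply]
  exact Finset.sum_congr rfl fun i hi =>
    ht i hi fun j hj => h j (Finset.mem_biUnion.mpr ⟨i, hi, hj⟩)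

end BlockSums

namespace DiscreteQuantumGroup

variable (G : DiscreteQuantumGroup.{u})

/-- The counit as a map into an algebra `C`: the unit for the convolution of maps into `C`. -/
noncomputable def convUnit (C : Type*) [Ring C] [Algebra ℂ C] : G.Fun →ₐ[ℂ] C :=
  (Algebra.ofId ℂ C).comp G.counit.toAlgHom

/-- The component of the comultiplication in the block `p = (i, j)` of the tensor square. -/
noncomputable def comulAt (p : G.Irr × G.Irr) : G.Fun →ₐ[ℂ] G.Block p.1 ⊗[ℂ] G.Block p.2 :=
  (Pi.evalAlgHom ℂ (fun p : G.Irr × G.Irr => G.Block p.1 ⊗[ℂ] G.Block p.2) p).comp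
    G.comul.toAlgHom

variable {G}

theorem convUnit_apply {C : Type*} [Ring C] [Algebra ℂ C] (f : G.Fun) :
    G.convUnit C f = G.counit f • 1 := Algebra.algebraMap_eq_smul_one _

theorem isNormal_convUnit (C : Type*) [Ring C] [Algebra ℂ C] :
    IsNormal (G.convUnit C).toLinearMap :=
  IsNormal.postcomp (T := G.counit.toAlgHom.toLinearMap) G.counit_dependsOn
    (Algebra.linearMap ℂ C)

theorem isNormal_comulAt (p : G.Irr × G.Irr) : IsNormal (G.comulAt p).toLinearMap :=
  G.comul_dependsOn p

theorem isNormal_proj_antipode (k : G.Irr) : IsNormal (LinearMap.proj k ∘ₗ G.antipode) :=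
  G.antipode_dependsOn k

theorem coassoc_sum {i j k : G.Irr} {s : Finset G.Irr}
    (hl : DependsOn (G.comulAt (i, j)).toLinearMap (s : Set G.Irr))
    (hr : DependsOn (G.comulAt (j, k)).toLinearMap (s : Set G.Irr)) (f : G.Fun) :
    TensorProduct.assoc ℂ (G.Block i) (G.Block j) (G.Block k)
      (∑ l ∈ s, ((G.comulAt (i, j)).toLinearMap ∘ₗ blockIncl G.dim l).rTensor (G.Block k)
        (G.comulAt (l, k) f)) =
      ∑ l ∈ s, ((G.comulAt (j, k)).toLinearMap ∘ₗ blockIncl G.dim l).lTensor (G.Block i)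
        (G.comulAt (i, l) f) := by
  rw [← finsum_eq_sum_of_support_subset _ (Function.support_subset_iff'.mpr fun l h => by
      rw [comp_blockIncl_eq_zero hl h, LinearMap.rTensor_zero, LinearMap.zero_apply]),
    ← finsum_eq_sum_of_support_subset _ (Function.support_subset_iff'.mpr fun l h => by
      rw [comp_blockIncl_eq_zero hr h, LinearMap.lTensor_zero, LinearMap.zero_apply])]
  exact G.coassoc f i j k

section Convolution

variable {C : Type*} [Ring C] [Algebra ℂ C]

/-- The product of two maps into an algebra, evaluated on a block of the tensor square. -/
noncomputable def mulOnBlock (T T' : G.Fun →ₗ[ℂ] C) (p : G.Irr × G.Irr) :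
    G.Block p.1 ⊗[ℂ] G.Block p.2 →ₗ[ℂ] C :=
  LinearMap.mul' ℂ C ∘ₗ TensorProduct.map (T ∘ₗ blockIncl G.dim p.1) (T' ∘ₗ blockIncl G.dim p.2)

/-- The convolution `T * T' = m(T ⊗ T')Δ` of two maps into an algebra. The sum over the blocks of
the tensor square is finite for normal maps, and is only meaningful for these. -/
noncomputable def conv (T T' : G.Fun →ₗ[ℂ] C) : G.Fun →ₗ[ℂ] C :=
  ∑ᶠ p : G.Irr × G.Irr, mulOnBlock T T' p ∘ₗ (G.comulAt p).toLinearMap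

theorem mulOnBlock_tmul (T T' : G.Fun →ₗ[ℂ] C) (p : G.Irr × G.Irr) (a : G.Block p.1)
    (b : G.Block p.2) :
    mulOnBlock T T' p (a ⊗ₜ b) = T (blockIncl G.dim p.1 a) * T' (blockIncl G.dim p.2 b) := rfl

variable {T T' T'' : G.Fun →ₗ[ℂ] C}

theorem conv_eq_sum {s t : Finset G.Irr} (hs : DependsOn T (s : Set G.Irr))
    (ht : DependsOn T' (t : Set G.Irr)) :
    conv T T' = ∑ p ∈ s ×ˢ t, mulOnBlock T T' p ∘ₗ (G.comulAt p).toLinearMap := by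
  refine finsum_eq_sum_of_support_subset _ (Function.support_subset_iff'.mpr fun p hp => ?_)
  have h : mulOnBlock T T' p = 0 := by
    rw [Finset.mem_coe, Finset.mem_product, not_and_or] at hp
    rcases hp with hp | hp
    · rw [mulOnBlock, comp_blockIncl_eq_zero hs hp, TensorProduct.map_zero_left,
        LinearMap.comp_zero]
    · rw [mulOnBlock, comp_blockIncl_eq_zero ht hp, TensorProduct.map_zero_right,
        LinearMap.comp_zero]
  rw [h, LinearMap.zero_comp]

theorem conv_apply {s t : Finset G.Irr} (hs : DependsOn T (s : Set G.Irr))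
    (ht : DependsOn T' (t : Set G.Irr)) (f : G.Fun) :
    conv T T' f = ∑ i ∈ s, ∑ j ∈ t, mulOnBlock T T' (i, j) (G.comulAt (i, j) f) := by
  rw [conv_eq_sum hs ht, LinearMap.sum_apply, Finset.sum_product]
  rfl

theorem isNormal_conv (hT : IsNormal T) (hT' : IsNormal T') :
    IsNormal (conv T T') := by
  obtain ⟨s, hs⟩ := hT
  obtain ⟨t, ht⟩ := hT'
  rw [conv_eq_sum hs ht]
  exact IsNormal.sum fun p _ => (isNormal_comulAt p).postcomp _

theorem map_conv_eq_map_conv {D V : Type*} [Ring D] [Algebra ℂ D] [AddCommGroup V] [Module ℂ V]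
    {U U' : G.Fun →ₗ[ℂ] D} (hT : IsNormal T) (hT' : IsNormal T') (hU : IsNormal U)
    (hU' : IsNormal U') {A : C →ₗ[ℂ] V} {B : D →ₗ[ℂ] V}
    (h : ∀ f g, A (T f * T' g) = B (U f * U' g)) (f : G.Fun) :
    A (conv T T' f) = B (conv U U' f) := by
  classical
  obtain ⟨s₁, h₁⟩ := hT
  obtain ⟨s₂, h₂⟩ := hU
  obtain ⟨t₁, h₁'⟩ := hT'
  obtain ⟨t₂, h₂'⟩ := hU'
  have hblock : ∀ p, A ∘ₗ mulOnBlock T T' p = B ∘ₗ mulOnBlock U U' p := fun p =>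
    TensorProduct.ext' fun a b => h (blockIncl G.dim p.1 a) (blockIncl G.dim p.2 b)
  rw [conv_apply (s := s₁ ∪ s₂) (t := t₁ ∪ t₂) (h₁.mono (by simp)) (h₁'.mono (by simp)),
    conv_apply (s := s₁ ∪ s₂) (t := t₁ ∪ t₂) (h₂.mono (by simp)) (h₂'.mono (by simp))]
  simp only [map_sum]
  exact Finset.sum_congr rfl fun i _ => Finset.sum_congr rfl fun j _ =>
    LinearMap.congr_fun (hblock (i, j)) _

end Convolution

end DiscreteQuantumGroup

namespace DiscreteQuantumGroup

section ConvolutionAlgebra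

variable {G : DiscreteQuantumGroup.{u}} {C : Type*} [Ring C] [Algebra ℂ C]
  {T T' T'' : G.Fun →ₗ[ℂ] C}

theorem conv_convUnit_left (hT : IsNormal T) : conv (G.convUnit C).toLinearMap T = T := by
  obtain ⟨e, he⟩ := G.counit_dependsOn
  obtain ⟨s, hs⟩ := hT
  have hblock : ∀ p : G.Irr × G.Irr, mulOnBlock (G.convUnit C).toLinearMap T p =
      T ∘ₗ blockIncl G.dim p.2 ∘ₗ (TensorProduct.lid ℂ (G.Block p.2)).toLinearMap ∘ₗ
        (G.counit.toAlgHom.toLinearMap ∘ₗ blockIncl G.dim p.1).rTensor (G.Block p.2) := fun p =>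
    TensorProduct.ext' fun a b => by
      simp only [mulOnBlock_tmul, AlgHom.toLinearMap_apply, convUnit_apply, smul_one_mul,
        LinearMap.comp_apply, LinearMap.rTensor_tmul, LinearEquiv.coe_coe,
        TensorProduct.lid_tmul, map_smul]
      rfl
  ext1 f
  have hcounit : ∀ j, ∑ i ∈ e, TensorProduct.lid ℂ (G.Block j)
      ((G.counit.toAlgHom.toLinearMap ∘ₗ blockIncl G.dim i).rTensor (G.Block j)
        (G.comulAt (i, j) f)) = f j := fun j =>
    (finsum_eq_sum_of_support_subset _ (Function.support_subset_iff'.mpr fun i hi => by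
      rw [comp_blockIncl_eq_zero (T := G.counit.toAlgHom.toLinearMap) he hi,
        LinearMap.rTensor_zero, LinearMap.zero_apply, map_zero])).symm.trans (G.counit_left f j)
  rw [conv_apply (fun _ _ h => congrArg (algebraMap ℂ C) (he h)) hs, Finset.sum_comm,
    eq_sum_blockIncl hs f]
  refine Finset.sum_congr rfl fun j _ => ?_
  simp only [hblock, LinearMap.comp_apply]
  rw [← map_sum, ← map_sum]
  exact congrArg (fun a => T (blockIncl G.dim j a)) (hcounit j)

theorem conv_convUnit_right (hT : IsNormal T) : conv T (G.convUnit C).toLinearMap = T := by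
  obtain ⟨e, he⟩ := G.counit_dependsOn
  obtain ⟨s, hs⟩ := hT
  have hblock : ∀ p : G.Irr × G.Irr, mulOnBlock T (G.convUnit C).toLinearMap p =
      T ∘ₗ blockIncl G.dim p.1 ∘ₗ (TensorProduct.rid ℂ (G.Block p.1)).toLinearMap ∘ₗ
        (G.counit.toAlgHom.toLinearMap ∘ₗ blockIncl G.dim p.2).lTensor (G.Block p.1) := fun p =>
    TensorProduct.ext' fun a b => by
      simp only [mulOnBlock_tmul, AlgHom.toLinearMap_apply, convUnit_apply, mul_smul_one,
        LinearMap.comp_apply, LinearMap.lTensor_tmul, LinearEquiv.coe_coe,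
        TensorProduct.rid_tmul, map_smul]
      rfl
  ext1 f
  have hcounit : ∀ i, ∑ j ∈ e, TensorProduct.rid ℂ (G.Block i)
      ((G.counit.toAlgHom.toLinearMap ∘ₗ blockIncl G.dim j).lTensor (G.Block i)
        (G.comulAt (i, j) f)) = f i := fun i =>
    (finsum_eq_sum_of_support_subset _ (Function.support_subset_iff'.mpr fun j hj => by
      rw [comp_blockIncl_eq_zero (T := G.counit.toAlgHom.toLinearMap) he hj,
        LinearMap.lTensor_zero, LinearMap.zero_apply, map_zero])).symm.trans (G.counit_right f i)
  rw [conv_apply hs (fun _ _ h => congrArg (algebraMap ℂ C) (he h)), eq_sum_blockIncl hs f]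
  refine Finset.sum_congr rfl fun i _ => ?_
  simp only [hblock, LinearMap.comp_apply]
  rw [← map_sum, ← map_sum]
  exact congrArg (fun a => T (blockIncl G.dim i a)) (hcounit i)

theorem mulOnBlock_conv_left {s t : Finset G.Irr} (hs : DependsOn T (s : Set G.Irr))
    (ht : DependsOn T' (t : Set G.Irr)) (l k : G.Irr) :
    mulOnBlock (conv T T') T'' (l, k) = ∑ i ∈ s, ∑ j ∈ t,
      (LinearMap.mul' ℂ C ∘ₗ
        TensorProduct.map (mulOnBlock T T' (i, j)) (T'' ∘ₗ blockIncl G.dim k)) ∘ₗ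
      ((G.comulAt (i, j)).toLinearMap ∘ₗ blockIncl G.dim l).rTensor (G.Block k) :=
  TensorProduct.ext' fun a b => by
    change conv T T' (blockIncl G.dim l a) * T'' (blockIncl G.dim k b) = _
    simp only [conv_apply hs ht, Finset.sum_mul, LinearMap.sum_apply]
    rfl

theorem mulOnBlock_conv_right {t r : Finset G.Irr} (ht : DependsOn T' (t : Set G.Irr))
    (hr : DependsOn T'' (r : Set G.Irr)) (i l : G.Irr) :
    mulOnBlock T (conv T' T'') (i, l) = ∑ j ∈ t, ∑ k ∈ r,
      (LinearMap.mul' ℂ C ∘ₗ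
        TensorProduct.map (T ∘ₗ blockIncl G.dim i) (mulOnBlock T' T'' (j, k))) ∘ₗ
      ((G.comulAt (j, k)).toLinearMap ∘ₗ blockIncl G.dim l).lTensor (G.Block i) :=
  TensorProduct.ext' fun a b => by
    change T (blockIncl G.dim i a) * conv T' T'' (blockIncl G.dim l b) = _
    simp only [conv_apply ht hr, Finset.mul_sum, LinearMap.sum_apply]
    rfl

theorem mul'_map_mulOnBlock_assoc (T T' T'' : G.Fun →ₗ[ℂ] C) (i j k : G.Irr) :
    LinearMap.mul' ℂ C ∘ₗ
        TensorProduct.map (mulOnBlock T T' (i, j)) (T'' ∘ₗ blockIncl G.dim k) =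
      (LinearMap.mul' ℂ C ∘ₗ
        TensorProduct.map (T ∘ₗ blockIncl G.dim i) (mulOnBlock T' T'' (j, k))) ∘ₗ
      (TensorProduct.assoc ℂ (G.Block i) (G.Block j) (G.Block k)).toLinearMap :=
  TensorProduct.ext_threefold fun _ _ _ => mul_assoc _ _ _

theorem conv_conv_left_apply {s t r q : Finset G.Irr} (hs : DependsOn T (s : Set G.Irr))
    (ht : DependsOn T' (t : Set G.Irr)) (hr : DependsOn T'' (r : Set G.Irr))
    (hq : DependsOn (conv T T') (q : Set G.Irr)) (f : G.Fun) :
    conv (conv T T') T'' f = ∑ i ∈ s, ∑ j ∈ t, ∑ k ∈ r,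
      (LinearMap.mul' ℂ C ∘ₗ
          TensorProduct.map (mulOnBlock T T' (i, j)) (T'' ∘ₗ blockIncl G.dim k))
        (∑ l ∈ q, ((G.comulAt (i, j)).toLinearMap ∘ₗ blockIncl G.dim l).rTensor (G.Block k)
          (G.comulAt (l, k) f)) := by
  rw [conv_apply hq hr]
  simp only [mulOnBlock_conv_left hs ht, LinearMap.sum_apply, map_sum]
  simp only [Finset.sum_comm (s := r)]
  simp only [Finset.sum_comm (s := q)]
  rfl

theorem conv_conv_right_apply {s t r q : Finset G.Irr} (hs : DependsOn T (s : Set G.Irr))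
    (ht : DependsOn T' (t : Set G.Irr)) (hr : DependsOn T'' (r : Set G.Irr))
    (hq : DependsOn (conv T' T'') (q : Set G.Irr)) (f : G.Fun) :
    conv T (conv T' T'') f = ∑ i ∈ s, ∑ j ∈ t, ∑ k ∈ r,
      (LinearMap.mul' ℂ C ∘ₗ
          TensorProduct.map (T ∘ₗ blockIncl G.dim i) (mulOnBlock T' T'' (j, k)))
        (∑ l ∈ q, ((G.comulAt (j, k)).toLinearMap ∘ₗ blockIncl G.dim l).lTensor (G.Block i)
          (G.comulAt (i, l) f)) := by
  rw [conv_apply hs hq]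
  simp only [mulOnBlock_conv_right ht hr, LinearMap.sum_apply, map_sum]
  simp only [Finset.sum_comm (s := q)]
  rfl

theorem conv_assoc (hT : IsNormal T) (hT' : IsNormal T') (hT'' : IsNormal T'') :
    conv (conv T T') T'' = conv T (conv T' T'') := by
  classical
  obtain ⟨q₁, h₁⟩ := isNormal_conv hT hT'
  obtain ⟨q₂, h₂⟩ := isNormal_conv hT' hT''
  obtain ⟨s, hs⟩ := hT
  obtain ⟨t, ht⟩ := hT'
  obtain ⟨r, hr⟩ := hT''
  choose w hw using isNormal_comulAt (G := G)
  let q := q₁ ∪ q₂ ∪ (s ×ˢ t ∪ t ×ˢ r).biUnion w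
  have hq : ∀ p ∈ s ×ˢ t ∪ t ×ˢ r, DependsOn (G.comulAt p).toLinearMap (q : Set G.Irr) :=
    fun p hp => (hw p).mono (Finset.coe_subset.mpr
      ((Finset.subset_biUnion_of_mem w hp).trans Finset.subset_union_right))
  have hq₁ : q₁ ⊆ q := Finset.subset_union_left.trans Finset.subset_union_left
  have hq₂ : q₂ ⊆ q := Finset.subset_union_right.trans Finset.subset_union_left
  ext1 f
  rw [conv_conv_left_apply hs ht hr (h₁.mono (Finset.coe_subset.mpr hq₁)),
    conv_conv_right_apply hs ht hr (h₂.mono (Finset.coe_subset.mpr hq₂))]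
  refine Finset.sum_congr rfl fun i hi => Finset.sum_congr rfl fun j hj =>
    Finset.sum_congr rfl fun k hk => ?_
  rw [mul'_map_mulOnBlock_assoc, LinearMap.comp_apply, ← coassoc_sum
    (hq _ (Finset.mem_union_left _ (Finset.mk_mem_product hi hj)))
    (hq _ (Finset.mem_union_right _ (Finset.mk_mem_product hj hk)))]
  rfl

end ConvolutionAlgebra

end DiscreteQuantumGroup

namespace DiscreteQuantumGroup

section ConvolutionInverse

variable {G : DiscreteQuantumGroup.{u}} {C : Type*} [Ring C] [Algebra ℂ C]

theorem isNormal_comp_antipode {V : Type*} [AddCommGroup V] [Module ℂ V] {T : G.Fun →ₗ[ℂ] V}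
    (hT : IsNormal T) : IsNormal (T ∘ₗ G.antipode) :=
  hT.precomp isNormal_proj_antipode

theorem conv_comp_antipode_left {θ : G.Fun →ₐ[ℂ] C} (hθ : IsNormal θ.toLinearMap) :
    conv (θ.toLinearMap ∘ₗ G.antipode) θ.toLinearMap = (G.convUnit C).toLinearMap := by
  classical
  obtain ⟨s₀, hs₀⟩ := isNormal_comp_antipode hθ
  obtain ⟨t, ht⟩ := hθ
  choose w hw using isNormal_proj_antipode (G := G)
  let s := s₀ ∪ t.biUnion w
  have hs : ∀ j ∈ t, DependsOn (LinearMap.proj j ∘ₗ G.antipode) (s : Set G.Irr) := fun j hj =>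
    (hw j).mono (Finset.coe_subset.mpr
      ((Finset.subset_biUnion_of_mem w hj).trans Finset.subset_union_right))
  have hblock : ∀ p : G.Irr × G.Irr, mulOnBlock (θ.toLinearMap ∘ₗ G.antipode) θ.toLinearMap p =
      θ.toLinearMap ∘ₗ blockIncl G.dim p.2 ∘ₗ LinearMap.mul' ℂ (G.Block p.2) ∘ₗ
        (LinearMap.proj p.2 ∘ₗ G.antipode ∘ₗ blockIncl G.dim p.1).rTensor (G.Block p.2) := fun p =>
    TensorProduct.ext' fun a b => (map_mul θ _ _).symm.trans (congrArg θ (mul_blockIncl _ _ _))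
  ext1 f
  have hantipode : ∀ j ∈ t, ∑ i ∈ s, LinearMap.mul' ℂ (G.Block j)
      ((LinearMap.proj j ∘ₗ G.antipode ∘ₗ blockIncl G.dim i).rTensor (G.Block j)
        (G.comulAt (i, j) f)) = G.counit f • 1 := fun j hj =>
    (finsum_eq_sum_of_support_subset _ (Function.support_subset_iff'.mpr fun i hi => by
      rw [← LinearMap.comp_assoc, comp_blockIncl_eq_zero (hs j hj) hi, LinearMap.rTensor_zero,
        LinearMap.zero_apply, map_zero])).symm.trans (G.antipode_left f j)
  rw [conv_apply (s := s) (hs₀.mono (Finset.coe_subset.mpr Finset.subset_union_left)) ht,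
    Finset.sum_comm]
  calc _ = ∑ j ∈ t, θ (blockIncl G.dim j (G.counit f • 1)) :=
        Finset.sum_congr rfl fun j hj => by
          simp only [hblock, LinearMap.comp_apply]
          rw [← map_sum, ← map_sum, hantipode j hj]
          rfl
    _ = θ (G.counit f • 1) := (eq_sum_blockIncl ht (G.counit f • 1)).symm
    _ = _ := by rw [map_smul, map_one, AlgHom.toLinearMap_apply, convUnit_apply]

theorem conv_comp_antipode_right {θ : G.Fun →ₐ[ℂ] C} (hθ : IsNormal θ.toLinearMap) :
    conv θ.toLinearMap (θ.toLinearMap ∘ₗ G.antipode) = (G.convUnit C).toLinearMap := by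
  classical
  obtain ⟨s₀, hs₀⟩ := isNormal_comp_antipode hθ
  obtain ⟨t, ht⟩ := hθ
  choose w hw using isNormal_proj_antipode (G := G)
  let s := s₀ ∪ t.biUnion w
  have hs : ∀ i ∈ t, DependsOn (LinearMap.proj i ∘ₗ G.antipode) (s : Set G.Irr) := fun i hi =>
    (hw i).mono (Finset.coe_subset.mpr
      ((Finset.subset_biUnion_of_mem w hi).trans Finset.subset_union_right))
  have hblock : ∀ p : G.Irr × G.Irr, mulOnBlock θ.toLinearMap (θ.toLinearMap ∘ₗ G.antipode) p =
      θ.toLinearMap ∘ₗ blockIncl G.dim p.1 ∘ₗ LinearMap.mul' ℂ (G.Block p.1) ∘ₗ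
        (LinearMap.proj p.1 ∘ₗ G.antipode ∘ₗ blockIncl G.dim p.2).lTensor (G.Block p.1) := fun p =>
    TensorProduct.ext' fun a b => (map_mul θ _ _).symm.trans (congrArg θ (blockIncl_mul _ _ _))
  ext1 f
  have hantipode : ∀ i ∈ t, ∑ j ∈ s, LinearMap.mul' ℂ (G.Block i)
      ((LinearMap.proj i ∘ₗ G.antipode ∘ₗ blockIncl G.dim j).lTensor (G.Block i)
        (G.comulAt (i, j) f)) = G.counit f • 1 := fun i hi =>
    (finsum_eq_sum_of_support_subset _ (Function.support_subset_iff'.mpr fun j hj => by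
      rw [← LinearMap.comp_assoc, comp_blockIncl_eq_zero (hs i hi) hj, LinearMap.lTensor_zero,
        LinearMap.zero_apply, map_zero])).symm.trans (G.antipode_right f i)
  rw [conv_apply (t := s) ht (hs₀.mono (Finset.coe_subset.mpr Finset.subset_union_left))]
  calc _ = ∑ i ∈ t, θ (blockIncl G.dim i (G.counit f • 1)) :=
        Finset.sum_congr rfl fun i hi => by
          simp only [hblock, LinearMap.comp_apply]
          rw [← map_sum, ← map_sum, hantipode i hi]
          rfl
    _ = θ (G.counit f • 1) := (eq_sum_blockIncl ht (G.counit f • 1)).symm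
    _ = _ := by rw [map_smul, map_one, AlgHom.toLinearMap_apply, convUnit_apply]

/-- The left leg `f ↦ f i ⊗ 1` of the block `p = (i, j)` of the tensor square. -/
noncomputable def leftLeg (p : G.Irr × G.Irr) : G.Fun →ₐ[ℂ] G.Block p.1 ⊗[ℂ] G.Block p.2 :=
  Algebra.TensorProduct.includeLeft.comp (Pi.evalAlgHom ℂ G.Block p.1)

/-- The right leg `f ↦ 1 ⊗ f j` of the block `p = (i, j)` of the tensor square. -/
noncomputable def rightLeg (p : G.Irr × G.Irr) : G.Fun →ₐ[ℂ] G.Block p.1 ⊗[ℂ] G.Block p.2 :=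
  Algebra.TensorProduct.includeRight.comp (Pi.evalAlgHom ℂ G.Block p.2)

theorem isNormal_leftLeg (p : G.Irr × G.Irr) : IsNormal (leftLeg p).toLinearMap :=
  (isNormal_proj p.1).postcomp Algebra.TensorProduct.includeLeft.toLinearMap

theorem isNormal_rightLeg (p : G.Irr × G.Irr) : IsNormal (rightLeg p).toLinearMap :=
  (isNormal_proj p.2).postcomp (TensorProduct.mk ℂ (G.Block p.1) (G.Block p.2) 1)

theorem conv_leftLeg_rightLeg (p : G.Irr × G.Irr) :
    conv (leftLeg p).toLinearMap (rightLeg p).toLinearMap = (G.comulAt p).toLinearMap := by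
  have hl : DependsOn (leftLeg p).toLinearMap (({p.1} : Finset G.Irr) : Set G.Irr) :=
    fun f g h => congrArg (· ⊗ₜ[ℂ] (1 : G.Block p.2)) (h p.1 (by simp))
  have hr : DependsOn (rightLeg p).toLinearMap (({p.2} : Finset G.Irr) : Set G.Irr) :=
    fun f g h => congrArg ((1 : G.Block p.1) ⊗ₜ[ℂ] ·) (h p.2 (by simp))
  have hblock : mulOnBlock (leftLeg p).toLinearMap (rightLeg p).toLinearMap p = .id :=
    TensorProduct.ext' fun a b =>
      (Algebra.TensorProduct.tmul_mul_tmul _ _ _ _).trans <|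
        congrArg₂ (· ⊗ₜ[ℂ] ·) ((mul_one _).trans (blockIncl_apply_self _ _))
          ((one_mul _).trans (blockIncl_apply_self _ _))
  rw [conv_eq_sum hl hr, Finset.singleton_product_singleton, Finset.sum_singleton, hblock,
    LinearMap.id_comp]

theorem conv_comulAt_antipode (p : G.Irr × G.Irr) :
    conv (G.comulAt p).toLinearMap ((rightLeg p).toLinearMap ∘ₗ G.antipode) =
      (leftLeg p).toLinearMap := by
  rw [← conv_leftLeg_rightLeg, conv_assoc (isNormal_leftLeg p) (isNormal_rightLeg p)
    (isNormal_comp_antipode (isNormal_rightLeg p)),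
    conv_comp_antipode_right (isNormal_rightLeg p), conv_convUnit_right (isNormal_leftLeg p)]

theorem conv_antipode_comulAt (p : G.Irr × G.Irr) :
    conv ((leftLeg p).toLinearMap ∘ₗ G.antipode) (G.comulAt p).toLinearMap =
      (rightLeg p).toLinearMap := by
  rw [← conv_leftLeg_rightLeg, ← conv_assoc (isNormal_comp_antipode (isNormal_leftLeg p))
    (isNormal_leftLeg p) (isNormal_rightLeg p), conv_comp_antipode_left (isNormal_leftLeg p),
    conv_convUnit_left (isNormal_rightLeg p)]

theorem comul_mul_tmul_one {p : G.Fun} (hp : ∀ f, p * f = G.counit f • p) (a : G.Fun)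
    (i j : G.Irr) :
    G.comul p (i, j) * (a i ⊗ₜ[ℂ] 1) = G.comul p (i, j) * (1 ⊗ₜ[ℂ] G.antipode a j) := by
  have hcomul : ∀ f, G.comulAt (i, j) p * G.comulAt (i, j) f =
      G.counit f • G.comulAt (i, j) p := fun f => by rw [← map_mul, hp, map_smul]
  have hS := isNormal_comp_antipode (isNormal_rightLeg (G := G) (i, j))
  calc G.comul p (i, j) * (a i ⊗ₜ[ℂ] 1)
      = LinearMap.mulLeft ℂ (G.comulAt (i, j) p) (leftLeg (i, j) a) := rfl
    _ = LinearMap.mulLeft ℂ (G.comulAt (i, j) p) (conv (G.comulAt (i, j)).toLinearMap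
          ((rightLeg (i, j)).toLinearMap ∘ₗ G.antipode) a) := by
        rw [conv_comulAt_antipode, AlgHom.toLinearMap_apply]
    _ = LinearMap.mulLeft ℂ (G.comulAt (i, j) p) (conv (G.convUnit _).toLinearMap
          ((rightLeg (i, j)).toLinearMap ∘ₗ G.antipode) a) :=
        map_conv_eq_map_conv (isNormal_comulAt _) hS (isNormal_convUnit _) hS (fun f g => by
          simp only [LinearMap.mulLeft_apply, AlgHom.toLinearMap_apply, convUnit_apply,
            ← mul_assoc, hcomul, mul_smul_comm, mul_one]) a
    _ = G.comul p (i, j) * (1 ⊗ₜ[ℂ] G.antipode a j) := by rw [conv_convUnit_left hS]; rfl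

theorem one_tmul_mul_comul {p : G.Fun} (hp : ∀ f, f * p = G.counit f • p) (a : G.Fun)
    (i j : G.Irr) :
    (1 ⊗ₜ[ℂ] a j) * G.comul p (i, j) = (G.antipode a i ⊗ₜ[ℂ] 1) * G.comul p (i, j) := by
  have hcomul : ∀ f, G.comulAt (i, j) f * G.comulAt (i, j) p =
      G.counit f • G.comulAt (i, j) p := fun f => by rw [← map_mul, hp, map_smul]
  have hS := isNormal_comp_antipode (isNormal_leftLeg (G := G) (i, j))
  calc (1 ⊗ₜ[ℂ] a j) * G.comul p (i, j)
      = LinearMap.mulRight ℂ (G.comulAt (i, j) p) (rightLeg (i, j) a) := rfl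
    _ = LinearMap.mulRight ℂ (G.comulAt (i, j) p) (conv
          ((leftLeg (i, j)).toLinearMap ∘ₗ G.antipode) (G.comulAt (i, j)).toLinearMap a) := by
        rw [conv_antipode_comulAt, AlgHom.toLinearMap_apply]
    _ = LinearMap.mulRight ℂ (G.comulAt (i, j) p) (conv
          ((leftLeg (i, j)).toLinearMap ∘ₗ G.antipode) (G.convUnit _).toLinearMap a) :=
        map_conv_eq_map_conv hS (isNormal_comulAt _) hS (isNormal_convUnit _) (fun f g => by
          simp only [LinearMap.mulRight_apply, AlgHom.toLinearMap_apply, convUnit_apply,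
            mul_assoc, hcomul, smul_mul_assoc, mul_smul_comm, one_mul]) a
    _ = (G.antipode a i ⊗ₜ[ℂ] 1) * G.comul p (i, j) := by rw [conv_convUnit_right hS]; rfl

end ConvolutionInverse

end DiscreteQuantumGroup

section Slices

variable {A B : Type*} [Ring A] [Algebra ℂ A] [Ring B] [Algebra ℂ B]

/-- The slice map `id ⊗ φ`. -/
noncomputable def sliceRight (A : Type*) [Ring A] [Algebra ℂ A] (φ : B →ₗ[ℂ] ℂ) :
    A ⊗[ℂ] B →ₗ[ℂ] A :=
  (TensorProduct.rid ℂ A).toLinearMap ∘ₗ φ.lTensor A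

/-- The slice map `φ ⊗ id`. -/
noncomputable def sliceLeft (B : Type*) [Ring B] [Algebra ℂ B] (φ : A →ₗ[ℂ] ℂ) :
    A ⊗[ℂ] B →ₗ[ℂ] B :=
  (TensorProduct.lid ℂ B).toLinearMap ∘ₗ φ.rTensor B

@[simp]
theorem sliceRight_tmul (φ : B →ₗ[ℂ] ℂ) (a : A) (b : B) : sliceRight A φ (a ⊗ₜ b) = φ b • a := rfl

@[simp]
theorem sliceLeft_tmul (φ : A →ₗ[ℂ] ℂ) (a : A) (b : B) : sliceLeft B φ (a ⊗ₜ b) = φ a • b := rfl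

theorem sliceRight_mul_tmul_one (φ : B →ₗ[ℂ] ℂ) (m : A ⊗[ℂ] B) (a : A) :
    sliceRight A φ (m * (a ⊗ₜ 1)) = sliceRight A φ m * a := by
  induction m using TensorProduct.induction_on with
  | zero => simp
  | add x y hx hy => simp only [add_mul, map_add, hx, hy]
  | tmul x y => simp

theorem sliceRight_tmul_one_mul (φ : B →ₗ[ℂ] ℂ) (m : A ⊗[ℂ] B) (a : A) :
    sliceRight A φ ((a ⊗ₜ 1) * m) = a * sliceRight A φ m := by
  induction m using TensorProduct.induction_on with
  | zero => simp
  | add x y hx hy => simp only [mul_add, map_add, hx, hy]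
  | tmul x y => simp

theorem sliceLeft_mul_one_tmul (φ : A →ₗ[ℂ] ℂ) (m : A ⊗[ℂ] B) (b : B) :
    sliceLeft B φ (m * (1 ⊗ₜ b)) = sliceLeft B φ m * b := by
  induction m using TensorProduct.induction_on with
  | zero => simp
  | add x y hx hy => simp only [add_mul, map_add, hx, hy]
  | tmul x y => simp

theorem sliceLeft_one_tmul_mul (φ : A →ₗ[ℂ] ℂ) (m : A ⊗[ℂ] B) (b : B) :
    sliceLeft B φ ((1 ⊗ₜ b) * m) = b * sliceLeft B φ m := by
  induction m using TensorProduct.induction_on with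
  | zero => simp
  | add x y hx hy => simp only [mul_add, map_add, hx, hy]
  | tmul x y => simp

theorem sliceRight_one_tmul_mul_comm {φ : B →ₗ[ℂ] ℂ} {b c : B} (h : ∀ y, φ (b * y) = φ (y * c))
    (m : A ⊗[ℂ] B) : sliceRight A φ ((1 ⊗ₜ b) * m) = sliceRight A φ (m * (1 ⊗ₜ c)) := by
  induction m using TensorProduct.induction_on with
  | zero => simp
  | add x y hx hy => simp only [mul_add, add_mul, map_add, hx, hy]
  | tmul x y => simp [h]

theorem sliceLeft_tmul_one_mul_comm {φ : A →ₗ[ℂ] ℂ} {a c : A} (h : ∀ y, φ (a * y) = φ (y * c))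
    (m : A ⊗[ℂ] B) : sliceLeft B φ ((a ⊗ₜ 1) * m) = sliceLeft B φ (m * (c ⊗ₜ 1)) := by
  induction m using TensorProduct.induction_on with
  | zero => simp
  | add x y hx hy => simp only [mul_add, add_mul, map_add, hx, hy]
  | tmul x y => simp [h]

theorem exists_forall_map_mul_comm [StarRing A] [FiniteDimensional ℂ A] {φ : A →ₗ[ℂ] ℂ}
    (hφ : ∀ a, φ (star a * a) = 0 → a = 0) (a : A) : ∃ c, ∀ y, φ (a * y) = φ (y * c) := by
  let T : A →ₗ[ℂ] Module.Dual ℂ A := (LinearMap.mul ℂ A).flip.compr₂ φ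
  have hT : Function.Injective T := (injective_iff_map_eq_zero T).mpr fun c hc =>
    hφ c (LinearMap.congr_fun hc (star c))
  obtain ⟨c, hc⟩ := (LinearMap.injective_iff_surjective_of_finrank_eq_finrank
    (Subspace.dual_finrank_eq (K := ℂ) (V := A)).symm).mp hT (φ ∘ₗ LinearMap.mulLeft ℂ a)
  exact ⟨c, fun y => (LinearMap.congr_fun hc y).symm⟩

end Slices

namespace DiscreteQuantumGroup

variable {G : DiscreteQuantumGroup.{u}}

section TrivialBlock

/-- `o` is the block of the trivial corepresentation: the component at `o` is the counit. -/
def IsTrivialBlock (o : G.Irr) : Prop := ∀ f : G.Fun, f o = G.counit f • 1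

variable (G) in
theorem exists_isTrivialBlock : ∃ o : G.Irr, IsTrivialBlock o := by
  have hmul : ∀ f i, G.counit (blockIncl G.dim i (f i)) =
      G.counit f * G.counit (blockIncl G.dim i 1) := fun f i => by
    rw [← map_mul, mul_blockIncl, mul_one]
  obtain ⟨s, hs⟩ := G.counit_dependsOn
  obtain ⟨o, ho⟩ : ∃ o, G.counit (blockIncl G.dim o 1) ≠ 0 := by
    by_contra! h
    have hsum : G.counit 1 = ∑ i ∈ s, G.counit (blockIncl G.dim i 1) :=
      eq_sum_blockIncl (T := G.counit.toAlgHom.toLinearMap) hs 1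
    rw [map_one, Finset.sum_eq_zero fun i _ => h i] at hsum
    exact one_ne_zero hsum
  have hone : G.counit (blockIncl G.dim o 1) = 1 := by
    have h := hmul (blockIncl G.dim o 1) o
    rw [blockIncl_apply_self] at h
    exact (mul_eq_left₀ ho).mp h.symm
  let χ : G.Block o →ₐ[ℂ] ℂ :=
    AlgHom.ofLinearMap (G.counit.toAlgHom.toLinearMap ∘ₗ blockIncl G.dim o) hone
      fun a b => map_mul (G.counit.toNonUnitalAlgHom.comp (blockHom G.dim o).toNonUnitalAlgHom) a b
  have : Nonempty (Fin (G.dim o)) := ⟨⟨0, G.dim_pos o⟩⟩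
  refine ⟨o, fun f => χ.toRingHom.injective ?_⟩
  change G.counit (blockIncl G.dim o (f o)) = χ (G.counit f • 1)
  rw [hmul, hone, mul_one, map_smul, map_one, smul_eq_mul, mul_one]

variable {o : G.Irr} (ho : IsTrivialBlock o)
include ho

theorem IsTrivialBlock.mul_eq (f : G.Fun) :
    blockIncl G.dim o 1 * f = G.counit f • blockIncl G.dim o 1 := by
  rw [blockIncl_mul, one_mul, ho f, map_smul]

theorem IsTrivialBlock.eq_mul (f : G.Fun) :
    f * blockIncl G.dim o 1 = G.counit f • blockIncl G.dim o 1 := by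
  rw [mul_blockIncl, mul_one, ho f, map_smul]

end TrivialBlock

section Haar

variable {φ : ∀ i, G.Block i →ₗ[ℂ] ℂ}

theorem star_comul_blockIncl_one (l i j : G.Irr) :
    star (G.comul (blockIncl G.dim l 1) (i, j)) = G.comul (blockIncl G.dim l 1) (i, j) := by
  have h : star (blockIncl G.dim l 1) = blockIncl G.dim l 1 := by
    rw [← blockHom_apply, ← map_star, star_one]
  exact congrFun ((map_star G.comul _).symm.trans (congrArg G.comul h)) (i, j)

theorem IsLeftHaar.map_one_ne_zero (hφ : G.IsLeftHaar φ) (i : G.Irr) : φ i 1 ≠ 0 := fun h => by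
  have : Nonempty (Fin (G.dim i)) := ⟨⟨0, G.dim_pos i⟩⟩
  exact one_ne_zero (hφ.faithful i 1 (by rwa [star_one, one_mul]))

theorem IsRightHaar.map_one_ne_zero (hφ : G.IsRightHaar φ) (i : G.Irr) : φ i 1 ≠ 0 := fun h => by
  have : Nonempty (Fin (G.dim i)) := ⟨⟨0, G.dim_pos i⟩⟩
  exact one_ne_zero (hφ.faithful i 1 (by rwa [star_one, one_mul]))

theorem IsLeftHaar.exists_sum_sliceRight (hφ : G.IsLeftHaar φ) (l i : G.Irr) :
    ∃ s : Finset G.Irr, ∑ j ∈ s, sliceRight (G.Block i) (φ j)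
      (G.comul (blockIncl G.dim l 1) (i, j)) = φ l 1 • 1 := by
  refine ⟨(G.comul_finite_right l i).toFinset, .trans ?_ (hφ.left_invariant l 1 i)⟩
  refine (finsum_eq_sum_of_support_subset _ fun j hj => ?_).symm
  rw [Set.Finite.coe_toFinset]
  exact fun h => hj (by simp only [h, map_zero])

theorem IsRightHaar.exists_sum_sliceLeft (hφ : G.IsRightHaar φ) (l j : G.Irr) :
    ∃ t : Finset G.Irr, ∑ i ∈ t, sliceLeft (G.Block j) (φ i)
      (G.comul (blockIncl G.dim l 1) (i, j)) = φ l 1 • 1 := by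
  refine ⟨(G.comul_finite_left l j).toFinset, .trans ?_ (hφ.right_invariant l 1 j)⟩
  refine (finsum_eq_sum_of_support_subset _ fun i hi => ?_).symm
  rw [Set.Finite.coe_toFinset]
  exact fun h => hi (by simp only [h, map_zero])

theorem IsLeftHaar.antipode_eq_of_modular (hφ : G.IsLeftHaar φ) {a b : G.Fun}
    (hab : ∀ j y, φ j (a j * y) = φ j (y * G.antipode b j)) : G.antipode a = b := by
  obtain ⟨o, ho⟩ := G.exists_isTrivialBlock
  funext i
  obtain ⟨s, hs⟩ := hφ.exists_sum_sliceRight o i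
  refine smul_right_injective _ (hφ.map_one_ne_zero o) ?_
  calc φ o 1 • G.antipode a i
      = ∑ j ∈ s, sliceRight (G.Block i) (φ j)
          ((1 ⊗ₜ[ℂ] a j) * G.comul (blockIncl G.dim o 1) (i, j)) := by
        simp only [one_tmul_mul_comul ho.eq_mul, sliceRight_tmul_one_mul]
        rw [← Finset.mul_sum, hs, mul_smul_comm, mul_one]
    _ = ∑ j ∈ s, sliceRight (G.Block i) (φ j)
          (G.comul (blockIncl G.dim o 1) (i, j) * (1 ⊗ₜ[ℂ] G.antipode b j)) :=
        Finset.sum_congr rfl fun j _ => sliceRight_one_tmul_mul_comm (hab j) _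
    _ = φ o 1 • b i := by
        simp only [← comul_mul_tmul_one ho.mul_eq, sliceRight_mul_tmul_one]
        rw [← Finset.sum_mul, hs, smul_mul_assoc, one_mul]

theorem IsRightHaar.antipode_eq_of_modular (hφ : G.IsRightHaar φ) {a b : G.Fun}
    (hab : ∀ i y, φ i (G.antipode a i * y) = φ i (y * b i)) : G.antipode b = a := by
  obtain ⟨o, ho⟩ := G.exists_isTrivialBlock
  funext j
  obtain ⟨t, ht⟩ := hφ.exists_sum_sliceLeft o j
  refine smul_right_injective _ (hφ.map_one_ne_zero o) ?_
  calc φ o 1 • G.antipode b j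
      = ∑ i ∈ t, sliceLeft (G.Block j) (φ i)
          (G.comul (blockIncl G.dim o 1) (i, j) * (b i ⊗ₜ[ℂ] 1)) := by
        simp only [comul_mul_tmul_one ho.mul_eq, sliceLeft_mul_one_tmul]
        rw [← Finset.sum_mul, ht, smul_mul_assoc, one_mul]
    _ = ∑ i ∈ t, sliceLeft (G.Block j) (φ i)
          ((G.antipode a i ⊗ₜ[ℂ] 1) * G.comul (blockIncl G.dim o 1) (i, j)) :=
        Finset.sum_congr rfl fun i _ => (sliceLeft_tmul_one_mul_comm (hab i) _).symm
    _ = φ o 1 • a j := by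
        simp only [← one_tmul_mul_comul ho.eq_mul, sliceLeft_one_tmul_mul]
        rw [← Finset.mul_sum, ht, mul_smul_comm, mul_one]

theorem IsRightHaar.antipode_star_antipode (hφ : G.IsRightHaar φ) (a : G.Fun) :
    G.antipode (star (G.antipode a)) = star a := by
  obtain ⟨o, ho⟩ := G.exists_isTrivialBlock
  funext j
  obtain ⟨t, ht⟩ := hφ.exists_sum_sliceLeft o j
  refine smul_right_injective _ (hφ.map_one_ne_zero o) ?_
  have hslice : ∀ b : G.Block j, φ o 1 • b = ∑ i ∈ t, sliceLeft (G.Block j) (φ i)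
      (G.comul (blockIncl G.dim o 1) (i, j) * (1 ⊗ₜ[ℂ] b)) := fun b => by
    simp only [sliceLeft_mul_one_tmul]
    rw [← Finset.sum_mul, ht, smul_mul_assoc, one_mul]
  have hstar : ∀ i, G.comul (blockIncl G.dim o 1) (i, j) * (1 ⊗ₜ[ℂ] star (a j)) =
      G.comul (blockIncl G.dim o 1) (i, j) * (star (G.antipode a i) ⊗ₜ[ℂ] 1) := fun i => by
    have h := congrArg star (one_tmul_mul_comul ho.eq_mul a i j)
    rw [star_mul, star_mul, star_comul_blockIncl_one, TensorProduct.star_tmul,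
      TensorProduct.star_tmul, star_one, star_one] at h
    exact h
  change φ o 1 • G.antipode (star (G.antipode a)) j = φ o 1 • star (a j)
  rw [hslice, hslice]
  refine Finset.sum_congr rfl fun i _ => congrArg _ ?_
  rw [hstar, ← comul_mul_tmul_one ho.mul_eq]
  rfl

theorem IsRightHaar.antipode_surjective (hφ : G.IsRightHaar φ) :
    Function.Surjective G.antipode := fun a =>
  ⟨star (G.antipode (star a)), by rw [hφ.antipode_star_antipode, star_star]⟩

theorem IsLeftHaar.map_mul_comm (hφ : G.IsLeftHaar φ) (hS : Function.Surjective G.antipode)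
    (a : G.Fun) (i : G.Irr) (y : G.Block i) :
    φ i (a i * y) = φ i (y * G.antipode (G.antipode a) i) := by
  choose c hc using fun j => exists_forall_map_mul_comm (hφ.faithful j) (a j)
  obtain ⟨b, rfl⟩ := hS c
  rw [hφ.antipode_eq_of_modular hc, hc]

theorem IsUnimodular.antipode_iterate_four (hG : G.IsUnimodular) (a : G.Fun) :
    G.antipode (G.antipode (G.antipode (G.antipode a))) = a :=
  let ⟨_, hl, hr⟩ := hG
  hr.antipode_eq_of_modular (hl.map_mul_comm hr.antipode_surjective (G.antipode a))

theorem IsUnimodular.antipode_antipode (hG : G.IsUnimodular) (a : G.Fun) :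
    G.antipode (G.antipode a) = a := by
  obtain ⟨φ, hl, hr⟩ := id hG
  let y := G.antipode (G.antipode a) - a
  have hy : G.antipode (G.antipode y) = -y := by
    simp only [y, map_sub, hG.antipode_iterate_four, neg_sub]
  refine sub_eq_zero.mp (funext fun i => hl.faithful i (y i) (le_antisymm ?_ (hl.nonneg i (y i))))
  have hmod : φ i (y i * star (y i)) = -φ i (star (y i) * y i) := by
    rw [hl.map_mul_comm hr.antipode_surjective y, hy, Pi.neg_apply, mul_neg, map_neg]
  have hnonneg := hl.nonneg i (star (y i))
  rw [star_star, hmod] at hnonneg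
  exact neg_nonneg.mp hnonneg

theorem IsUnimodular.antipode_star (hG : G.IsUnimodular) (f : G.Fun) :
    G.antipode (star f) = star (G.antipode f) := by
  obtain ⟨φ, -, hr⟩ := id hG
  rw [← hr.antipode_star_antipode f, hG.antipode_antipode]

end Haar

end DiscreteQuantumGroup

section UnitaryAntipode

open scoped Matrix.Norms.L2Operator MatrixOrder in
theorem commute_of_posSemidef_of_commute_mul_self {n : Type*} [Fintype n]
    {F a : Matrix n n ℂ} (hF : F.PosSemidef) (h : Commute (F * F) a) : Commute F a := by
  classical
  have hsqrt : Commute (CFC.sqrt (F * F)) a := h.cfcₙ_nnreal NNReal.sqrt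
  rwa [CFC.sqrt_mul_self F hF.nonneg] at hsqrt

namespace DiscreteQuantumGroup

variable {G : DiscreteQuantumGroup.{u}}

/- For `S = R (F · F⁻¹)` to preserve the adjoint, `F · F⁻¹` and `F⁻¹ · F` have to agree, that is,
`F * F` has to be central. -/
theorem IsUnitaryAntipode.eq_antipode {R : G.Fun →ₗ[ℂ] G.Fun} (hR : G.IsUnitaryAntipode R)
    (hS : ∀ f, G.antipode (star f) = star (G.antipode f)) : R = G.antipode := by
  obtain ⟨F, hF, hpol⟩ := hR.polar
  have mul_inv : F * F⁻¹ = 1 := funext fun i => Matrix.mul_nonsing_inv _ (hF i).det_pos.ne'.isUnit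
  have inv_mul : F⁻¹ * F = 1 := funext fun i => Matrix.nonsing_inv_mul _ (hF i).det_pos.ne'.isUnit
  have star_F : star F = F := funext fun i => (hF i).isHermitian
  have star_inv : star F⁻¹ = F⁻¹ := funext fun i => (hF i).isHermitian.inv
  have conj_eq : ∀ f, F * f * F⁻¹ = F⁻¹ * f * F := fun f => by
    have h := hS (star f)
    rw [hpol, hpol, ← hR.map_star, star_star, star_mul, star_mul, star_star, star_F, star_inv,
      ← mul_assoc] at h
    exact Function.LeftInverse.injective hR.involutive h
  have sq_comm : ∀ f, F * F * f = f * (F * F) := fun f =>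
    calc F * F * f = F * (F * f * F⁻¹) * F := by simp only [mul_assoc, inv_mul, mul_one]
      _ = F * F⁻¹ * f * (F * F) := by rw [conj_eq]; simp only [mul_assoc]
      _ = f * (F * F) := by rw [mul_inv, one_mul]
  have comm : ∀ f, F * f = f * F := fun f => funext fun i =>
    (commute_of_posSemidef_of_commute_mul_self (hF i).posSemidef (congrFun (sq_comm f) i)).eq
  refine LinearMap.ext fun f => ?_
  rw [hpol, comm, mul_assoc, mul_inv, mul_one]

theorem isUnitaryAntipode_antipode (hinv : ∀ f, G.antipode (G.antipode f) = f)
    (hS : ∀ f, G.antipode (star f) = star (G.antipode f)) : G.IsUnitaryAntipode G.antipode where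
  map_mul := G.antipode_mul
  map_star := hS
  involutive := hinv
  polar := ⟨1, fun _ => Matrix.PosDef.one, fun f => by
    have inv_one : (1 : G.Fun)⁻¹ = 1 := funext fun _ => inv_one
    rw [inv_one, mul_one, one_mul]⟩

end DiscreteQuantumGroup

end UnitaryAntipode

section AntiunitaryPairing

variable {H K : Type*} [NormedAddCommGroup H] [InnerProductSpace ℂ H] [NormedAddCommGroup K]
  [InnerProductSpace ℂ K]

theorem inner_antiunitary (J : H ≃ₗᵢ⋆[ℂ] K) (ξ η : H) : inner ℂ (J ξ) (J η) = inner ℂ η ξ :=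
  ((ConjSpace.toConj H).symm.trans J : ConjSpace H ≃ₗᵢ[ℂ] K).inner_map_map
    (ConjSpace.toConj H ξ) (ConjSpace.toConj H η)

variable [FiniteDimensional ℂ H]

/-- The vector `∑ i, e i ⊗ J (e i)` for an orthonormal basis `e`; it does not depend on `e`. -/
noncomputable def antiunitaryVec (J : H ≃ₗᵢ⋆[ℂ] K) : HTensor H K :=
  ∑ i, HTensor.tmul (stdOrthonormalBasis ℂ H i) (J (stdOrthonormalBasis ℂ H i))

/-- The coevaluation `1 ↦ ∑ i, e i ⊗ J (e i)` of the duality given by an antiunitary `J`. -/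
noncomputable def antiunitaryCoev (J : H ≃ₗᵢ⋆[ℂ] K) : ℂ →L[ℂ] HTensor H K :=
  ContinuousLinearMap.toSpanSingleton ℂ (antiunitaryVec J)

theorem tmul_antiunitaryCoev {L : Type*} [NormedAddCommGroup L] [InnerProductSpace ℂ L]
    (J : H ≃ₗᵢ⋆[ℂ] K) (l : L) (c : ℂ) :
    HTensor.tmul l (antiunitaryCoev J c) = c • ∑ i, HTensor.tmul l
      (HTensor.tmul (stdOrthonormalBasis ℂ H i) (J (stdOrthonormalBasis ℂ H i))) :=
  (TensorProduct.tmul_smul c l (antiunitaryVec J)).trans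
    (congrArg (c • ·) (TensorProduct.tmul_sum l _ _))

theorem antiunitaryCoev_tmul {L : Type*} [NormedAddCommGroup L] [InnerProductSpace ℂ L]
    (J : H ≃ₗᵢ⋆[ℂ] K) (c : ℂ) (l : L) :
    HTensor.tmul (antiunitaryCoev J c) l = c • ∑ i, HTensor.tmul
      (HTensor.tmul (stdOrthonormalBasis ℂ H i) (J (stdOrthonormalBasis ℂ H i))) l :=
  (TensorProduct.smul_tmul' c (antiunitaryVec J) l).symm.trans
    (congrArg (c • ·) (TensorProduct.sum_tmul _ _ l))

variable [FiniteDimensional ℂ K]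

/-- The evaluation `J ξ ⊗ η ↦ ⟪ξ, η⟫` of the duality given by an antiunitary `J`. -/
noncomputable def antiunitaryEv (J : H ≃ₗᵢ⋆[ℂ] K) : HTensor K H →L[ℂ] ℂ :=
  LinearMap.toContinuousLinearMap (E := HTensor K H) (TensorProduct.lift
    (LinearMap.mk₂ ℂ (fun (k : K) (h : H) => inner ℂ (J.symm k) h)
      (fun k k' h => by rw [map_add, inner_add_left])
      (fun c k h => by rw [map_smulₛₗ, inner_smul_left, Complex.conj_conj, smul_eq_mul])
      (fun _ _ _ => inner_add_right _ _ _)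
      (fun _ _ _ => inner_smul_right _ _ _)) : K ⊗[ℂ] H →ₗ[ℂ] ℂ)

theorem antiunitaryEv_tmul (J : H ≃ₗᵢ⋆[ℂ] K) (k : K) (h : H) :
    antiunitaryEv J (HTensor.tmul k h) = inner ℂ (J.symm k) h := rfl

theorem inner_antiunitaryVec (J : H ≃ₗᵢ⋆[ℂ] K) (y : HTensor H K) :
    inner ℂ (antiunitaryVec J) y = antiunitaryEv J.symm y := by
  suffices innerSL ℂ (antiunitaryVec J) = antiunitaryEv J.symm from
    congrArg (fun B : HTensor H K →L[ℂ] ℂ => B y) this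
  refine HTensor.ext fun ξ k => ?_
  obtain ⟨η, rfl⟩ := J.surjective k
  rw [innerSL_apply_apply, antiunitaryEv_tmul, antiunitaryVec, sum_inner]
  change _ = inner ℂ (J ξ) (J η)
  rw [inner_antiunitary, ← (stdOrthonormalBasis ℂ H).sum_inner_mul_inner]
  refine Finset.sum_congr rfl fun i _ => (TensorProduct.inner_tmul _ _ _ _ _).trans ?_
  rw [inner_antiunitary, mul_comm]

theorem antiunitaryCoev_eq_adjoint [CompleteSpace H] [CompleteSpace K] (J : H ≃ₗᵢ⋆[ℂ] K) :
    antiunitaryCoev J = ContinuousLinearMap.adjoint (antiunitaryEv J.symm) := by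
  refine (ContinuousLinearMap.eq_adjoint_iff _ _).mpr fun c y => ?_
  change inner ℂ (c • antiunitaryVec J) y = _
  rw [inner_smul_left, inner_antiunitaryVec, RCLike.inner_apply, mul_comm]

theorem antiunitary_zigzag_right (J : H ≃ₗᵢ⋆[ℂ] K) :
    HTensor.map (antiunitaryEv J) (.id ℂ K) ∘L
      ((HTensor.assoc K H K).symm : HTensor K (HTensor H K) →L[ℂ] HTensor (HTensor K H) K) ∘L
        HTensor.map (.id ℂ K) (antiunitaryCoev J) =
    ((HTensor.lid K).symm : K →L[ℂ] HTensor ℂ K) ∘L (HTensor.rid K : HTensor K ℂ →L[ℂ] K) := by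
  refine HTensor.ext fun k c => ?_
  obtain ⟨ξ, rfl⟩ := J.surjective k
  let e := stdOrthonormalBasis ℂ H
  have coordinate : ∀ i, HTensor.tmul (inner ℂ ξ (e i)) (J (e i)) =
      (HTensor.lid K).symm (J (inner ℂ (e i) ξ • e i)) := fun i => by
    rw [map_smulₛₗ, inner_conj_symm, HTensor.lid_symm_apply, HTensor.tmul_smul', smul_eq_mul,
      mul_one]
  change HTensor.map (antiunitaryEv J) (.id ℂ K) ((HTensor.assoc K H K).symm
    (HTensor.tmul (J ξ) (antiunitaryCoev J c))) = (HTensor.lid K).symm (c • J ξ)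
  rw [tmul_antiunitaryCoev]
  simp only [map_smul, map_sum, HTensor.assoc_symm_tmul, HTensor.map_tmul, antiunitaryEv_tmul,
    LinearIsometryEquiv.symm_apply_apply, ContinuousLinearMap.id_apply]
  refine congrArg (c • ·) ?_
  conv_rhs => rw [← e.sum_repr' ξ, map_sum, map_sum]
  exact Finset.sum_congr rfl fun i _ => coordinate i

theorem antiunitary_zigzag_left (J : H ≃ₗᵢ⋆[ℂ] K) :
    HTensor.map (.id ℂ H) (antiunitaryEv J) ∘L
      (HTensor.assoc H K H : HTensor (HTensor H K) H →L[ℂ] HTensor H (HTensor K H)) ∘L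
        HTensor.map (antiunitaryCoev J) (.id ℂ H) =
    ((HTensor.rid H).symm : H →L[ℂ] HTensor H ℂ) ∘L (HTensor.lid H : HTensor ℂ H →L[ℂ] H) := by
  refine HTensor.ext fun c ξ => ?_
  let e := stdOrthonormalBasis ℂ H
  have coordinate : ∀ i, HTensor.tmul (e i) (inner ℂ (e i) ξ) =
      (HTensor.rid H).symm (inner ℂ (e i) ξ • e i) := fun i => by
    rw [HTensor.rid_symm_apply, ← HTensor.tmul_smul', smul_eq_mul, mul_one]
  change HTensor.map (.id ℂ H) (antiunitaryEv J) ((HTensor.assoc H K H)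
    (HTensor.tmul (antiunitaryCoev J c) ξ)) = (HTensor.rid H).symm (c • ξ)
  rw [antiunitaryCoev_tmul]
  simp only [map_smul, map_sum, HTensor.assoc_tmul, HTensor.map_tmul, antiunitaryEv_tmul,
    LinearIsometryEquiv.symm_apply_apply, ContinuousLinearMap.id_apply]
  refine congrArg (c • ·) ?_
  conv_rhs => rw [← e.sum_repr' ξ, map_sum]
  exact Finset.sum_congr rfl fun i _ => coordinate i

end AntiunitaryPairing

section Rigidity

open scoped Matrix.Norms.L2Operator

variable {G : DiscreteQuantumGroup.{u}} {X : Type v} {H K : Type*}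
  [NormedAddCommGroup H] [InnerProductSpace ℂ H] [CompleteSpace H]
  [NormedAddCommGroup K] [InnerProductSpace ℂ K] [CompleteSpace K]

theorem NormalRep.isNormal_hom (φ : NormalRep G H) : IsNormal φ.hom.toAlgHom.toLinearMap := φ.dep

variable [FiniteDimensional ℂ H] [FiniteDimensional ℂ K]

namespace NormalRep

theorem mul_hom_eq_conv (ψ : NormalRep G K) (φ : NormalRep G H) (f : G.Fun) :
    (ψ.mul φ).hom f = DiscreteQuantumGroup.conv
      ((HTensor.mapBilin K H).flip 1 ∘ₗ ψ.hom.toAlgHom.toLinearMap)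
      (HTensor.mapBilin K H 1 ∘ₗ φ.hom.toAlgHom.toLinearMap) f := by
  obtain ⟨s, hs⟩ := ψ.isNormal_hom
  obtain ⟨t, ht⟩ := φ.isNormal_hom
  have block_ψ : ∀ i, i ∉ s → ψ.block i 1 = 0 := fun i hi =>
    LinearMap.congr_fun (comp_blockIncl_eq_zero hs hi) 1
  have block_φ : ∀ i, i ∉ t → φ.block i 1 = 0 := fun i hi =>
    LinearMap.congr_fun (comp_blockIncl_eq_zero ht hi) 1
  have hblock : ∀ p x, ψ.pairBlock φ p x = DiscreteQuantumGroup.mulOnBlock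
      ((HTensor.mapBilin K H).flip 1 ∘ₗ ψ.hom.toAlgHom.toLinearMap)
      (HTensor.mapBilin K H 1 ∘ₗ φ.hom.toAlgHom.toLinearMap) p x := fun p x => by
    induction x using TensorProduct.induction_on with
    | zero => rw [map_zero, map_zero]
    | add x y hx hy => rw [map_add, map_add, hx, hy]
    | tmul a b =>
      refine Eq.trans ?_ (HTensor.map_mul (ψ.block p.1 a) 1 1 (φ.block p.2 b))
      rw [mul_one, one_mul, pairBlock_tmul]
  rw [mul_hom, box_eq_sum ψ φ _ block_ψ block_φ,
    DiscreteQuantumGroup.conv_eq_sum (fun _ _ h => congrArg ((HTensor.mapBilin K H).flip 1) (hs h))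
      (fun _ _ h => congrArg (HTensor.mapBilin K H 1) (ht h)), LinearMap.sum_apply]
  exact Finset.sum_congr rfl fun p _ => hblock p _

/- Moving the first leg to the second one turns `(ψ ⊗ φ)Δ` into `(φ ∘ S) * φ = ε`. -/
theorem intertwines_counit_of_antipode_invariant {ψ : NormalRep G K} {φ : NormalRep G H}
    {B : HTensor K H →L[ℂ] ℂ}
    (hB : ∀ f, B ∘L HTensor.map (ψ.hom f) 1 = B ∘L HTensor.map 1 (φ.hom (G.antipode f))) :
    (ψ.mul φ).Intertwines (counit G) B := fun f => by
  let compB : (HTensor K H →L[ℂ] HTensor K H) →ₗ[ℂ] (HTensor K H →L[ℂ] ℂ) :=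
    (ContinuousLinearMap.compL ℂ (HTensor K H) (HTensor K H) ℂ B).toLinearMap
  have hmove : ∀ f g, B ∘L (HTensor.map (ψ.hom f) 1 * HTensor.map 1 (φ.hom g)) =
      B ∘L HTensor.map 1 (φ.hom (G.antipode f) * φ.hom g) := fun f g =>
    calc _ = (B ∘L HTensor.map (ψ.hom f) 1) ∘L HTensor.map 1 (φ.hom g) := rfl
      _ = B ∘L (HTensor.map 1 (φ.hom (G.antipode f)) * HTensor.map 1 (φ.hom g)) := by
        rw [hB]; rfl
      _ = _ := by rw [← HTensor.map_mul, one_mul]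
  have hconv := DiscreteQuantumGroup.map_conv_eq_map_conv (A := compB)
    (B := compB ∘ₗ HTensor.mapBilin K H 1)
    (ψ.isNormal_hom.postcomp ((HTensor.mapBilin K H).flip 1))
    (φ.isNormal_hom.postcomp (HTensor.mapBilin K H 1))
    (DiscreteQuantumGroup.isNormal_comp_antipode φ.isNormal_hom) φ.isNormal_hom hmove f
  calc B ∘L (ψ.mul φ).hom f = B ∘L HTensor.map 1 (DiscreteQuantumGroup.conv
          (φ.hom.toAlgHom.toLinearMap ∘ₗ G.antipode) φ.hom.toAlgHom.toLinearMap f) := by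
        rw [mul_hom_eq_conv]; exact hconv
    _ = B ∘L HTensor.map 1 (G.counit f • 1) := by
        rw [DiscreteQuantumGroup.conv_comp_antipode_left φ.isNormal_hom,
          AlgHom.toLinearMap_apply, DiscreteQuantumGroup.convUnit_apply]
    _ = G.counit f • B := by
        rw [← HTensor.mapBilin_apply, map_smul, HTensor.mapBilin_apply, HTensor.map_one,
          ContinuousLinearMap.comp_smul]
        rfl
    _ = (counit G).hom f ∘L B := ContinuousLinearMap.ext fun _ => rfl

end NormalRep

namespace WreathCorep

theorem Intertwines.adjoint {H K : Type*} [NormedAddCommGroup H] [InnerProductSpace ℂ H]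
    [CompleteSpace H] [NormedAddCommGroup K] [InnerProductSpace ℂ K] [CompleteSpace K]
    {π : WreathCorep G X H} {ρ : WreathCorep G X K} {T : H →L[ℂ] K} (h : π.Intertwines ρ T) :
    ρ.Intertwines π (ContinuousLinearMap.adjoint T) where
  rep x f := by
    have hrep := congrArg ContinuousLinearMap.adjoint (h.rep x (star f))
    rw [ContinuousLinearMap.adjoint_comp, ContinuousLinearMap.adjoint_comp, map_star (π.rep x),
      map_star (ρ.rep x), ContinuousLinearMap.star_eq_adjoint, ContinuousLinearMap.star_eq_adjoint,
      ContinuousLinearMap.adjoint_adjoint, ContinuousLinearMap.adjoint_adjoint] at hrep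
    exact hrep.symm
  perm x y := by
    have hperm := congrArg ContinuousLinearMap.adjoint (h.perm x y)
    rw [ContinuousLinearMap.adjoint_comp, ContinuousLinearMap.adjoint_comp,
      (π.perm.isProj x y).isSelfAdjoint.adjoint_eq,
      (ρ.perm.isProj x y).isSelfAdjoint.adjoint_eq] at hperm
    exact hperm.symm

/-- The antiunitary `J` identifies `ρ` with the conjugate of `π`. The representations are compared
after restriction to the ranges of the projections `ρ.perm.u x y`, where only one summand of the
contragredient is left. -/
structure IsConjugate (π : WreathCorep G X H) (ρ : WreathCorep G X K) (J : H ≃ₗᵢ⋆[ℂ] K) :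
    Prop where
  rep : ∀ x y f ξ, (ρ.ext x).hom f (ρ.perm.u x y (J ξ)) =
    J ((π.ext y).hom (G.antipode (star f)) (π.perm.u y x ξ))
  perm : ∀ x y ξ, ρ.perm.u x y (J ξ) = J (π.perm.u y x ξ)

namespace IsConjugate

variable {π : WreathCorep G X H} {ρ : WreathCorep G X K} {J : H ≃ₗᵢ⋆[ℂ] K}

theorem symm (h : π.IsConjugate ρ J) (hS : G.IsUnitaryAntipode G.antipode) :
    ρ.IsConjugate π J.symm where
  rep x y f k := by
    obtain ⟨ξ, rfl⟩ := J.surjective k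
    rw [h.rep, LinearIsometryEquiv.symm_apply_apply, LinearIsometryEquiv.symm_apply_apply,
      ← hS.map_star, star_star, hS.involutive]
  perm x y k := by
    obtain ⟨ξ, rfl⟩ := J.surjective k
    rw [h.perm, LinearIsometryEquiv.symm_apply_apply, LinearIsometryEquiv.symm_apply_apply]

theorem antiunitaryEv_comp_map_perm (h : π.IsConjugate ρ J) (x y : X) :
    antiunitaryEv J ∘L HTensor.map (ρ.perm.u x y) 1 =
      antiunitaryEv J ∘L HTensor.map 1 (π.perm.u y x) := by
  refine HTensor.ext fun k η => ?_
  obtain ⟨ξ, rfl⟩ := J.surjective k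
  simp only [ContinuousLinearMap.comp_apply, HTensor.map_tmul, antiunitaryEv_tmul, h.perm,
    LinearIsometryEquiv.symm_apply_apply, one_apply_eq_self]
  exact (π.perm.isProj y x).isSelfAdjoint.isSymmetric ξ η

theorem antiunitaryEv_comp_map_rep (h : π.IsConjugate ρ J)
    (hS : ∀ f, G.antipode (star f) = star (G.antipode f)) (x y : X) (f : G.Fun) :
    (antiunitaryEv J ∘L HTensor.map (ρ.perm.u x y) 1) ∘L
        HTensor.map ((ρ.ext x).hom f) (1 : H →L[ℂ] H) =
      (antiunitaryEv J ∘L HTensor.map (ρ.perm.u x y) 1) ∘L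
        HTensor.map 1 ((π.ext y).hom (G.antipode f)) := by
  refine HTensor.ext fun k η => ?_
  obtain ⟨ξ, rfl⟩ := J.surjective k
  have hrep : ρ.perm.u x y ((ρ.ext x).hom f (J ξ)) =
      J (star ((π.ext y).hom (G.antipode f)) (π.perm.u y x ξ)) := by
    rw [← map_star, ← hS, ← h.rep]
    exact congrArg (fun A : K →L[ℂ] K => A (J ξ)) (ρ.ext_comm x y f).symm
  simp only [ContinuousLinearMap.comp_apply, HTensor.map_tmul, antiunitaryEv_tmul, hrep, h.perm,
    LinearIsometryEquiv.symm_apply_apply, one_apply_eq_self]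
  exact ContinuousLinearMap.adjoint_inner_left _ _ _

theorem antiunitaryEv_comp_tensor_perm (h : π.IsConjugate ρ J) (x y : X) :
    antiunitaryEv J ∘L (ρ.tensor π).perm.u x y = (unit G X).perm.u x y ∘L antiunitaryEv J := by
  refine (ρ.perm.row_pou x).map_left.ext_comp (M := ℂ) fun z => ?_
  have hrow : (ρ.tensor π).perm.u x y ∘L HTensor.map (ρ.perm.u x z) 1 =
      HTensor.map (ρ.perm.u x z) 1 ∘L HTensor.map 1 (π.perm.u z y) :=
    (ρ.perm.tensorU_mul_row π.perm x y z).trans (by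
      rw [← HTensor.map_comp]; rfl)
  have hmove : antiunitaryEv J ∘L (ρ.tensor π).perm.u x y ∘L HTensor.map (ρ.perm.u x z) 1 =
      antiunitaryEv J ∘L HTensor.map 1 (π.perm.u z x * π.perm.u z y) := by
    rw [hrow, ← ContinuousLinearMap.comp_assoc, h.antiunitaryEv_comp_map_perm,
      ContinuousLinearMap.comp_assoc, ← HTensor.map_comp]
    rfl
  rw [ContinuousLinearMap.comp_assoc, hmove, ContinuousLinearMap.comp_assoc,
    h.antiunitaryEv_comp_map_perm]
  by_cases hxy : x = y
  · subst hxy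
    rw [trivial_diag, (π.perm.isProj z x).isIdempotentElem.eq]
    rfl
  · rw [trivial_row x y hxy, π.perm.row_orth z x y hxy, HTensor.map_zero_right,
      ContinuousLinearMap.comp_zero, ContinuousLinearMap.zero_comp]

theorem antiunitaryEv_intertwines (h : π.IsConjugate ρ J)
    (hS : ∀ f, G.antipode (star f) = star (G.antipode f)) :
    (ρ.tensor π).Intertwines (unit G X) (antiunitaryEv J) := by
  refine intertwines_of_ext (fun x => ?_) h.antiunitaryEv_comp_tensor_perm
  rw [tensor_ext, unit_ext]
  exact NormalRep.intertwines_of_pou (P := fun y => HTensor.map (ρ.perm.u x y) (1 : H →L[ℂ] H))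
    (ρ.perm.row_pou x).map_left (θ := fun y => (ρ.ext x).mul (π.ext y))
    (fun y => ρ.tensorRep_intertwines π x y (NormalRep.Intertwines.one _))
    (fun y => NormalRep.intertwines_counit_of_antipode_invariant
      (h.antiunitaryEv_comp_map_rep hS x y))

theorem antiunitaryCoev_intertwines (h : π.IsConjugate ρ J)
    (hS : G.IsUnitaryAntipode G.antipode) :
    (unit G X).Intertwines (π.tensor ρ) (antiunitaryCoev J) := by
  rw [antiunitaryCoev_eq_adjoint]
  exact ((h.symm hS).antiunitaryEv_intertwines hS.map_star).adjoint

end IsConjugate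

theorem isConjugate_contragredient (π : WreathCorep G X H)
    (hS : G.IsUnitaryAntipode G.antipode) :
    π.IsConjugate (π.contragredient hS) (ConjSpace.toConj H) where
  rep x y f ξ := by
    have hglue := NormalRep.glueProj_mul (fun y => (π.ext y).conj hS)
      (fun y => ConjSpace.bar (π.perm.u y x)) (ConjSpace.pou_bar (π.perm.col_pou x))
      (fun y => ConjSpace.isStarProjection_bar (π.perm.isProj y x)) (π.conj_comm hS x) f y
    rw [show (π.contragredient hS).ext x = π.contragredientRep hS x from ofNormal_ext _ _ _ x]
    exact congrArg (fun A : ConjSpace H →L[ℂ] ConjSpace H => A (ConjSpace.toConj H ξ)) hglue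
  perm _ _ _ := rfl

end WreathCorep

namespace FreeWreath

/-- The duality between conjugate objects; `ρ` is the right dual of `π`. -/
noncomputable abbrev exactPairing {π ρ : FreeWreath G X} {J : π.space ≃ₗᵢ⋆[ℂ] ρ.space}
    (h : π.corep.IsConjugate ρ.corep J) (hS : G.IsUnitaryAntipode G.antipode) :
    ExactPairing π ρ where
  coevaluation' := ⟨antiunitaryCoev J, h.antiunitaryCoev_intertwines hS⟩
  evaluation' := ⟨antiunitaryEv J, h.antiunitaryEv_intertwines hS.map_star⟩
  coevaluation_evaluation' := hom_ext (antiunitary_zigzag_right J)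
  evaluation_coevaluation' := hom_ext (antiunitary_zigzag_left J)

end FreeWreath

end Rigidity

/-- Every finite dimensional `X`-free wreath corepresentation of a unimodular discrete quantum group
is dualisable, with dual its contragredient, and the category of these is rigid. The first
clause records that the unitary antipode, on which the contragredient depends, is well defined. -/
theorem mainTheorem12 (G : DiscreteQuantumGroup.{u}) (hG : G.IsUnimodular) (X : Type v) :
    (∃! R : G.Fun →ₗ[ℂ] G.Fun, G.IsUnitaryAntipode R) ∧
    (∀ (R : G.Fun →ₗ[ℂ] G.Fun) (hR : G.IsUnitaryAntipode R) (π : FreeWreath G X),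
      Nonempty (ExactPairing π (π.contragredient hR)) ∧
      Nonempty (ExactPairing (π.contragredient hR) π)) ∧
    Nonempty (RigidCategory (FreeWreath G X)) := by
  have hS : G.IsUnitaryAntipode G.antipode :=
    DiscreteQuantumGroup.isUnitaryAntipode_antipode hG.antipode_antipode hG.antipode_star
  have eq_antipode : ∀ R, G.IsUnitaryAntipode R → R = G.antipode := fun R hR =>
    hR.eq_antipode hG.antipode_star
  have dual : ∀ (R : G.Fun →ₗ[ℂ] G.Fun) (hR : G.IsUnitaryAntipode R) (π : FreeWreath G X),
      Nonempty (ExactPairing π (π.contragredient hR)) ∧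
      Nonempty (ExactPairing (π.contragredient hR) π) := fun R hR π => by
    obtain rfl := eq_antipode R hR
    have h := π.corep.isConjugate_contragredient hR
    exact ⟨⟨FreeWreath.exactPairing (ρ := π.contragredient hR) h hR⟩,
      ⟨FreeWreath.exactPairing (π := π.contragredient hR) (h.symm hR) hR⟩⟩
  exact ⟨⟨_, hS, eq_antipode⟩, dual, ⟨
    { rightDual := fun π =>
        { rightDual := π.contragredient hS
          exact := (dual _ hS π).1.some }
      leftDual := fun π =>
        { leftDual := π.contragredient hS
          exact := (dual _ hS π).2.some } }⟩⟩
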